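/- Let $t<T$ and $c>0$ be real numbers, let $\theta\in\mathbb R$, $\sigma>0$, and let $Z_1,Z_2,\dots$ be i.i.d. copies of the normal form of the payment-per-loss variable $$Z=c\,(\min\{X,T\}-\min\{X,t\}),\qquad X\sim N(\theta,\sigma^2),$$ a doubly censored version of $X$. Let $\Phi,\phi$ be the standard normal cdf and pdf, and write $F_{\theta,\sigma}(x)=\Phi((x-\theta)/\sigma)$, $F=F_{\theta,\sigma}$. Let $F(t)\le a<1-b\le F(T)$ (Case 6), and let $m_n,m_n^*$ be non-negative integers with $\sqrt n\,(m_n/n-a)\to0$ and $\sqrt n\,(m_n^*/n-b)\to0$ (for example $m_n=\lfloor na\rfloor$, $m_n^*=\lfloor nb\rfloor$). For a sample with order statistics $z_{1:n}\le\dots\le z_{n:n}$, put $h(z)=z/c+t$ and define the sample winsorized moments $$\widehat W_k=\frac1n\Big[m_n\,h(z_{m_n+1:n})^k+\sum_{i=m_n+1}^{n-m_n^*}h(z_{i:n})^k+m_n^*\,h(z_{n-m_n^*:n})^k\Big],\quad k=1,2,$$ and the population winsorized moments, in which $F_Z^{-1}(\cdot\mid\theta,\sigma)$ is the quantile function of $Z$,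 $$W_k(\theta,\sigma)=a\,h(F_Z^{-1}(a\mid\theta,\sigma))^k+\int_a^{1-b}h(F_Z^{-1}(v\mid\theta,\sigma))^k\,dv+b\,h(F_Z^{-1}(1-b\mid\theta,\sigma))^k .$$ An MWM estimate is a pair $(\theta',\sigma')$ with $\sigma'>0$ and $F_{\theta',\sigma'}(t)\le a<1-b\le F_{\theta',\sigma'}(T)$ that solves $W_k(\theta',\sigma')=\widehat W_k$, $k=1,2$. Put $$c_k=c_k(a,b)=a\,\Phi^{-1}(a)^k+\int_a^{1-b}\Phi^{-1}(s)^k\,ds+b\,\Phi^{-1}(1-b)^k ,$$ $$\begin{aligned}\kappa_{ij}={}&c_{i+j}-c_ic_j-a\,\partial_a(c_{i+j}-c_ic_j)-b\,\partial_b(c_{i+j}-c_ic_j)+a(1-a)\,\partial_ac_i\,\partial_ac_j\\&+b(1-b)\,\partial_bc_i\,\partial_bc_j-ab\,(\partial_ac_i\,\partial_bc_j+\partial_bc_i\,\partial_ac_j),\end{aligned}$$ and $c_1^*=\kappa_{11}$, $c_2^*=\tfrac12\kappa_{12}$, $c_3^*=\tfrac14\kappa_{22}$; none of these depends on $\theta$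 or $\sigma$. Then: 1. $c_2-c_1^2>0$, and $$\partial_ac_k=\frac{k\,a\,\Phi^{-1}(a)^{k-1}}{\phi(\Phi^{-1}(a))},\qquad \partial_bc_k=-\frac{k\,b\,\Phi^{-1}(1-b)^{k-1}}{\phi(\Phi^{-1}(1-b))}.$$ 2. (Closed form.) A pair $(\theta',\sigma')$ with $\sigma'>0$ and $F_{\theta',\sigma'}(t)\le a<1-b\le F_{\theta',\sigma'}(T)$ is an MWM estimate if and only if it equals $$\widehat\sigma=\sqrt{(\widehat W_2-\widehat W_1^2)/(c_2-c_1^2)},\qquad \widehat\theta=\widehat W_1-c_1\widehat\sigma .$$ 3. Suppose in addition that $F(t)<a$ and $1-b<F(T)$. Then, with probability tending to one, $(\widehat\theta,\widehat\sigma)$ is an MWM estimate and $m_n\ge\#\{i\le n:Z_i=0\}$, $m_n^*\ge\#\{i\le n:Z_i=c(T-t)\}$. Moreover $\sqrt n\,\big((\widehat\theta,\widehat\sigma)-(\theta,\sigma)\big)$ converges in distribution to $N(0,S_{z,\mathrm{MWM}})$, where $$S_{z,\mathrm{MWM}}=\frac{\sigma^2}{(c_2-c_1^2)^2}\begin{bmatrix}c_1^*c_2^2-2c_1c_2c_2^*+c_1^2c_3^*&-c_1^*c_1c_2+c_2c_2^*+c_1^2c_2^*-c_1c_3^*\\-c_1^*c_1c_2+c_2c_2^*+c_1^2c_2^*-c_1c_3^*&c_1^*c_1^2-2c_1c_2^*+c_3^*\end{bmatrix}.$$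 4. Under the assumptions of 3, let $(\widehat\theta_{\mathrm{MLE}},\widehat\sigma_{\mathrm{MLE}})$ be a maximum likelihood estimator, i.e. a measurable function of the sample that maximizes $(\theta,\sigma)\mapsto\prod_{i\le n}f_Z(z_i\mid\theta,\sigma)$ over $\sigma>0$ whenever a maximizer exists, where $f_Z$ equals $F(t)$ at $0$, $1-F(T)$ at $c(T-t)$, $\phi\big((z/c+t-\theta)/\sigma\big)/(c\sigma)$ on $(0,c(T-t))$ and $0$ elsewhere. Then $\sqrt n\,\big((\widehat\theta_{\mathrm{MLE}},\widehat\sigma_{\mathrm{MLE}})-(\theta,\sigma)\big)$ converges in distribution to $N(0,S_{z,\mathrm{MLE}})$, where, with $\gamma=\frac{t-\theta}\sigma$, $\xi=\frac{T-\theta}\sigma$, $R=T-t$, $\bar\Phi=1-\Phi$, $\Lambda=\frac{\bar\Phi(\gamma)-\bar\Phi(\xi)}{\bar\Phi(\gamma)}$, $\Omega_1=\frac{\phi(\gamma)}{\bar\Phi(\gamma)-\bar\Phi(\xi)}$, $\Omega_2=\frac{\phi(\xi)}{\bar\Phi(\gamma)-\bar\Phi(\xi)}$, $$\begin{aligned}\psi_1&=-\Big[1+\gamma\Omega_1-\xi\Omega_2+\tfrac{\phi(\gamma)}{\Phi(\gamma)}\Omega_1+\tfrac{\phi(\xi)}{\bar\Phi(\xi)}\Omega_2\Big],\\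 \psi_2&=\tfrac{R\Omega_2}{\sigma}\Big[\tfrac{\phi(\xi)}{\bar\Phi(\xi)}-\xi\Big]+[\Omega_1-\Omega_2-\gamma],\\ \psi_3&=\big(\tfrac R\sigma\big)^2\Omega_2\Big(\xi-\tfrac{\phi(\xi)}{\bar\Phi(\xi)}\Big)-\Big[2-\gamma(\Omega_1-\Omega_2-\gamma)-\tfrac{\Omega_2R}{\sigma}\Big],\end{aligned}$$ $$S_{z,\mathrm{MLE}}=\frac{\Lambda^{-1}}{\bar\Phi(\gamma)(\psi_1\psi_3-\psi_2^2)}\,D\begin{bmatrix}-\psi_3&\sigma\psi_2\\\sigma\psi_2&-\sigma^2\psi_1\end{bmatrix}D',\qquad D=\begin{bmatrix}-\sigma&-\gamma\\0&1\end{bmatrix}.$$ Both covariance matrices have positive determinant, and the asymptotic relative efficiency of $(\widehat\theta,\widehat\sigma)$ with respect to the MLE (the square root of the ratio of the determinants of the asymptotic covariance matrices of the MLE and of the MWM estimator) equals $$\big(\det S_{z,\mathrm{MLE}}/\det S_{z,\mathrm{MWM}}\big)^{1/2}.$$ -/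

import Mathlib

open MeasureTheory ProbabilityTheory Filter Topology

noncomputable section

namespace MWM

/-- A parameter `(θ, σ)`: coordinate `0` is `θ`, coordinate `1` is `σ`. -/
abbrev Param := EuclideanSpace ℝ (Fin 2)

/-- Standard normal cdf `Φ`. -/
def Phi (x : ℝ) : ℝ := cdf (gaussianReal 0 1) x

/-- Standard normal pdf `φ`. -/
def phi (x : ℝ) : ℝ := gaussianPDFReal 0 1 x

/-- The `N(θ, σ²)` cdf `F(x) = Φ((x - θ)/σ)`. -/
def normalCDF (η : Param) (x : ℝ) : ℝ := Phi ((x - η 0) / η 1)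

/-- The `N(θ, σ²)` pdf `f(x) = φ((x - θ)/σ)/σ`. -/
def normalPDF (η : Param) (x : ℝ) : ℝ := phi ((x - η 0) / η 1) / η 1

/-- The quantile function `v ↦ inf {x | v ≤ F(x)}` of a probability law on `ℝ`. -/
def quantile (μ : Measure ℝ) (v : ℝ) : ℝ := sInf {x | v ≤ cdf μ x}

/-! ### The payment-per-loss variable -/

/-- The payment per loss `z = c (min(x, T) - min(x, t))` of a (log-)loss `x`. -/
def payment (c t T x : ℝ) : ℝ := c * (min x T - min x t)

/-- The law of `Z = c (min(X, T) - min(X, t))` where `X ∼ N(θ, σ²)`. -/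
def paymentLaw (c t T : ℝ) (η : Param) : Measure ℝ :=
  (gaussianReal (η 0) (Real.toNNReal (η 1 ^ 2))).map (payment c t T)

open Classical in
/-- The density `f_Z(z)` of `Z` (with respect to Lebesgue measure on `(0, c(T-t))` plus unit point
masses at `0` and at `c(T-t)`). -/
def paymentPDF (c t T : ℝ) (η : Param) (z : ℝ) : ℝ :=
  if z = 0 then normalCDF η t
  else if z = c * (T - t) then 1 - normalCDF η T
  else if 0 < z ∧ z < c * (T - t) then normalPDF η (z / c + t) / c
  else 0

/-- The winsorizing proportions leave only uncensored data: `F(t) ≤ a < 1 - b ≤ F(T)`. -/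
def FullyObserved (a b t T : ℝ) (η : Param) : Prop :=
  normalCDF η t ≤ a ∧ a < 1 - b ∧ 1 - b ≤ normalCDF η T

/-! ### Winsorized moments -/

/-- `h_Z(z) = z/c + t`. -/
def hZ (c t z : ℝ) : ℝ := z / c + t

/-- The winsorized `k`-th moment `a H(a)^k + ∫_a^{1-b} H(v)^k dv + b H(1-b)^k`. -/
def winsorizedMoment (H : ℝ → ℝ) (a b : ℝ) (k : ℕ) : ℝ :=
  a * H a ^ k + (∫ v in a..(1 - b), H v ^ k) + b * H (1 - b) ^ k

/-- The population winsorized moment `W_{z,k}(θ, σ)`. -/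
def popMoment (c t T a b : ℝ) (η : Param) (k : ℕ) : ℝ :=
  winsorizedMoment (fun v => hZ c t (quantile (paymentLaw c t T η) v)) a b k

/-- The order statistic `z_{i:n}`, `1 ≤ i ≤ n`, of a sample (and `0` for other `i`). -/
def orderStat {n : ℕ} (z : Fin n → ℝ) (i : ℕ) : ℝ :=
  if h : 1 ≤ i ∧ i ≤ n then z (Tuple.sort z ⟨i - 1, by omega⟩) else 0

/-- The sample winsorized moment `Ŵ_{z,k}`, winsorizing the `m` smallest and `m'` largest data. -/
def sampleMoment (c t : ℝ) {n : ℕ} (m m' : ℕ) (z : Fin n → ℝ) (k : ℕ) : ℝ :=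
  (1 / (n : ℝ)) *
    ((m : ℝ) * hZ c t (orderStat z (m + 1)) ^ k
      + ∑ i ∈ Finset.Icc (m + 1) (n - m'), hZ c t (orderStat z i) ^ k
      + (m' : ℝ) * hZ c t (orderStat z (n - m')) ^ k)

/-- `η = (θ, σ)` is an MWM estimate of the sample `z`: it matches the population
with the sample winsorized moments of orders `1` and `2`, in the parameter region where
`F(t) ≤ a < 1 - b ≤ F(T)`. -/
def IsMWM (c t T a b : ℝ) {n : ℕ} (m m' : ℕ) (z : Fin n → ℝ) (η : Param) : Prop :=
  0 < η 1 ∧ FullyObserved a b t T η ∧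
    popMoment c t T a b η 1 = sampleMoment c t m m' z 1 ∧
    popMoment c t T a b η 2 = sampleMoment c t m m' z 2

/-! ### The constants `c_k` and `c*_k` -/

/-- `c_k = a Φ⁻¹(a)^k + ∫_a^{1-b} Φ⁻¹(s)^k ds + b Φ⁻¹(1-b)^k`. -/
def ck (a b : ℝ) (k : ℕ) : ℝ := winsorizedMoment (quantile (gaussianReal 0 1)) a b k

/-- `∂c_k/∂a`. -/
def ckA (a b : ℝ) (k : ℕ) : ℝ := deriv (fun x => ck x b k) a

/-- `∂c_k/∂b`. -/
def ckB (a b : ℝ) (k : ℕ) : ℝ := deriv (fun y => ck a y k) b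

/-- The expression shared by `c*_1` (`i = j = 1`), `2 c*_2` (`i = 1`, `j = 2`)
and `4 c*_3` (`i = j = 2`). -/
def ckCov (a b : ℝ) (i j : ℕ) : ℝ :=
  ck a b (i + j) - ck a b i * ck a b j
    - a * deriv (fun x => ck x b (i + j) - ck x b i * ck x b j) a
    - b * deriv (fun y => ck a y (i + j) - ck a y i * ck a y j) b
    + a * (1 - a) * (ckA a b i * ckA a b j)
    + b * (1 - b) * (ckB a b i * ckB a b j)
    - a * b * (ckA a b i * ckB a b j + ckB a b i * ckA a b j)

/-- `c*_1`. -/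
def cs1 (a b : ℝ) : ℝ := ckCov a b 1 1

/-- `c*_2`. -/
def cs2 (a b : ℝ) : ℝ := ckCov a b 1 2 / 2

/-- `c*_3`. -/
def cs3 (a b : ℝ) : ℝ := ckCov a b 2 2 / 4

/-- The closed-form estimate `(θ̂, σ̂)`: `σ̂ = √((Ŵ₂ - Ŵ₁²)/(c₂ - c₁²))`, `θ̂ = Ŵ₁ - c₁ σ̂`. -/
def mwm (c t a b : ℝ) {n : ℕ} (m m' : ℕ) (z : Fin n → ℝ) : Param :=
  let W1 := sampleMoment c t m m' z 1
  let W2 := sampleMoment c t m m' z 2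
  let s := √((W2 - W1 ^ 2) / (ck a b 2 - ck a b 1 ^ 2))
  !₂[W1 - ck a b 1 * s, s]

/-- The matrix `S_{z,MWM}`. -/
def SMWM (a b σ : ℝ) : Matrix (Fin 2) (Fin 2) ℝ :=
  let c1 := ck a b 1
  let c2 := ck a b 2
  let s1 := cs1 a b
  let s2 := cs2 a b
  let s3 := cs3 a b
  (σ ^ 2 / (c2 - c1 ^ 2) ^ 2) •
    !![s1 * c2 ^ 2 - 2 * c1 * c2 * s2 + c1 ^ 2 * s3,
        -s1 * c1 * c2 + c2 * s2 + c1 ^ 2 * s2 - c1 * s3;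
       -s1 * c1 * c2 + c2 * s2 + c1 ^ 2 * s2 - c1 * s3,
        s1 * c1 ^ 2 - 2 * c1 * s2 + s3]

/-! ### Maximum likelihood -/

/-- The likelihood of `(θ, σ)` given the sample `z`. -/
def likelihood (c t T : ℝ) {n : ℕ} (z : Fin n → ℝ) (η : Param) : ℝ :=
  ∏ i, paymentPDF c t T η (z i)

/-- `η` maximizes the likelihood over `{(θ, σ) | σ > 0}`. -/
def IsLikelihoodMax (c t T : ℝ) {n : ℕ} (z : Fin n → ℝ) (η : Param) : Prop :=
  0 < η 1 ∧ ∀ η' : Param, 0 < η' 1 → likelihood c t T z η' ≤ likelihood c t T z η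

/-- `est` is a maximum likelihood estimator: a measurable function of the sample, which is a
maximizer of the likelihood for every sample whose likelihood has a maximizer. -/
def IsMLE (c t T : ℝ) (est : (n : ℕ) → (Fin n → ℝ) → Param) : Prop :=
  ∀ n, Measurable (est n) ∧
    ∀ z : Fin n → ℝ, (∃ η, IsLikelihoodMax c t T z η) → IsLikelihoodMax c t T z (est n z)

/-- The matrix `S_{z,MLE}`. -/
def SMLE (t T : ℝ) (η : Param) : Matrix (Fin 2) (Fin 2) ℝ :=
  let σ := η 1
  let γ := (t - η 0) / σ
  let ξ := (T - η 0) / σ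
  let R := T - t
  let Λ := ((1 - Phi γ) - (1 - Phi ξ)) / (1 - Phi γ)
  let Ω1 := phi γ / ((1 - Phi γ) - (1 - Phi ξ))
  let Ω2 := phi ξ / ((1 - Phi γ) - (1 - Phi ξ))
  let ψ1 := -(1 + γ * Ω1 - ξ * Ω2 + phi γ / Phi γ * Ω1 + phi ξ / (1 - Phi ξ) * Ω2)
  let ψ2 := R * Ω2 / σ * (phi ξ / (1 - Phi ξ) - ξ) + (Ω1 - Ω2 - γ)
  let ψ3 := (R / σ) ^ 2 * Ω2 * (ξ - phi ξ / (1 - Phi ξ))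
    - (2 - γ * (Ω1 - Ω2 - γ) - Ω2 * R / σ)
  let D : Matrix (Fin 2) (Fin 2) ℝ := !![-σ, -γ; 0, 1]
  (Λ⁻¹ / ((1 - Phi γ) * (ψ1 * ψ3 - ψ2 ^ 2))) •
    (D * !![-ψ3, σ * ψ2; σ * ψ2, -σ ^ 2 * ψ1] * D.transpose)

/-! ### Asymptotic normality and relative efficiency -/

/-- `est n` is `AN(η, S/n)`: `√n (est n - η)` converges in distribution to `N(0, S)`. -/
def IsAN {Ω : Type*} [MeasurableSpace Ω] (P : Measure Ω) [IsProbabilityMeasure P]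
    (est : ℕ → Ω → Param) (η : Param) (S : Matrix (Fin 2) (Fin 2) ℝ) : Prop :=
  S.PosSemidef ∧
    TendstoInDistribution (fun (n : ℕ) ω => √(n : ℝ) • (est n ω - η)) atTop
      (id : Param → Param) (fun _ => P) (multivariateGaussian 0 S)

/-- `r` is the asymptotic relative efficiency of `est` with respect to `ref` at `η`: both are
asymptotically normal with nondegenerate asymptotic covariance matrices `S` and `S₀`,
and `r = (det S₀ / det S)^{1/2}`. -/
def HasARE {Ω : Type*} [MeasurableSpace Ω] (P : Measure Ω) [IsProbabilityMeasure P]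
    (est ref : ℕ → Ω → Param) (η : Param) (r : ℝ) : Prop :=
  ∃ S S₀ : Matrix (Fin 2) (Fin 2) ℝ, IsAN P est η S ∧ IsAN P ref η S₀ ∧
    0 < S.det ∧ 0 < S₀.det ∧ r = √(S₀.det / S.det)

end MWM

end

/-!
The proof standardizes the data. Put `u = (t - θ) / σ` and `v = (T - θ) / σ`; then `h(Z)`
standardized is a standard normal variable clamped to `[u, v]`, and its law is `clampLaw u v`.

*Closed form.* On the window `F(t) ≤ a < 1 - b ≤ F(T)` the winsorized part of the quantile function
of `Z` never reaches the censored part, so `h (F_Z⁻¹ s) = θ + σ Φ⁻¹(s)` there. Hence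
`W₁ = θ + σ c₁` and `W₂ - W₁² = σ² (c₂ - c₁²)`, with `c₂ - c₁²` the variance of a clamped normal
variable, and the two moment equations are solved explicitly.

*Winsorized estimator.* Almost all limit theory is done along one filter, `inProb P` on `ℕ × Ω`,
for which "eventually" means "with probability tending to one". With respect to it, convergence in
probability is an ordinary `Tendsto`, and an estimator that equals its limit plus an average of a
bounded centred function of the observations up to `o(n^{-1/2})` (`IsAsympLinear`) is stable under
differentiable maps. A sample winsorized moment is the average of the data clamped at two order
statistics. Those order statistics are asymptotically linear by Bahadur's representation, and
replacing them by the population quantiles changes the average only through the first-order effect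
of moving the two clamping points. The result is asymptotic linearity of `(Ŵ₁, Ŵ₂)`, then of
`(θ̂, σ̂)` by the delta method. The covariances of the influence functions of the winsorized moments
are the numbers `κ_ij`, which identifies `S_{z,MWM}`; a central limit theorem for the averages then
gives the limit law. Since `F(t) < a` and `1 - b < F(T)`, the fraction of observations censored on
either side stays below the trimmed fraction with probability tending to one.

*Maximum likelihood.* In the coordinates `(u, v)` the log-likelihood is concave, strictly so once an
observation is uncensored, and it depends on the sample linearly, through the sum of a statistic in
`ℝ⁵`: the numbers of observations censored on either side, and the three coefficients of the
quadratic form in `(u, v)` that the uncensored ones contribute (`censorStat`). Therefore a critical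
point, when there is one, is the only maximizer (`isLikelihoodMax_iff`). The implicit function
theorem produces a critical point as a differentiable function of the averaged statistic
(`exists_likelihood_solution`), so with probability tending to one the maximum likelihood estimate
is that function of an average, and the delta method applies. The information equality
(`info_eq_integral`) turns its covariance into the inverse of the Fisher information, and a change
of coordinates into `S_{z,MLE}`.
-/

noncomputable section

namespace MWM

/-! ### The standard normal distribution -/

lemma phi_eq (x : ℝ) : phi x = (√(2 * Real.pi))⁻¹ * Real.exp (-x ^ 2 / 2) := by
  simp [phi, gaussianPDFReal]

lemma phi_pos (x : ℝ) : 0 < phi x := gaussianPDFReal_pos 0 1 x (by norm_num)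

lemma hasDerivAt_phi (x : ℝ) : HasDerivAt phi (-(x * phi x)) x := by
  have h : HasDerivAt (fun y : ℝ => (√(2 * Real.pi))⁻¹ * Real.exp (-y ^ 2 / 2))
      ((√(2 * Real.pi))⁻¹ * (Real.exp (-x ^ 2 / 2) * (-(2 * x) / 2))) x := by
    have h1 : HasDerivAt (fun y : ℝ => -y ^ 2 / 2) (-(2 * x) / 2) x := by
      simpa using ((hasDerivAt_pow 2 x).neg.div_const 2)
    exact (h1.exp).const_mul _
  have e : phi = fun y : ℝ => (√(2 * Real.pi))⁻¹ * Real.exp (-y ^ 2 / 2) := funext phi_eq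
  rw [e]
  convert h using 1
  ring

lemma continuous_phi : Continuous phi :=
  continuous_iff_continuousAt.2 fun x => (hasDerivAt_phi x).continuousAt

lemma phi_neg (x : ℝ) : phi (-x) = phi x := by simp [phi_eq]

lemma integrable_phi : Integrable phi := integrable_gaussianPDFReal 0 1

lemma integral_phi : ∫ x, phi x = 1 := integral_gaussianPDFReal_eq_one 0 (by norm_num)

lemma Phi_eq_integral (x : ℝ) : Phi x = ∫ y in Set.Iic x, phi y := by
  rw [Phi, cdf_eq_real, measureReal_def, gaussianReal_apply_eq_integral 0 (by norm_num),
    ENNReal.toReal_ofReal]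
  · rfl
  · exact integral_nonneg fun y => (phi_pos y).le

lemma Phi_sub (x y : ℝ) : Phi y - Phi x = ∫ z in x..y, phi z := by
  rw [Phi_eq_integral, Phi_eq_integral,
    intervalIntegral.integral_Iic_sub_Iic integrable_phi.integrableOn integrable_phi.integrableOn]

lemma one_sub_Phi (x : ℝ) : 1 - Phi x = ∫ y in Set.Ioi x, phi y := by
  rw [← integral_phi, Phi_eq_integral,
    ← intervalIntegral.integral_Iic_add_Ioi (b := x) integrable_phi.integrableOn
      integrable_phi.integrableOn]
  ring

lemma hasDerivAt_Phi (x : ℝ) : HasDerivAt Phi (phi x) x := by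
  have h : HasDerivAt (fun y => Phi 0 + ∫ z in (0 : ℝ)..y, phi z) (phi x) x :=
    (intervalIntegral.integral_hasDerivAt_right (continuous_phi.intervalIntegrable _ _)
      continuous_phi.stronglyMeasurable.stronglyMeasurableAtFilter
      continuous_phi.continuousAt).const_add _
  convert h using 1
  ext y
  rw [← Phi_sub]; ring

lemma continuous_Phi : Continuous Phi :=
  continuous_iff_continuousAt.2 fun x => (hasDerivAt_Phi x).continuousAt

lemma strictMono_Phi : StrictMono Phi :=
  strictMono_of_deriv_pos fun x => by rw [(hasDerivAt_Phi x).deriv]; exact phi_pos x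

lemma Phi_pos (x : ℝ) : 0 < Phi x :=
  (cdf_nonneg (gaussianReal 0 1) (x - 1)).trans_lt (strictMono_Phi (by linarith))

lemma Phi_lt_one (x : ℝ) : Phi x < 1 :=
  (strictMono_Phi (show x < x + 1 by linarith)).trans_le (cdf_le_one (gaussianReal 0 1) (x + 1))

lemma Phi_neg (x : ℝ) : Phi (-x) = 1 - Phi x := by
  rw [one_sub_Phi, Phi_eq_integral, ← integral_comp_neg_Ioi]
  simp [phi_neg]

lemma exists_Phi_eq {v : ℝ} (h0 : 0 < v) (h1 : v < 1) : ∃ x, Phi x = v := by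
  have hb : ∃ x, Phi x ≤ v :=
    (((tendsto_cdf_atBot (gaussianReal 0 1)).eventually_lt_const h0).exists).imp fun _ h => h.le
  have ht : ∃ x, v ≤ Phi x :=
    (((tendsto_cdf_atTop (gaussianReal 0 1)).eventually_const_lt h1).exists).imp fun _ h => h.le
  obtain ⟨x, hx⟩ := hb
  obtain ⟨y, hy⟩ := ht
  exact mem_range_of_exists_le_of_exists_ge continuous_Phi ⟨x, hx⟩ ⟨y, hy⟩

/-- The standard normal quantile function `Φ⁻¹`. -/
def q (v : ℝ) : ℝ := quantile (gaussianReal 0 1) v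

lemma q_Phi (x : ℝ) : q (Phi x) = x := by
  have : {y | Phi x ≤ cdf (gaussianReal 0 1) y} = Set.Ici x := by
    ext y; exact strictMono_Phi.le_iff_le
  rw [q, quantile, this, csInf_Ici]

lemma Phi_q {v : ℝ} (h0 : 0 < v) (h1 : v < 1) : Phi (q v) = v := by
  obtain ⟨x, rfl⟩ := exists_Phi_eq h0 h1
  rw [q_Phi]

lemma q_lt_q {v w : ℝ} (h0 : 0 < v) (hvw : v < w) (h1 : w < 1) : q v < q w := by
  rw [← strictMono_Phi.lt_iff_lt, Phi_q h0 (hvw.trans h1), Phi_q (h0.trans hvw) h1]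
  exact hvw

lemma continuousAt_q {v : ℝ} (h0 : 0 < v) (h1 : v < 1) : ContinuousAt q v := by
  have hm : StrictMonoOn q (Set.Ioo 0 1) := fun x hx y hy h => q_lt_q hx.1 h hy.2
  refine hm.continuousAt_of_image_mem_nhds (Ioo_mem_nhds h0 h1) ?_
  convert univ_mem
  ext x
  simp only [Set.mem_image, Set.mem_univ, iff_true]
  exact ⟨Phi x, ⟨Phi_pos x, Phi_lt_one x⟩, q_Phi x⟩

lemma hasDerivAt_q {v : ℝ} (h0 : 0 < v) (h1 : v < 1) : HasDerivAt q (phi (q v))⁻¹ v := by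
  refine (hasDerivAt_Phi (q v)).of_local_left_inverse (continuousAt_q h0 h1) (phi_pos _).ne' ?_
  filter_upwards [Ioo_mem_nhds h0 h1] with w hw
  exact Phi_q hw.1 hw.2

/-- Mills' bound in the form `φ(x) + x Φ(x) ≥ 0`: it says that `log Φ` is concave. -/
lemma phi_add_mul_Phi_nonneg (x : ℝ) : 0 ≤ phi x + x * Phi x := by
  rcases le_or_gt 0 x with hx | hx
  · have := phi_pos x; have := Phi_pos x; positivity
  · have hint : Integrable fun s : ℝ => -(s * phi s) := by
      have := ((integrable_mul_exp_neg_mul_sq (b := 1 / 2) (by norm_num)).const_mul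
        (√(2 * Real.pi))⁻¹).neg
      refine this.congr (ae_of_all _ fun s => ?_)
      simp only [Pi.neg_apply, phi_eq]
      ring_nf
    have hlim : Tendsto phi atBot (𝓝 0) := by
      have h0 : Tendsto (fun y : ℝ => Real.exp (-y ^ 2 / 2)) atBot (𝓝 0) := by
        refine Real.tendsto_exp_atBot.comp ?_
        refine Tendsto.atBot_div_const (by norm_num) (tendsto_neg_atTop_atBot.comp ?_)
        exact ((tendsto_pow_atTop (α := ℝ) (n := 2) (by norm_num)).comp
          tendsto_abs_atBot_atTop).congr fun y => by simp
      have := h0.const_mul (√(2 * Real.pi))⁻¹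
      rw [mul_zero] at this
      exact this.congr fun y => (phi_eq y).symm
    have hF : ∫ s in Set.Iic x, -(s * phi s) = phi x := by
      have := integral_Iic_of_hasDerivAt_of_tendsto' (a := x) (f := phi)
        (fun y _ => hasDerivAt_phi y) hint.integrableOn hlim
      simpa using this
    have hle : ∫ s in Set.Iic x, -(x * phi s) ≤ ∫ s in Set.Iic x, -(s * phi s) := by
      refine setIntegral_mono_on (integrable_phi.const_mul x).neg.integrableOn hint.integrableOn
        measurableSet_Iic fun s hs => ?_
      have := phi_pos s
      have hs' : s ≤ x := hs
      nlinarith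
    rw [hF, integral_neg, integral_const_mul, ← Phi_eq_integral] at hle
    linarith

lemma hasDerivAt_log_Phi (x : ℝ) : HasDerivAt (fun y => Real.log (Phi y)) (phi x / Phi x) x :=
  (hasDerivAt_Phi x).log (Phi_pos x).ne'

lemma hasDerivAt_phi_div_Phi (x : ℝ) :
    HasDerivAt (fun y => phi y / Phi y) (-(x * phi x / Phi x + (phi x / Phi x) ^ 2)) x := by
  have hP := (Phi_pos x).ne'
  refine ((hasDerivAt_phi x).div (hasDerivAt_Phi x) hP).congr_deriv ?_
  field_simp
  ring

lemma deriv_phi_div_Phi_nonneg (x : ℝ) : 0 ≤ x * phi x / Phi x + (phi x / Phi x) ^ 2 := by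
  have hP := Phi_pos x
  have e : x * phi x / Phi x + (phi x / Phi x) ^ 2 = phi x * (phi x + x * Phi x) / Phi x ^ 2 := by
    field_simp; ring
  rw [e]
  have := phi_add_mul_Phi_nonneg x
  have := phi_pos x
  positivity

/-- The tangent line inequality for the concave function `log Φ`. -/
lemma log_Phi_le (x y : ℝ) :
    Real.log (Phi y) ≤ Real.log (Phi x) + phi x / Phi x * (y - x) := by
  have hanti : Antitone fun z => phi z / Phi z := by
    refine antitone_of_deriv_nonpos (fun z => (hasDerivAt_phi_div_Phi z).differentiableAt)
      fun z => ?_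
    rw [(hasDerivAt_phi_div_Phi z).deriv]
    linarith [deriv_phi_div_Phi_nonneg z]
  have hconc : ConcaveOn ℝ Set.univ fun z => Real.log (Phi z) := by
    refine Antitone.concaveOn_univ_of_deriv
      (fun z => (hasDerivAt_log_Phi z).differentiableAt) ?_
    intro a b hab
    rw [(hasDerivAt_log_Phi a).deriv, (hasDerivAt_log_Phi b).deriv]
    exact hanti hab
  rcases lt_trichotomy x y with h | h | h
  · have := hconc.slope_le_of_hasDerivAt (Set.mem_univ x) (Set.mem_univ y) h (hasDerivAt_log_Phi x)
    rw [slope_def_field, div_le_iff₀ (by linarith)] at this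
    linarith
  · simp [h]
  · have := hconc.le_slope_of_hasDerivAt (Set.mem_univ y) (Set.mem_univ x) h (hasDerivAt_log_Phi x)
    rw [slope_def_field, le_div_iff₀ (by linarith)] at this
    linarith

/-- The tangent line inequality for the concave function `log (1 - Φ)`. -/
lemma log_one_sub_Phi_le (x y : ℝ) :
    Real.log (1 - Phi y) ≤ Real.log (1 - Phi x) - phi x / (1 - Phi x) * (y - x) := by
  have := log_Phi_le (-x) (-y)
  rw [Phi_neg, Phi_neg, phi_neg] at this
  linarith

/-! ### Integrals of functions that are constant on both tails -/

/-- The function equal to `L` on `(-∞, p]`, to `g` on `(p, r)` and to `R` on `[r, ∞)`. -/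
def tails (p r L R : ℝ) (g : ℝ → ℝ) (x : ℝ) : ℝ := if x ≤ p then L else if x < r then g x else R

lemma measurable_tails {p r L R : ℝ} {g : ℝ → ℝ} (hg : Measurable g) :
    Measurable (tails p r L R g) := by
  unfold tails
  exact Measurable.ite measurableSet_Iic measurable_const
    (Measurable.ite measurableSet_Iio hg measurable_const)

lemma abs_tails_le (p r L R : ℝ) {g : ℝ → ℝ} (hg : Continuous g) :
    ∃ C, ∀ x, |tails p r L R g x| ≤ C := by
  obtain ⟨K, hK⟩ := (isCompact_Icc (a := p) (b := r)).exists_bound_of_continuousOn hg.continuousOn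
  refine ⟨|L| + |R| + |K|, fun x => ?_⟩
  have hL := abs_nonneg L
  have hR := abs_nonneg R
  have hK0 := abs_nonneg K
  unfold tails
  split_ifs with h1 h2
  · linarith
  · have := hK x ⟨(not_le.1 h1).le, h2.le⟩
    rw [Real.norm_eq_abs] at this
    have := le_abs_self K
    linarith
  · linarith

lemma integral_tails {p r L R : ℝ} (hpr : p ≤ r) {g : ℝ → ℝ} (hg : Continuous g) :
    ∫ x, tails p r L R g x ∂(gaussianReal 0 1)
      = Phi p * L + (∫ x in p..r, g x * phi x) + (1 - Phi r) * R := by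
  obtain ⟨C, hC⟩ := abs_tails_le p r L R hg
  have hint : Integrable fun x => phi x * tails p r L R g x := by
    refine (integrable_phi.const_mul C).mono'
      (continuous_phi.measurable.mul (measurable_tails hg.measurable)).aestronglyMeasurable
      (ae_of_all _ fun x => ?_)
    rw [Real.norm_eq_abs, abs_mul, abs_of_pos (phi_pos x), mul_comm]
    exact mul_le_mul_of_nonneg_right (hC x) (phi_pos x).le
  rw [integral_gaussianReal_eq_integral_smul (by norm_num)]
  change ∫ x, phi x * tails p r L R g x = _
  have h1 : ∫ x in Set.Iic p, phi x * tails p r L R g x = Phi p * L := by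
    rw [Phi_eq_integral, ← integral_mul_const]
    refine setIntegral_congr_fun measurableSet_Iic fun x hx => ?_
    have : x ≤ p := hx
    simp [tails, this]
  have h3 : ∫ x in Set.Ioi r, phi x * tails p r L R g x = (1 - Phi r) * R := by
    rw [one_sub_Phi, ← integral_mul_const]
    refine setIntegral_congr_fun measurableSet_Ioi fun x hx => ?_
    have : r < x := hx
    simp [tails, not_le.2 (hpr.trans_lt this), this.le]
  have h2 : ∫ x in p..r, phi x * tails p r L R g x = ∫ x in p..r, g x * phi x := by
    rw [intervalIntegral.integral_of_le hpr, intervalIntegral.integral_of_le hpr,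
      integral_Ioc_eq_integral_Ioo, integral_Ioc_eq_integral_Ioo]
    refine setIntegral_congr_fun measurableSet_Ioo fun x hx => ?_
    simp [tails, not_le.2 hx.1, hx.2, mul_comm]
  rw [← intervalIntegral.integral_Iic_add_Ioi (b := r) hint.integrableOn hint.integrableOn, h3,
    ← h2, ← h1, ← intervalIntegral.integral_Iic_sub_Iic hint.integrableOn hint.integrableOn]
  ring

/-! ### The constants `c_k` -/

/-- The substitution `s = Φ(y)` in the definition of `c_k`. -/
lemma integral_q_pow {a b : ℝ} (ha : 0 < a) (hab : a < b) (hb : b < 1) (k : ℕ) :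
    ∫ v in a..b, q v ^ k = ∫ y in (q a)..(q b), y ^ k * phi y := by
  have h := intervalIntegral.integral_comp_mul_deriv'' (a := q a) (b := q b) (f := Phi) (f' := phi)
    (g := fun v => q v ^ k) continuous_Phi.continuousOn
    (fun x _ => (hasDerivAt_Phi x).hasDerivWithinAt) continuous_phi.continuousOn
    (by
      rintro v ⟨x, hx, rfl⟩
      exact ((continuousAt_q (Phi_pos x) (Phi_lt_one x)).pow k).continuousWithinAt)
  rw [Phi_q ha (hab.trans hb), Phi_q (ha.trans hab) hb] at h
  rw [← h]
  simp [q_Phi]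

lemma ck_eq {a b : ℝ} (ha : 0 < a) (hab : a < 1 - b) (hb : 0 < b) (k : ℕ) :
    ck a b k = a * q a ^ k + (∫ y in (q a)..(q (1 - b)), y ^ k * phi y) + b * q (1 - b) ^ k := by
  rw [← integral_q_pow ha hab (by linarith)]
  rfl

lemma intervalIntegrable_q_pow {u v : ℝ} (hu : u ∈ Set.Ioo (0 : ℝ) 1) (hv : v ∈ Set.Ioo (0 : ℝ) 1)
    (k : ℕ) : IntervalIntegrable (fun s => q s ^ k) volume u v := by
  refine ContinuousOn.intervalIntegrable fun s hs => ?_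
  have hs' : s ∈ Set.Ioo (0 : ℝ) 1 := (Set.ordConnected_Ioo.uIcc_subset hu hv) hs
  exact ((continuousAt_q hs'.1 hs'.2).pow k).continuousWithinAt

lemma stronglyMeasurableAtFilter_q_pow {v : ℝ} (h0 : 0 < v) (h1 : v < 1) (k : ℕ) :
    StronglyMeasurableAtFilter (fun s => q s ^ k) (𝓝 v) := by
  refine ContinuousOn.stronglyMeasurableAtFilter (s := Set.Ioo 0 1) isOpen_Ioo (fun s hs => ?_) v
    ⟨h0, h1⟩
  exact ((continuousAt_q hs.1 hs.2).pow k).continuousWithinAt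

lemma hasDerivAt_ck_left {a b : ℝ} (ha : 0 < a) (hab : a < 1 - b) (hb : 0 < b) (k : ℕ) :
    HasDerivAt (fun x => ck x b k) (k * a * q a ^ (k - 1) / phi (q a)) a := by
  have h1 : a < 1 := by linarith
  have hq := (hasDerivAt_q ha h1).pow k
  have hI := intervalIntegral.integral_hasDerivAt_left
    (intervalIntegrable_q_pow (k := k) ⟨ha, h1⟩ ⟨ha.trans hab, by linarith⟩)
    (stronglyMeasurableAtFilter_q_pow ha h1 k) ((continuousAt_q ha h1).pow k)
  have h := (((hasDerivAt_id a).mul hq).add hI).add_const (b * q (1 - b) ^ k)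
  refine h.congr_deriv ?_
  simp only [Pi.pow_apply, id]
  ring

lemma hasDerivAt_ck_right {a b : ℝ} (ha : 0 < a) (hab : a < 1 - b) (hb : 0 < b) (k : ℕ) :
    HasDerivAt (fun y => ck a y k) (-(k * b * q (1 - b) ^ (k - 1) / phi (q (1 - b)))) b := by
  have h0 : 0 < 1 - b := ha.trans hab
  have h1 : 1 - b < 1 := by linarith
  have hs : HasDerivAt (fun y : ℝ => 1 - y) (-1) b := by
    simpa using (hasDerivAt_id b).const_sub 1
  have hq : HasDerivAt (fun y : ℝ => q (1 - y) ^ k)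
      (k * q (1 - b) ^ (k - 1) * ((phi (q (1 - b)))⁻¹ * (-1))) b :=
    ((hasDerivAt_q h0 h1).comp b hs).pow k
  have hI : HasDerivAt (fun y : ℝ => ∫ v in a..(1 - y), q v ^ k) (q (1 - b) ^ k * (-1)) b :=
    (intervalIntegral.integral_hasDerivAt_right
    (intervalIntegrable_q_pow (k := k) ⟨ha, by linarith⟩ ⟨h0, h1⟩)
    (stronglyMeasurableAtFilter_q_pow h0 h1 k) ((continuousAt_q h0 h1).pow k)).comp b hs
  have h := (hI.const_add (a * q a ^ k)).add ((hasDerivAt_id b).mul hq)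
  refine h.congr_deriv ?_
  simp only [id]
  ring

/-! ### Truncated normal moments -/

/-- The truncated moment `∫_p^r y^k φ(y) dy`. -/
def truncMoment (p r : ℝ) (k : ℕ) : ℝ := ∫ y in p..r, y ^ k * phi y

lemma truncMoment_zero (p r : ℝ) : truncMoment p r 0 = Phi r - Phi p := by
  simp [truncMoment, Phi_sub]

lemma integral_mul_phi_quartic (p r e0 e1 e2 e3 e4 : ℝ) :
    ∫ y in p..r, (e0 + e1 * y + e2 * y ^ 2 + e3 * y ^ 3 + e4 * y ^ 4) * phi y
      = e0 * truncMoment p r 0 + e1 * truncMoment p r 1 + e2 * truncMoment p r 2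
        + e3 * truncMoment p r 3 + e4 * truncMoment p r 4 := by
  have hi : ∀ (e : ℝ) (k : ℕ), IntervalIntegrable (fun y => e * (y ^ k * phi y)) volume p r :=
    fun e k => (continuous_const.mul ((continuous_pow k).mul continuous_phi)).intervalIntegrable _ _
  simp only [truncMoment, ← intervalIntegral.integral_const_mul]
  rw [← intervalIntegral.integral_add (hi _ _) (hi _ _),
    ← intervalIntegral.integral_add ((hi _ _).add (hi _ _)) (hi _ _),
    ← intervalIntegral.integral_add (((hi _ _).add (hi _ _)).add (hi _ _)) (hi _ _),
    ← intervalIntegral.integral_add ((((hi _ _).add (hi _ _)).add (hi _ _)).add (hi _ _)) (hi _ _)]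
  refine intervalIntegral.integral_congr fun y _ => ?_
  ring

/-- A polynomial of degree one or two does not vanish on an interval, so that its square has a
positive normal integral there. -/
lemma integral_sq_quadratic_pos {p r : ℝ} (hpr : p < r) {x1 x2 : ℝ} (hx : x1 ≠ 0 ∨ x2 ≠ 0)
    (e : ℝ) : 0 < ∫ y in p..r, (e + x1 * y + x2 * y ^ 2) ^ 2 * phi y := by
  have hcont : Continuous fun y => (e + x1 * y + x2 * y ^ 2) ^ 2 * phi y :=
    (by fun_prop : Continuous fun y : ℝ => (e + x1 * y + x2 * y ^ 2) ^ 2).mul continuous_phi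
  refine intervalIntegral.integral_pos hpr hcont.continuousOn
    (fun y _ => mul_nonneg (sq_nonneg _) (phi_pos y).le) ?_
  by_contra! hcon
  have key : ∀ y ∈ Set.Icc p r, e + x1 * y + x2 * y ^ 2 = 0 := fun y hy => by
    have h1 := hcon y hy
    have h2 := phi_pos y
    have h3 : (e + x1 * y + x2 * y ^ 2) ^ 2 = 0 := by
      have := sq_nonneg (e + x1 * y + x2 * y ^ 2)
      nlinarith
    exact pow_eq_zero_iff two_ne_zero |>.1 h3
  have k1 := key p ⟨le_rfl, hpr.le⟩
  have k2 := key r ⟨hpr.le, le_rfl⟩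
  have k3 := key ((p + r) / 2) ⟨by linarith, by linarith⟩
  have hd : r - p ≠ 0 := by linarith
  have m2 : x2 = 0 := by
    have : (r - p) ^ 2 * x2 = 0 := by linear_combination 2 * k1 + 2 * k2 - 4 * k3
    simpa [hd] using this
  have m1 : x1 = 0 := by
    have : (r - p) * x1 = 0 := by rw [m2] at k1 k2; linear_combination k2 - k1
    simpa [hd] using this
  rcases hx with h | h
  · exact h m1
  · exact h m2

lemma ck_eq_truncMoment {a b : ℝ} (ha : 0 < a) (hab : a < 1 - b) (hb : 0 < b) (k : ℕ) :
    ck a b k = a * q a ^ k + truncMoment (q a) (q (1 - b)) k + b * q (1 - b) ^ k :=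
  ck_eq ha hab hb k

lemma truncMoment_q_zero {a b : ℝ} (ha : 0 < a) (hab : a < 1 - b) (hb : 0 < b) :
    truncMoment (q a) (q (1 - b)) 0 = 1 - a - b := by
  rw [truncMoment_zero, Phi_q ha (by linarith), Phi_q (ha.trans hab) (by linarith)]
  ring

/-- `c₂ - c₁²` is the variance of the standard normal variable winsorized at `Φ⁻¹(a)` and
`Φ⁻¹(1 - b)`. -/
lemma ck_two_sub_sq_pos {a b : ℝ} (ha : 0 < a) (hab : a < 1 - b) (hb : 0 < b) :
    0 < ck a b 2 - ck a b 1 ^ 2 := by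
  set c1 := ck a b 1 with hc1
  have h1 := ck_eq_truncMoment ha hab hb 1
  have h2 := ck_eq_truncMoment ha hab hb 2
  have h0 := truncMoment_q_zero ha hab hb
  have hpos := integral_sq_quadratic_pos (q_lt_q ha hab (by linarith)) (x1 := 1) (x2 := 0)
    (by simp) (-c1)
  have hexp : ∫ y in (q a)..(q (1 - b)), (-c1 + 1 * y + 0 * y ^ 2) ^ 2 * phi y
      = c1 ^ 2 * truncMoment (q a) (q (1 - b)) 0 + (-2 * c1) * truncMoment (q a) (q (1 - b)) 1
        + 1 * truncMoment (q a) (q (1 - b)) 2 + 0 * truncMoment (q a) (q (1 - b)) 3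
        + 0 * truncMoment (q a) (q (1 - b)) 4 := by
    rw [← integral_mul_phi_quartic]
    refine intervalIntegral.integral_congr fun y _ => ?_
    ring
  rw [hexp, h0] at hpos
  rw [h2]
  rw [← hc1] at h1
  have e1 : 0 ≤ a * (q a - c1) ^ 2 := mul_nonneg ha.le (sq_nonneg _)
  have e2 : 0 ≤ b * (q (1 - b) - c1) ^ 2 := mul_nonneg hb.le (sq_nonneg _)
  have h1' : truncMoment (q a) (q (1 - b)) 1 = c1 - a * q a - b * q (1 - b) := by
    simp only [pow_one] at h1; linarith
  rw [h1'] at hpos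
  nlinarith

/-! ### The payment per loss -/

lemma hZ_payment {c t T : ℝ} (hc : 0 < c) (htT : t < T) (x : ℝ) :
    hZ c t (payment c t T x) = max t (min T x) := by
  unfold hZ payment
  rw [mul_div_cancel_left₀ _ hc.ne']
  rcases le_total x t with h | h
  · rw [min_eq_left h, min_eq_left (h.trans htT.le), min_eq_right (h.trans htT.le), max_eq_left h]
    ring
  · rcases le_total x T with h' | h'
    · rw [min_eq_right h, min_eq_left h', min_eq_right h', max_eq_right h]; ring
    · rw [min_eq_right h, min_eq_right h', min_eq_left h', max_eq_right htT.le]; ring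

lemma payment_eq {c t T : ℝ} (hc : 0 < c) (htT : t < T) (x : ℝ) :
    payment c t T x = c * (max t (min T x) - t) := by
  rw [← hZ_payment hc htT, hZ]
  field_simp
  ring

lemma continuous_payment (c t T : ℝ) : Continuous (payment c t T) := by
  unfold payment; fun_prop

lemma paymentLaw_eq_map (c t T : ℝ) (η : Param) :
    paymentLaw c t T η = (gaussianReal 0 1).map fun x => payment c t T (η 0 + η 1 * x) := by
  have h1 : gaussianReal (η 0) (Real.toNNReal (η 1 ^ 2))
      = (gaussianReal 0 1).map fun x => η 0 + η 1 * x := by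
    have e : (fun x => η 0 + η 1 * x) = (fun x => η 0 + x) ∘ (fun x => η 1 * x) := rfl
    rw [e, ← Measure.map_map (by fun_prop) (by fun_prop), gaussianReal_map_const_mul,
      gaussianReal_map_const_add]
    congr 1
    · simp
    · ext
      simp [sq_nonneg]
  rw [paymentLaw, h1, Measure.map_map (continuous_payment c t T).measurable (by fun_prop)]
  rfl

instance (c t T : ℝ) (η : Param) : IsProbabilityMeasure (paymentLaw c t T η) :=
  Measure.isProbabilityMeasure_map (continuous_payment c t T).measurable.aemeasurable

lemma cdf_paymentLaw {c t T : ℝ} (hc : 0 < c) (htT : t < T) {η : Param} (hη : 0 < η 1) (z : ℝ) :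
    cdf (paymentLaw c t T η) z =
      if z < 0 then 0 else if z < c * (T - t) then normalCDF η (z / c + t) else 1 := by
  rw [cdf_eq_real, paymentLaw_eq_map c t T η,
    map_measureReal_apply (f := fun x => payment c t T (η 0 + η 1 * x))
      ((continuous_payment c t T).measurable.comp (by fun_prop)) measurableSet_Iic]
  have key : ∀ x, payment c t T x ≤ z ↔ max t (min T x) ≤ z / c + t := fun x => by
    rw [payment_eq hc htT, ← le_div_iff₀' hc]
    constructor <;> intro h <;> linarith
  have hpre : (fun x => payment c t T (η 0 + η 1 * x)) ⁻¹' Set.Iic z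
      = {x | max t (min T (η 0 + η 1 * x)) ≤ z / c + t} := by
    ext x; exact key _
  rw [hpre]
  split_ifs with h1 h2
  · have : {x | max t (min T (η 0 + η 1 * x)) ≤ z / c + t} = ∅ := by
      ext x
      have : z / c < 0 := div_neg_of_neg_of_pos h1 hc
      have h3 := le_max_left t (min T (η 0 + η 1 * x))
      simp only [Set.mem_ofPred_eq, Set.mem_empty_iff_false, iff_false, not_le]
      linarith
    rw [this, measureReal_empty]
  · have h3 : z / c + t < T := by
      have : z / c < T - t := by rwa [div_lt_iff₀' hc]
      linarith
    have h4 : t ≤ z / c + t := by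
      have : 0 ≤ z / c := div_nonneg (not_lt.1 h1) hc.le
      linarith
    have : {x | max t (min T (η 0 + η 1 * x)) ≤ z / c + t}
        = Set.Iic ((z / c + t - η 0) / η 1) := by
      ext x
      simp only [Set.mem_ofPred_eq, Set.mem_Iic, max_le_iff, min_le_iff, h4, true_and,
        not_le.2 h3, false_or]
      rw [le_div_iff₀' hη]
      constructor <;> intro h <;> linarith
    rw [this, ← cdf_eq_real]
    rfl
  · have h3 : T ≤ z / c + t := by
      have : T - t ≤ z / c := by rw [le_div_iff₀' hc]; exact not_lt.1 h2
      linarith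
    have : {x | max t (min T (η 0 + η 1 * x)) ≤ z / c + t} = Set.univ := by
      ext x
      simp only [Set.mem_ofPred_eq, Set.mem_univ, iff_true]
      exact max_le (by linarith) ((min_le_left _ _).trans h3)
    rw [this, probReal_univ]

lemma quantile_paymentLaw {c t T : ℝ} (hc : 0 < c) (htT : t < T) {η : Param} (hη : 0 < η 1)
    {v : ℝ} (h1 : normalCDF η t ≤ v) (h2 : v ≤ normalCDF η T) :
    quantile (paymentLaw c t T η) v = c * (η 0 + η 1 * q v - t) := by
  have hv0 : 0 < v := (Phi_pos _).trans_le h1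
  have hv1 : v < 1 := h2.trans_lt (Phi_lt_one _)
  have hle : ∀ x, v ≤ normalCDF η x ↔ η 0 + η 1 * q v ≤ x := fun x => by
    rw [normalCDF]
    nth_rewrite 1 [← Phi_q hv0 hv1]
    rw [strictMono_Phi.le_iff_le, le_div_iff₀' hη]
    constructor <;> intro h <;> linarith
  have hx1 : t ≤ η 0 + η 1 * q v := by
    rw [normalCDF, ← Phi_q hv0 hv1, strictMono_Phi.le_iff_le, div_le_iff₀' hη] at h1
    linarith
  have hx2 : η 0 + η 1 * q v ≤ T := (hle T).1 h2
  have : {x | v ≤ cdf (paymentLaw c t T η) x} = Set.Ici (c * (η 0 + η 1 * q v - t)) := by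
    ext z
    simp only [Set.mem_ofPred_eq, Set.mem_Ici, cdf_paymentLaw hc htT hη]
    split_ifs with h3 h4
    · have : 0 ≤ c * (η 0 + η 1 * q v - t) := mul_nonneg hc.le (by linarith)
      constructor <;> intro h <;> linarith
    · rw [hle, ← le_div_iff₀' hc]
      constructor <;> intro h <;> linarith
    · refine ⟨fun _ => ?_, fun _ => hv1.le⟩
      refine le_trans ?_ (not_lt.1 h4)
      exact mul_le_mul_of_nonneg_left (by linarith) hc.le
  rw [quantile, this, csInf_Ici]

section closedForm

variable {c t T a b : ℝ} {η : Param}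

lemma FullyObserved.pos (h : FullyObserved a b t T η) : 0 < a ∧ 0 < b :=
  ⟨(Phi_pos _).trans_le h.1, by have := h.2.2.trans_lt (Phi_lt_one _); linarith⟩

lemma popMoment_eq (hc : 0 < c) (htT : t < T) (hη : 0 < η 1) (h : FullyObserved a b t T η)
    (k : ℕ) : popMoment c t T a b η k = winsorizedMoment (fun v => η 0 + η 1 * q v) a b k := by
  have key : ∀ v ∈ Set.Icc a (1 - b),
      hZ c t (quantile (paymentLaw c t T η) v) = η 0 + η 1 * q v := fun v hv => by
    rw [quantile_paymentLaw hc htT hη (h.1.trans hv.1) (hv.2.trans h.2.2), hZ,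
      mul_div_cancel_left₀ _ hc.ne']
    ring
  unfold popMoment winsorizedMoment
  beta_reduce
  rw [key a ⟨le_rfl, h.2.1.le⟩, key (1 - b) ⟨h.2.1.le, le_rfl⟩]
  congr 2
  refine intervalIntegral.integral_congr fun v hv => ?_
  rw [Set.uIcc_of_le h.2.1.le] at hv
  simp only [key v hv]

lemma popMoment_one (hc : 0 < c) (htT : t < T) (hη : 0 < η 1) (h : FullyObserved a b t T η) :
    popMoment c t T a b η 1 = η 0 + η 1 * ck a b 1 := by
  obtain ⟨ha, hb⟩ := h.pos
  have hi := intervalIntegrable_q_pow (u := a) (v := 1 - b) ⟨ha, by linarith [h.2.1]⟩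
    ⟨by linarith [h.2.1], by linarith⟩ 1
  simp only [pow_one] at hi
  rw [popMoment_eq hc htT hη h, ck, winsorizedMoment, winsorizedMoment]
  simp only [pow_one]
  rw [intervalIntegral.integral_add intervalIntegrable_const (hi.const_mul _),
    intervalIntegral.integral_const_mul, intervalIntegral.integral_const]
  simp only [smul_eq_mul]
  unfold q
  ring

lemma popMoment_two (hc : 0 < c) (htT : t < T) (hη : 0 < η 1) (h : FullyObserved a b t T η) :
    popMoment c t T a b η 2 = η 0 ^ 2 + 2 * η 0 * η 1 * ck a b 1 + η 1 ^ 2 * ck a b 2 := by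
  obtain ⟨ha, hb⟩ := h.pos
  have hi1 := intervalIntegrable_q_pow (u := a) (v := 1 - b) ⟨ha, by linarith [h.2.1]⟩
    ⟨by linarith [h.2.1], by linarith⟩ 1
  have hi2 := intervalIntegrable_q_pow (u := a) (v := 1 - b) ⟨ha, by linarith [h.2.1]⟩
    ⟨by linarith [h.2.1], by linarith⟩ 2
  simp only [pow_one] at hi1
  rw [popMoment_eq hc htT hη h, ck, ck, winsorizedMoment, winsorizedMoment, winsorizedMoment]
  have e : ∀ v, (η 0 + η 1 * q v) ^ 2
      = η 0 ^ 2 + (2 * η 0 * η 1) * q v + η 1 ^ 2 * q v ^ 2 := fun v => by ring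
  simp only [e, pow_one]
  rw [intervalIntegral.integral_add (intervalIntegrable_const.add (hi1.const_mul _))
      (hi2.const_mul _),
    intervalIntegral.integral_add intervalIntegrable_const (hi1.const_mul _),
    intervalIntegral.integral_const_mul, intervalIntegral.integral_const_mul,
    intervalIntegral.integral_const]
  simp only [smul_eq_mul]
  unfold q
  ring

/-- Where all winsorized data are uncensored, the two moment equations read
`θ + c₁ σ = Ŵ₁` and `θ² + 2 c₁ θ σ + c₂ σ² = Ŵ₂`, and have the closed-form solution `mwm`. -/
lemma isMWM_iff (hc : 0 < c) (htT : t < T) {n k k' : ℕ} (z : Fin n → ℝ) :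
    IsMWM c t T a b k k' z η ↔
      0 < η 1 ∧ FullyObserved a b t T η ∧ η = mwm c t a b k k' z := by
  unfold IsMWM
  refine and_congr_right fun hη => and_congr_right fun h => ?_
  rw [popMoment_one hc htT hη h, popMoment_two hc htT hη h]
  have hD := ck_two_sub_sq_pos h.pos.1 h.2.1 h.pos.2
  simp only [mwm]
  set W1 := sampleMoment c t k k' z 1
  set W2 := sampleMoment c t k k' z 2
  set c1 := ck a b 1
  set c2 := ck a b 2
  constructor
  · rintro ⟨h1, h2⟩
    have hs : √((W2 - W1 ^ 2) / (c2 - c1 ^ 2)) = η 1 := by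
      rw [Real.sqrt_eq_iff_mul_self_eq_of_pos hη, eq_div_iff hD.ne', ← h1, ← h2]
      ring
    rw [hs]
    ext i
    fin_cases i
    · simp only [Fin.zero_eta, Fin.isValue, Matrix.cons_val_zero]
      linarith
    · simp
  · intro h3
    have e0 : η 0 = W1 - c1 * √((W2 - W1 ^ 2) / (c2 - c1 ^ 2)) := by
      conv_lhs => rw [h3]
      simp
    have e1 : η 1 = √((W2 - W1 ^ 2) / (c2 - c1 ^ 2)) := by
      conv_lhs => rw [h3]
      simp
    have hs := e1.symm
    rw [Real.sqrt_eq_iff_mul_self_eq_of_pos hη, eq_div_iff hD.ne'] at hs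
    rw [← e1] at e0
    constructor
    · rw [e0]; ring
    · rw [e0]; linear_combination hs
end closedForm

/-! ### Stochastic order symbols -/

section inProb

variable {Ω : Type*} [MeasurableSpace Ω] {P : Measure Ω}

/-- The filter of the sequences of events whose probability tends to one. A sequence `f n` of random
variables converges to `x` in probability iff `fun x => f x.1 x.2` tends to `x` along this filter,
so that rules such as `o_P(1) + o_P(1) = o_P(1)` or the continuous mapping theorem
become rules about limits along a filter. -/
def inProb (P : Measure Ω) : Filter (ℕ × Ω) where
  sets := {s | Tendsto (fun n => P {ω | (n, ω) ∉ s}) atTop (𝓝 0)}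
  univ_sets := by simp
  sets_of_superset {s u} hs hsu :=
    tendsto_of_tendsto_of_tendsto_of_le_of_le tendsto_const_nhds hs (fun _ => zero_le)
      fun n => measure_mono fun ω hω h => hω (hsu h)
  inter_sets {s u} hs hu := by
    have h := Tendsto.add (M := ENNReal) hs hu
    rw [add_zero] at h
    refine tendsto_of_tendsto_of_tendsto_of_le_of_le tendsto_const_nhds h (fun _ => zero_le)
      fun n => (measure_mono ?_).trans (measure_union_le _ _)
    intro ω hω
    by_contra hcon
    simp only [Set.mem_union, Set.mem_ofPred_eq, not_or, not_not] at hcon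
    exact hω hcon

lemma eventually_inProb {p : ℕ × Ω → Prop} :
    (∀ᶠ x in inProb P, p x) ↔ Tendsto (fun n => P {ω | ¬ p (n, ω)}) atTop (𝓝 0) := Iff.rfl

lemma eventually_inProb_of_ae {p : ℕ × Ω → Prop} (h : ∀ᶠ n in atTop, ∀ᵐ ω ∂P, p (n, ω)) :
    ∀ᶠ x in inProb P, p x := by
  rw [eventually_inProb]
  refine tendsto_const_nhds.congr' ?_
  filter_upwards [h] with n hn
  exact hn.symm

lemma tendsto_fst_inProb : Tendsto Prod.fst (inProb P) atTop := by
  intro s hs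
  refine eventually_inProb_of_ae (p := fun x => x.1 ∈ s) ?_
  filter_upwards [hs] with n hn
  exact ae_of_all _ fun _ => hn

lemma tendsto_measure_one_of_eventually [IsProbabilityMeasure P] {p : ℕ × Ω → Prop}
    (h : ∀ᶠ x in inProb P, p x) : Tendsto (fun n => P {ω | p (n, ω)}) atTop (𝓝 1) := by
  have h0 : Tendsto (fun n => 1 - P {ω | ¬ p (n, ω)}) atTop (𝓝 1) := by
    simpa using ENNReal.Tendsto.sub (tendsto_const_nhds (x := (1 : ENNReal)))
      (eventually_inProb.1 h) (Or.inl ENNReal.one_ne_top)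
  refine tendsto_of_tendsto_of_tendsto_of_le_of_le h0 tendsto_const_nhds (fun n => ?_)
    fun n => prob_le_one
  rw [tsub_le_iff_right, ← measure_univ (μ := P)]
  refine (measure_mono fun ω _ => ?_).trans (measure_union_le _ _)
  exact em (p (n, ω))

lemma tendstoInMeasure_zero_iff {E : Type*} [SeminormedAddCommGroup E] {f : ℕ → Ω → E} :
    TendstoInMeasure P f atTop 0 ↔ Tendsto (fun x : ℕ × Ω => f x.1 x.2) (inProb P) (𝓝 0) := by
  rw [tendstoInMeasure_iff_norm, Metric.tendsto_nhds]
  refine forall₂_congr fun ε _ => ?_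
  rw [eventually_inProb]
  simp

/-- A sequence of random elements that is bounded in probability, in symbols `O_P(1)`. -/
def IsTightSeq {E : Type*} [SeminormedAddCommGroup E] (P : Measure Ω) (f : ℕ × Ω → E) : Prop :=
  ∀ ε : ENNReal, 0 < ε → ∃ K : ℝ, ∀ᶠ n in atTop, P {ω | K < ‖f (n, ω)‖} ≤ ε

section tight

variable {E F : Type*} [SeminormedAddCommGroup E] [SeminormedAddCommGroup F]

lemma IsTightSeq.mul_tendsto_zero {f : ℕ × Ω → E} {r : ℕ × Ω → ℝ} (hf : IsTightSeq P f)
    (hr : Tendsto r (inProb P) (𝓝 0)) : Tendsto (fun x => r x * ‖f x‖) (inProb P) (𝓝 0) := by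
  rw [Metric.tendsto_nhds] at hr ⊢
  intro δ hδ
  rw [eventually_inProb, ENNReal.tendsto_nhds_zero]
  intro ε hε
  obtain ⟨K, hK⟩ := hf (ε / 2) (ENNReal.half_pos hε.ne')
  have hr' := ENNReal.tendsto_nhds_zero.1
    (eventually_inProb.1 (hr (δ / (|K| + 1)) (by positivity))) (ε / 2) (ENNReal.half_pos hε.ne')
  filter_upwards [hK, hr'] with n h1 h2
  rw [← ENNReal.add_halves ε]
  refine (measure_mono ?_).trans ((measure_union_le _ _).trans (add_le_add h1 h2))
  intro ω hω
  by_contra hcon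
  simp only [Set.mem_union, Set.mem_ofPred_eq, not_or, not_lt, not_le, dist_zero_right] at hcon
  refine hω ?_
  rw [dist_zero_right, norm_mul, norm_norm]
  obtain ⟨g1, g2⟩ := hcon
  have g3 : ‖f (n, ω)‖ < |K| + 1 := by linarith [le_abs_self K]
  calc ‖r (n, ω)‖ * ‖f (n, ω)‖ ≤ ‖r (n, ω)‖ * (|K| + 1) :=
        mul_le_mul_of_nonneg_left g3.le (norm_nonneg _)
    _ < δ / (|K| + 1) * (|K| + 1) := mul_lt_mul_of_pos_right g2 (by positivity)
    _ = δ := by field_simp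

lemma IsTightSeq.mono {f : ℕ × Ω → E} {g : ℕ × Ω → F} (hf : IsTightSeq P f)
    (h : ∀ᶠ x in inProb P, ‖g x‖ ≤ ‖f x‖) : IsTightSeq P g := by
  intro ε hε
  obtain ⟨K, hK⟩ := hf (ε / 2) (ENNReal.half_pos hε.ne')
  refine ⟨K, ?_⟩
  have h' := ENNReal.tendsto_nhds_zero.1 (eventually_inProb.1 h) (ε / 2) (ENNReal.half_pos hε.ne')
  filter_upwards [hK, h'] with n h1 h2
  rw [← ENNReal.add_halves ε]
  refine (measure_mono ?_).trans ((measure_union_le _ _).trans (add_le_add h1 h2))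
  intro ω hω
  by_contra hcon
  simp only [Set.mem_union, Set.mem_ofPred_eq, not_or, not_not, not_lt] at hcon
  exact not_lt.2 (hcon.2.trans hcon.1) hω

lemma IsTightSeq.add {f g : ℕ × Ω → E} (hf : IsTightSeq P f) (hg : IsTightSeq P g) :
    IsTightSeq P (fun x => f x + g x) := by
  intro ε hε
  obtain ⟨K, hK⟩ := hf (ε / 2) (ENNReal.half_pos hε.ne')
  obtain ⟨L, hL⟩ := hg (ε / 2) (ENNReal.half_pos hε.ne')
  refine ⟨K + L, ?_⟩
  filter_upwards [hK, hL] with n h1 h2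
  rw [← ENNReal.add_halves ε]
  refine (measure_mono ?_).trans ((measure_union_le _ _).trans (add_le_add h1 h2))
  intro ω hω
  by_contra hcon
  simp only [Set.mem_union, Set.mem_ofPred_eq, not_or, not_lt] at hcon
  exact not_lt.2 ((norm_add_le _ _).trans (add_le_add hcon.1 hcon.2)) hω

/-- To prove that an event has probability tending to one, one may assume that a tight sequence is
bounded by a constant. -/
lemma IsTightSeq.eventually {f : ℕ × Ω → E} (hf : IsTightSeq P f) {p : ℕ × Ω → Prop}
    (h : ∀ K : ℝ, ∀ᶠ x in inProb P, ‖f x‖ ≤ K → p x) : ∀ᶠ x in inProb P, p x := by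
  rw [eventually_inProb, ENNReal.tendsto_nhds_zero]
  intro ε hε
  obtain ⟨K, hK⟩ := hf (ε / 2) (ENNReal.half_pos hε.ne')
  have h' := ENNReal.tendsto_nhds_zero.1 (eventually_inProb.1 (h K)) (ε / 2)
    (ENNReal.half_pos hε.ne')
  filter_upwards [hK, h'] with n h1 h2
  rw [← ENNReal.add_halves ε]
  refine (measure_mono ?_).trans ((measure_union_le _ _).trans (add_le_add h1 h2))
  intro ω hω
  by_contra hcon
  simp only [Set.mem_union, Set.mem_ofPred_eq, not_or, not_not, not_lt] at hcon
  exact hω (hcon.2 hcon.1)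

lemma isTightSeq_of_tendsto_zero {f : ℕ × Ω → E} (hf : Tendsto f (inProb P) (𝓝 0)) :
    IsTightSeq P f := by
  intro ε hε
  refine ⟨1, ?_⟩
  have h : ∀ᶠ x in inProb P, ‖f x‖ ≤ 1 := by
    have := hf.norm
    rw [norm_zero] at this
    exact (this.eventually_lt_const one_pos).mono fun _ h => h.le
  filter_upwards [ENNReal.tendsto_nhds_zero.1 (eventually_inProb.1 h) ε hε] with n hn
  simpa only [not_le] using hn

lemma IsTightSeq.sum {κ : Type*} (s : Finset κ) {f : κ → ℕ × Ω → E}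
    (hf : ∀ i ∈ s, IsTightSeq P (f i)) : IsTightSeq P (fun x => ∑ i ∈ s, f i x) := by
  classical
  induction s using Finset.induction_on with
  | empty =>
    simp only [Finset.sum_empty]
    exact isTightSeq_of_tendsto_zero tendsto_const_nhds
  | insert i s hi ih =>
    simp only [Finset.sum_insert hi]
    exact (hf i (Finset.mem_insert_self i s)).add
      (ih fun j hj => hf j (Finset.mem_insert_of_mem hj))

end tight

lemma tendsto_inv_sqrt_inProb : Tendsto (fun x : ℕ × Ω => (√(x.1 : ℝ))⁻¹) (inProb P) (𝓝 0) :=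
  (tendsto_inv_atTop_zero.comp
    (Real.tendsto_sqrt_atTop.comp tendsto_natCast_atTop_atTop)).comp tendsto_fst_inProb

end inProb

/-! ### Normalized sums over an i.i.d. sample -/

section iid

variable {Ω : Type*} [MeasurableSpace Ω] {P : Measure Ω}

/-- `Y 0, Y 1, …` are independent with common law `ν`. -/
structure IsIID (P : Measure Ω) (Y : ℕ → Ω → ℝ) (ν : Measure ℝ) : Prop where
  law : ∀ i, HasLaw (Y i) ν P
  indep : iIndepFun Y P

/-- The normalized sum `n^{-1/2} ∑_{i < n} ψ(Y_i)`. -/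
def normSum {E : Type*} [AddCommGroup E] [Module ℝ E] (Y : ℕ → Ω → ℝ) (ψ : ℝ → E)
    (x : ℕ × Ω) : E := (√(x.1 : ℝ))⁻¹ • ∑ i ∈ Finset.range x.1, ψ (Y i x.2)

/-- A bounded measurable function with mean zero under `ν`. -/
structure IsScore {E : Type*} [NormedAddCommGroup E] [NormedSpace ℝ E] [MeasurableSpace E]
    (ν : Measure ℝ) (ψ : ℝ → E) : Prop where
  measurable : Measurable ψ
  bounded : ∃ C, ∀ y, ‖ψ y‖ ≤ C
  mean : ∫ y, ψ y ∂ν = 0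

variable {Y : ℕ → Ω → ℝ} {ν : Measure ℝ}

lemma integrable_of_bounded [IsFiniteMeasure ν] {E : Type*} [NormedAddCommGroup E]
    [MeasurableSpace E] [BorelSpace E] [SecondCountableTopology E] {ψ : ℝ → E}
    (hm : Measurable ψ) (hb : ∃ C, ∀ y, ‖ψ y‖ ≤ C) : Integrable ψ ν := by
  obtain ⟨C, hC⟩ := hb
  exact Integrable.of_bound hm.aestronglyMeasurable C (ae_of_all _ hC)

lemma IsScore.clm_comp [IsFiniteMeasure ν] {E F : Type*} [NormedAddCommGroup E] [NormedSpace ℝ E]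
    [MeasurableSpace E] [BorelSpace E] [SecondCountableTopology E] [CompleteSpace E]
    [NormedAddCommGroup F] [NormedSpace ℝ F] [MeasurableSpace F] [BorelSpace F] [CompleteSpace F]
    {ψ : ℝ → E} (h : IsScore ν ψ) (L : E →L[ℝ] F) : IsScore ν (fun y => L (ψ y)) where
  measurable := L.continuous.measurable.comp h.measurable
  bounded := by
    obtain ⟨C, hC⟩ := h.bounded
    exact ⟨‖L‖ * C, fun y => (L.le_opNorm _).trans
      (mul_le_mul_of_nonneg_left (hC y) (norm_nonneg _))⟩
  mean := by
    rw [L.integral_comp_comm (integrable_of_bounded h.measurable h.bounded), h.mean, map_zero]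

lemma normSum_clm {Ω : Type*} {Y : ℕ → Ω → ℝ} {E F : Type*} [NormedAddCommGroup E]
    [NormedSpace ℝ E] [NormedAddCommGroup F]
    [NormedSpace ℝ F] (L : E →L[ℝ] F) (ψ : ℝ → E) (x : ℕ × Ω) :
    normSum Y (fun y => L (ψ y)) x = L (normSum Y ψ x) := by
  simp [normSum, map_sum]

lemma aemeasurable_normSum {E : Type*} [NormedAddCommGroup E] [NormedSpace ℝ E]
    [MeasurableSpace E] [BorelSpace E] [SecondCountableTopology E] {ψ : ℝ → E}
    (hY : IsIID P Y ν) (hψ : Measurable ψ) (n : ℕ) :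
    AEMeasurable (fun ω => normSum Y ψ (n, ω)) P := by
  unfold normSum
  have h : AEMeasurable (fun ω => ∑ i ∈ Finset.range n, ψ (Y i ω)) P :=
    Finset.aemeasurable_fun_sum _ fun i _ => hψ.comp_aemeasurable (hY.law i).aemeasurable
  exact h.const_smul (√(n : ℝ))⁻¹

variable [IsProbabilityMeasure P]

/-- Chebyshev's inequality for normalized sums. -/
lemma IsIID.measure_normSum_ge_le (hY : IsIID P Y ν) {ψ : ℝ → ℝ} (hψ : IsScore ν ψ) (n : ℕ)
    {K : ℝ} (hK : 0 < K) :
    P {ω | K ≤ |normSum Y ψ (n, ω)|} ≤ ENNReal.ofReal ((∫ y, ψ y ^ 2 ∂ν) / K ^ 2) := by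
  obtain ⟨C, hC⟩ := hψ.bounded
  have hLp : ∀ i, MemLp (fun ω => ψ (Y i ω)) 2 P := fun i =>
    MemLp.of_bound (hψ.measurable.comp_aemeasurable (hY.law i).aemeasurable).aestronglyMeasurable C
      (ae_of_all _ fun ω => hC _)
  have hE : ∀ i, ∫ ω, ψ (Y i ω) ∂P = 0 := fun i => by
    have := (hY.law i).integral_comp (f := ψ) hψ.measurable.aestronglyMeasurable
    rw [hψ.mean] at this
    exact this
  have hV : ∀ i, variance (fun ω => ψ (Y i ω)) P = ∫ y, ψ y ^ 2 ∂ν := fun i => by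
    rw [variance_of_integral_eq_zero (hLp i).aemeasurable (hE i)]
    exact (hY.law i).integral_comp (f := fun y => ψ y ^ 2)
      (hψ.measurable.pow_const 2).aestronglyMeasurable
  have hsum : variance (fun ω => ∑ i ∈ Finset.range n, ψ (Y i ω)) P = n * ∫ y, ψ y ^ 2 ∂ν := by
    have h := IndepFun.variance_sum (s := Finset.range n) (X := fun i ω => ψ (Y i ω))
      (fun i _ => hLp i) fun i _ j _ hij =>
        (hY.indep.comp (fun _ => ψ) fun _ => hψ.measurable).indepFun hij
    have e : (∑ i ∈ Finset.range n, fun ω => ψ (Y i ω))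
        = fun ω => ∑ i ∈ Finset.range n, ψ (Y i ω) := by ext; simp
    rw [e] at h
    rw [h]
    simp [hV]
  have hLpS : MemLp (fun ω => normSum Y ψ (n, ω)) 2 P := by
    have := (memLp_finsetSum (Finset.range n) fun i _ => hLp i).const_mul (√(n : ℝ))⁻¹
    exact this
  have hES : ∫ ω, normSum Y ψ (n, ω) ∂P = 0 := by
    simp only [normSum, smul_eq_mul]
    rw [integral_const_mul, integral_finsetSum _ fun i _ => (hLp i).integrable (by norm_num)]
    simp [hE]
  have hVS : variance (fun ω => normSum Y ψ (n, ω)) P ≤ ∫ y, ψ y ^ 2 ∂ν := by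
    simp only [normSum, smul_eq_mul]
    rw [variance_const_mul, hsum, ← mul_assoc, inv_pow, Real.sq_sqrt (Nat.cast_nonneg n)]
    have h0 : 0 ≤ ∫ y, ψ y ^ 2 ∂ν := integral_nonneg fun y => sq_nonneg _
    have h1 : (n : ℝ)⁻¹ * n ≤ 1 := inv_mul_le_one
    nlinarith
  have := meas_ge_le_variance_div_sq hLpS hK
  rw [hES] at this
  simp only [sub_zero] at this
  exact this.trans (ENNReal.ofReal_le_ofReal (by gcongr))

lemma IsIID.isTightSeq_normSum_real (hY : IsIID P Y ν) {ψ : ℝ → ℝ} (hψ : IsScore ν ψ) :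
    IsTightSeq P (normSum Y ψ) := by
  intro ε hε
  have hlim : Tendsto (fun K : ℝ => ENNReal.ofReal ((∫ y, ψ y ^ 2 ∂ν) / K ^ 2)) atTop (𝓝 0) := by
    rw [← ENNReal.ofReal_zero]
    exact (ENNReal.continuous_ofReal.tendsto 0).comp
      (tendsto_const_nhds.div_atTop (tendsto_pow_atTop two_ne_zero))
  obtain ⟨K, hK, hK0⟩ := ((ENNReal.tendsto_nhds_zero.1 hlim ε hε).and
    (eventually_gt_atTop 0)).exists
  refine ⟨K, Eventually.of_forall fun n => ?_⟩
  refine (measure_mono fun ω hω => ?_).trans ((hY.measure_normSum_ge_le hψ n hK0).trans hK)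
  exact (show K < ‖normSum Y ψ (n, ω)‖ from hω).le

variable [IsProbabilityMeasure ν]

lemma IsIID.isTightSeq_normSum {ι : Type*} [Fintype ι] (hY : IsIID P Y ν)
    {ψ : ℝ → EuclideanSpace ℝ ι} (hψ : IsScore ν ψ) : IsTightSeq P (normSum Y ψ) := by
  have h1 : IsTightSeq P fun x => ∑ i, ‖normSum Y (fun y => ψ y i) x‖ := by
    refine IsTightSeq.sum _ fun i _ => ?_
    exact (hY.isTightSeq_normSum_real (hψ.clm_comp (EuclideanSpace.proj i))).mono
      (Eventually.of_forall fun x => by simp)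
  refine h1.mono (Eventually.of_forall fun x => ?_)
  have h2 : ∀ i, normSum Y (fun y => ψ y i) x = normSum Y ψ x i := fun i =>
    normSum_clm (EuclideanSpace.proj i) ψ x
  simp only [h2]
  rw [Real.norm_of_nonneg (by positivity), EuclideanSpace.norm_eq]
  refine Real.sqrt_le_iff.2 ⟨by positivity, ?_⟩
  exact Finset.sum_sq_le_sq_sum_of_nonneg fun i _ => norm_nonneg _

/-- The weak law of large numbers for bounded functions of the observations. -/
lemma IsIID.tendsto_mean (hY : IsIID P Y ν) {ψ : ℝ → ℝ} (hm : Measurable ψ)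
    (hb : ∃ C, ∀ y, ‖ψ y‖ ≤ C) :
    Tendsto (fun x : ℕ × Ω => (x.1 : ℝ)⁻¹ * ∑ i ∈ Finset.range x.1, ψ (Y i x.2)) (inProb P)
      (𝓝 (∫ y, ψ y ∂ν)) := by
  set μ := ∫ y, ψ y ∂ν
  have hs : IsScore ν (fun y => ψ y - μ) := by
    refine ⟨hm.sub_const _, ?_, ?_⟩
    · obtain ⟨C, hC⟩ := hb
      exact ⟨C + ‖μ‖, fun y => (norm_sub_le _ _).trans (by linarith [hC y])⟩
    · rw [integral_sub (integrable_of_bounded hm hb) (integrable_const _)]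
      simp [μ]
  have h := (hY.isTightSeq_normSum_real hs).mul_tendsto_zero tendsto_inv_sqrt_inProb
  rw [← tendsto_sub_nhds_zero_iff, tendsto_zero_iff_norm_tendsto_zero]
  refine h.congr' ?_
  filter_upwards [tendsto_fst_inProb.eventually (eventually_gt_atTop 0)] with x hx
  have hx' : (0 : ℝ) < x.1 := by exact_mod_cast hx
  have e : (x.1 : ℝ)⁻¹ * ∑ i ∈ Finset.range x.1, ψ (Y i x.2) - μ
      = (√(x.1 : ℝ))⁻¹ * normSum Y (fun y => ψ y - μ) x := by
    simp only [normSum, smul_eq_mul, Finset.sum_sub_distrib, Finset.sum_const, Finset.card_range,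
      nsmul_eq_mul]
    rw [← mul_assoc, ← mul_inv, Real.mul_self_sqrt hx'.le]
    field_simp
  rw [e, norm_mul, Real.norm_of_nonneg (inv_nonneg.2 (Real.sqrt_nonneg _))]

end iid

/-! ### Asymptotically linear estimators -/

section asympLinear

variable {Ω : Type*} [MeasurableSpace Ω] {P : Measure Ω} {Y : ℕ → Ω → ℝ} {ν : Measure ℝ}

/-- The estimators `est n` of `η` are asymptotically linear with influence function `ψ`:
`√n (est n - η) = n^{-1/2} ∑_{i < n} ψ(Y_i) + o_P(1)`. -/
def IsAsympLinear {E : Type*} [NormedAddCommGroup E] [NormedSpace ℝ E] (P : Measure Ω)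
    (Y : ℕ → Ω → ℝ) (est : ℕ × Ω → E) (η : E) (ψ : ℝ → E) : Prop :=
  Tendsto (fun x : ℕ × Ω => √(x.1 : ℝ) • (est x - η) - normSum Y ψ x) (inProb P) (𝓝 0)

lemma isAsympLinear_euclidean {ι : Type*} [Fintype ι] {est : ℕ × Ω → EuclideanSpace ℝ ι}
    {η : EuclideanSpace ℝ ι} {ψ : ℝ → EuclideanSpace ℝ ι}
    (h : ∀ i, IsAsympLinear P Y (fun x => est x i) (η i) (fun y => ψ y i)) :
    IsAsympLinear P Y est η ψ := by
  have h1 : Tendsto (fun x : ℕ × Ω => fun i =>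
      √(x.1 : ℝ) • (est x i - η i) - normSum Y (fun y => ψ y i) x) (inProb P) (𝓝 0) :=
    tendsto_pi_nhds.2 h
  have h2 := ((PiLp.continuous_toLp 2 fun _ : ι => ℝ).tendsto 0).comp h1
  refine Tendsto.congr (fun x => ?_) h2
  ext i
  have h3 : normSum Y (fun y => ψ y i) x = normSum Y ψ x i :=
    normSum_clm (EuclideanSpace.proj i) ψ x
  simp [h3]

lemma IsAsympLinear.congr {E : Type*} [NormedAddCommGroup E] [NormedSpace ℝ E]
    {est est' : ℕ × Ω → E} {η : E} {ψ : ℝ → E} (h : IsAsympLinear P Y est η ψ)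
    (he : ∀ᶠ x in inProb P, est x = est' x) : IsAsympLinear P Y est' η ψ := by
  refine Tendsto.congr' ?_ h
  filter_upwards [he] with x hx
  rw [hx]

section delta

variable {E : Type*} [NormedAddCommGroup E] [NormedSpace ℝ E] {est : ℕ × Ω → E} {η : E} {ψ : ℝ → E}

lemma IsAsympLinear.isTightSeq (hψ : IsTightSeq P (normSum Y ψ)) (h : IsAsympLinear P Y est η ψ) :
    IsTightSeq P fun x : ℕ × Ω => √(x.1 : ℝ) • (est x - η) :=
  ((isTightSeq_of_tendsto_zero h).add hψ).mono (Eventually.of_forall fun x => by simp)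

lemma IsAsympLinear.tendsto (hψ : IsTightSeq P (normSum Y ψ)) (h : IsAsympLinear P Y est η ψ) :
    Tendsto est (inProb P) (𝓝 η) := by
  rw [← tendsto_sub_nhds_zero_iff, tendsto_zero_iff_norm_tendsto_zero]
  refine ((h.isTightSeq hψ).mul_tendsto_zero tendsto_inv_sqrt_inProb).congr' ?_
  filter_upwards [tendsto_fst_inProb.eventually (eventually_gt_atTop 0)] with x hx
  have hx' : (0 : ℝ) < √(x.1 : ℝ) := Real.sqrt_pos.2 (by exact_mod_cast hx)
  rw [norm_smul, Real.norm_of_nonneg hx'.le, ← mul_assoc, inv_mul_cancel₀ hx'.ne', one_mul]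

/-- The delta method. -/
lemma IsAsympLinear.comp_hasFDerivAt (hψ : IsTightSeq P (normSum Y ψ))
    (h : IsAsympLinear P Y est η ψ) {F : Type*} [NormedAddCommGroup F] [NormedSpace ℝ F]
    {G : E → F} {G' : E →L[ℝ] F} (hG : HasFDerivAt G G' η) :
    IsAsympLinear P Y (fun x => G (est x)) (G η) (fun y => G' (ψ y)) := by
  have h1 : Tendsto (fun x => √((x : ℕ × Ω).1 : ℝ) • (G (est x) - G η - G' (est x - η)))
      (inProb P) (𝓝 0) := by
    have h2 := (hasFDerivAt_iff_tendsto.1 hG).comp (h.tendsto hψ)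
    have h3 := (h.isTightSeq hψ).mul_tendsto_zero h2
    rw [tendsto_zero_iff_norm_tendsto_zero]
    refine h3.congr fun x => ?_
    rw [norm_smul, norm_smul]
    simp only [Function.comp_apply]
    by_cases h0 : est x = η
    · simp [h0]
    · have : ‖est x - η‖ ≠ 0 := by rwa [norm_ne_zero_iff, sub_ne_zero]
      field_simp
  have h4 : Tendsto (fun x : ℕ × Ω => G' (√(x.1 : ℝ) • (est x - η) - normSum Y ψ x)) (inProb P)
      (𝓝 0) := by
    have := (G'.continuous.tendsto 0).comp h
    rwa [map_zero] at this
  have h5 := h1.add h4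
  rw [add_zero] at h5
  refine h5.congr fun x => ?_
  rw [normSum_clm]
  simp only [map_sub, map_smul, smul_sub]
  abel

lemma IsAsympLinear.add {est' : ℕ × Ω → E} {η' : E} {ψ' : ℝ → E} (h : IsAsympLinear P Y est η ψ)
    (h' : IsAsympLinear P Y est' η' ψ') :
    IsAsympLinear P Y (fun x => est x + est' x) (η + η') (fun y => ψ y + ψ' y) := by
  have h1 := Tendsto.add h h'
  rw [add_zero] at h1
  refine h1.congr fun x => ?_
  simp only [normSum, Finset.sum_add_distrib, smul_add, smul_sub]
  abel

end delta

/-- A consistent random factor in front of the error of an asymptotically linear estimator can be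
replaced by its limit. -/
lemma IsAsympLinear.sub_mul {est w : ℕ × Ω → ℝ} {η c : ℝ} {ψ : ℝ → ℝ}
    (hψ : IsTightSeq P (normSum Y ψ)) (h : IsAsympLinear P Y est η ψ)
    (hw : Tendsto w (inProb P) (𝓝 c)) :
    IsAsympLinear P Y (fun x => (est x - η) * w x) 0 (fun y => c * ψ y) := by
  have h1 : Tendsto (fun x => (√((x : ℕ × Ω).1 : ℝ) • (est x - η)) * (w x - c)) (inProb P)
      (𝓝 0) := by
    rw [tendsto_zero_iff_norm_tendsto_zero]
    have hw' := (tendsto_sub_nhds_zero_iff.2 hw).norm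
    rw [norm_zero] at hw'
    refine ((h.isTightSeq hψ).mul_tendsto_zero hw').congr fun x => ?_
    rw [norm_mul, mul_comm]
  have h2 := h1.add (Tendsto.const_mul c h)
  rw [mul_zero, add_zero] at h2
  refine h2.congr fun x => ?_
  simp only [normSum, smul_eq_mul, ← Finset.mul_sum]
  ring

variable [IsProbabilityMeasure P] [IsProbabilityMeasure ν]

/-- The multivariate central limit theorem for bounded scores. -/
lemma IsIID.tendstoInDistribution_normSum {ι : Type*} [Fintype ι] [DecidableEq ι]
    (hY : IsIID P Y ν) {ψ : ℝ → EuclideanSpace ℝ ι} (hψ : IsScore ν ψ) {S : Matrix ι ι ℝ}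
    (hS : S.PosSemidef) (hcov : ∀ i j, S i j = ∫ y, ψ y i * ψ y j ∂ν) :
    TendstoInDistribution (fun n ω => normSum Y ψ (n, ω)) atTop (id : EuclideanSpace ℝ ι → _)
      (fun _ => P) (multivariateGaussian 0 S) where
  forall_aemeasurable n := aemeasurable_normSum hY hψ.measurable n
  tendsto := by
    -- by characteristic functions, it suffices to treat the one-dimensional sums of `⟨x, ψ(Y_i)⟩`
    refine ProbabilityMeasure.tendsto_iff_tendsto_charFun.2 fun x => ?_
    simp only [ProbabilityMeasure.coe_mk, Measure.map_id]
    have hg := hψ.clm_comp (innerSL ℝ x)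
    set g : ℝ → ℝ := fun y => innerSL ℝ x (ψ y) with hgdef
    obtain ⟨C, hC⟩ := hg.bounded
    have hlaw : ∀ i, IdentDistrib (fun ω => g (Y i ω)) (fun ω => g (Y 0 ω)) P P := fun i =>
      (⟨(hY.law i).aemeasurable, (hY.law 0).aemeasurable,
        (hY.law i).map_eq.trans (hY.law 0).map_eq.symm⟩ :
          IdentDistrib (Y i) (Y 0) P P).comp hg.measurable
    have hLp : MemLp (fun ω => g (Y 0 ω)) 2 P :=
      MemLp.of_bound (hg.measurable.comp_aemeasurable
        (hY.law 0).aemeasurable).aestronglyMeasurable C (ae_of_all _ fun ω => hC _)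
    have hE : ∫ ω, g (Y 0 ω) ∂P = 0 := by
      have := (hY.law 0).integral_comp (f := g) hg.measurable.aestronglyMeasurable
      rw [hg.mean] at this
      exact this
    have hbd : ∀ i, ∃ C, ∀ y, ‖ψ y i‖ ≤ C := fun i => by
      obtain ⟨D, hD⟩ := hψ.bounded
      exact ⟨D, fun y => (PiLp.norm_apply_le _ i).trans (hD y)⟩
    have hms : ∀ i, Measurable fun y => ψ y i := fun i =>
      (EuclideanSpace.proj (𝕜 := ℝ) i).continuous.measurable.comp hψ.measurable
    have hgsum : ∀ y, g y = ∑ i, x i * ψ y i := fun y => by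
      simp [hgdef, innerSL_apply_apply, PiLp.inner_apply, mul_comm]
    have hV : variance (fun ω => g (Y 0 ω)) P = x.ofLp ⬝ᵥ S.mulVec x.ofLp := by
      rw [variance_of_integral_eq_zero hLp.aemeasurable hE]
      have e1 := (hY.law 0).integral_comp (f := fun y => g y ^ 2)
        (hg.measurable.pow_const 2).aestronglyMeasurable
      refine e1.trans ?_
      have e2 : ∀ y, g y ^ 2 = ∑ i, ∑ j, x i * x j * (ψ y i * ψ y j) := fun y => by
        rw [hgsum, sq, Finset.sum_mul_sum]
        exact Finset.sum_congr rfl fun i _ => Finset.sum_congr rfl fun j _ => by ring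
      simp only [e2]
      have hint : ∀ i j, Integrable (fun y => x i * x j * (ψ y i * ψ y j)) ν := fun i j => by
        obtain ⟨D, hD⟩ := hbd i
        obtain ⟨D', hD'⟩ := hbd j
        refine (integrable_of_bounded (E := ℝ) ((hms i).mul (hms j))
          ⟨D * D', fun y => ?_⟩).const_mul _
        rw [Pi.mul_apply, norm_mul]
        exact mul_le_mul (hD y) (hD' y) (norm_nonneg _) ((norm_nonneg _).trans (hD y))
      rw [integral_finsetSum _ fun i _ => integrable_finsetSum _ fun j _ => hint i j]
      simp only [dotProduct, Matrix.mulVec, Finset.mul_sum]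
      refine Finset.sum_congr rfl fun i _ => ?_
      rw [integral_finsetSum _ fun j _ => hint i j]
      refine Finset.sum_congr rfl fun j _ => ?_
      rw [integral_const_mul, hcov]
      ring
    have hclt := tendstoInDistribution_inv_sqrt_mul_sum_sub
      (X := fun i ω => g (Y i ω))
      (HasLaw.id (μ := gaussianReal 0 (variance (fun ω => g (Y 0 ω)) P).toNNReal))
      hLp (hY.indep.comp (fun _ => g) fun _ => hg.measurable) hlaw
    have h1 := ProbabilityMeasure.tendsto_iff_tendsto_charFun.1 hclt.tendsto 1
    simp only [ProbabilityMeasure.coe_mk, Measure.map_id] at h1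
    rw [charFun_gaussianReal] at h1
    rw [charFun_multivariateGaussian hS]
    have hlim : Complex.exp ((inner ℝ x (0 : EuclideanSpace ℝ ι) : ℝ) * Complex.I
          - ((x.ofLp ⬝ᵥ S.mulVec x.ofLp : ℝ) : ℂ) / 2)
        = Complex.exp (((1 : ℝ) : ℂ) * ((0 : ℝ) : ℂ) * Complex.I
          - (((variance (fun ω => g (Y 0 ω)) P).toNNReal : ℝ) : ℂ) * ((1 : ℝ) : ℂ) ^ 2 / 2) := by
      rw [Real.coe_toNNReal _ (variance_nonneg _ _), hV]
      simp
    rw [hlim]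
    refine h1.congr fun n => ?_
    rw [charFun_apply, charFun_apply, integral_map, integral_map]
    · refine integral_congr_ae (ae_of_all _ fun ω => ?_)
      have e3 : inner ℝ (normSum Y ψ (n, ω)) x = normSum Y g (n, ω) := by
        rw [hgdef, normSum_clm, innerSL_apply_apply, real_inner_comm]
      simp only [e3]
      simp [normSum, hE]
    · exact aemeasurable_normSum hY hψ.measurable n
    · fun_prop
    · have := aemeasurable_normSum hY hg.measurable n
      simpa [normSum, hE] using this
    · fun_prop

/-- An asymptotically linear estimator is asymptotically normal, and its asymptotic covariance
matrix is the covariance matrix of its influence function. -/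
lemma IsAsympLinear.isAN (hY : IsIID P Y ν) {est : ℕ → Ω → Param} {η : Param} {ψ : ℝ → Param}
    (hψ : IsScore ν ψ) (h : IsAsympLinear P Y (fun x => est x.1 x.2) η ψ)
    (hm : ∀ n, AEMeasurable (est n) P) {S : Matrix (Fin 2) (Fin 2) ℝ} (hS : S.PosSemidef)
    (hcov : ∀ i j, S i j = ∫ y, ψ y i * ψ y j ∂ν) : IsAN P est η S := by
  refine ⟨hS, tendstoInDistribution_of_tendstoInMeasure_sub _ _
    (hY.tendstoInDistribution_normSum hψ hS hcov) ?_ fun n => ?_⟩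
  · exact tendstoInMeasure_zero_iff.2 h
  · exact ((hm n).sub_const η).const_smul (√(n : ℝ))

end asympLinear

/-! ### Order statistics -/

section orderStat

variable {n : ℕ}

lemma orderStat_eq (z : Fin n → ℝ) (i : Fin n) : orderStat z (i + 1) = z (Tuple.sort z i) := by
  rw [orderStat, dif_pos ⟨by omega, by omega⟩]
  simp

lemma orderStat_le_iff (z : Fin n → ℝ) {i : ℕ} (h1 : 1 ≤ i) (hn : i ≤ n) (s : ℝ) :
    orderStat z i ≤ s ↔ i ≤ (Finset.univ.filter fun j => z j ≤ s).card := by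
  have h := Tuple.lt_card_le_iff_apply_le_of_monotone (f := z ∘ Tuple.sort z) (a := s)
    (j := ⟨i - 1, by omega⟩) (Tuple.monotone_sort z)
  have hc : (Finset.univ.filter fun j => (z ∘ Tuple.sort z) j ≤ s).card
      = (Finset.univ.filter fun j => z j ≤ s).card := by
    rw [← Fintype.card_subtype, ← Fintype.card_subtype]
    exact Fintype.card_congr ((Tuple.sort z).subtypeEquiv fun j => Iff.rfl)
  rw [hc] at h
  rw [orderStat, dif_pos ⟨h1, hn⟩]
  refine h.symm.trans ?_
  simp only
  omega

lemma orderStat_mono (z : Fin n → ℝ) {i j : ℕ} (h1 : 1 ≤ i) (hij : i ≤ j) (hn : j ≤ n) :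
    orderStat z i ≤ orderStat z j := by
  rw [orderStat, orderStat, dif_pos ⟨h1, hij.trans hn⟩, dif_pos ⟨h1.trans hij, hn⟩]
  exact Tuple.monotone_sort z (by rw [Fin.mk_le_mk]; omega)

lemma measurable_orderStat (i : ℕ) : Measurable fun z : Fin n → ℝ => orderStat z i := by
  by_cases h : 1 ≤ i ∧ i ≤ n
  · refine measurable_of_Iic fun s => ?_
    have e : (fun z : Fin n → ℝ => orderStat z i) ⁻¹' Set.Iic s
        = {z | (i : ℝ) ≤ ∑ j, if z j ≤ s then (1 : ℝ) else 0} := by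
      ext z
      simp only [Set.mem_preimage, Set.mem_Iic, orderStat_le_iff z h.1 h.2, Set.mem_ofPred_eq,
        Finset.sum_boole, Nat.cast_le]
    rw [e]
    refine measurableSet_le measurable_const (Finset.measurable_sum _ fun j _ => ?_)
    exact Measurable.ite (measurableSet_le (measurable_pi_apply j) measurable_const)
      measurable_const measurable_const
  · have e : (fun z : Fin n → ℝ => orderStat z i) = fun _ => 0 := by
      ext z; rw [orderStat, dif_neg h]
    rw [e]
    exact measurable_const

lemma orderStat_comp {f : ℝ → ℝ} (hf : Monotone f) (z : Fin n → ℝ) {i : ℕ} (h1 : 1 ≤ i)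
    (hn : i ≤ n) : orderStat (fun j => f (z j)) i = f (orderStat z i) := by
  rw [orderStat, orderStat, dif_pos ⟨h1, hn⟩, dif_pos ⟨h1, hn⟩]
  have := Tuple.unique_monotone (f := fun j => f (z j)) (σ := Tuple.sort fun j => f (z j))
    (τ := Tuple.sort z) (Tuple.monotone_sort _) (hf.comp (Tuple.monotone_sort z))
  exact congrFun this _

/-- Winsorizing the `m` smallest and the `m'` largest data amounts to clamping the data to the
interval between two order statistics. -/
lemma winsorized_sum_eq (g : ℝ → ℝ) (z : Fin n → ℝ) {m m' : ℕ} (h : m + m' < n) :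
    (m : ℝ) * g (orderStat z (m + 1)) + ∑ i ∈ Finset.Icc (m + 1) (n - m'), g (orderStat z i)
        + (m' : ℝ) * g (orderStat z (n - m'))
      = ∑ j, g (max (orderStat z (m + 1)) (min (orderStat z (n - m')) (z j))) := by
  set A := orderStat z (m + 1)
  set B := orderStat z (n - m')
  have hAB : A ≤ B := orderStat_mono z (by omega) (by omega) (by omega)
  have e1 : ∑ j, g (max A (min B (z j)))
      = ∑ i ∈ Finset.range n, g (max A (min B (orderStat z (i + 1)))) := by
    rw [← Equiv.sum_comp (Tuple.sort z), Finset.sum_range]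
    exact Finset.sum_congr rfl fun i _ => by rw [orderStat_eq]
  have e2 : ∑ i ∈ Finset.Icc (m + 1) (n - m'), g (orderStat z i)
      = ∑ i ∈ Finset.Ico m (n - m'), g (orderStat z (i + 1)) := by
    rw [Finset.sum_Ico_add' (fun i => g (orderStat z i)) m (n - m') 1]
    rfl
  rw [e1, e2, ← Finset.sum_range_add_sum_Ico _ (show m ≤ n by omega),
    ← Finset.sum_Ico_consecutive _ (show m ≤ n - m' by omega) (show n - m' ≤ n by omega)]
  have p1 : ∀ i ∈ Finset.range m, g (max A (min B (orderStat z (i + 1)))) = g A := by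
    intro i hi
    have hi' := Finset.mem_range.1 hi
    have : orderStat z (i + 1) ≤ A := orderStat_mono z (by omega) (by omega) (by omega)
    rw [min_eq_right (this.trans hAB), max_eq_left this]
  have p2 : ∀ i ∈ Finset.Ico m (n - m'), g (max A (min B (orderStat z (i + 1))))
      = g (orderStat z (i + 1)) := by
    intro i hi
    have hi' := Finset.mem_Ico.1 hi
    have h1 : A ≤ orderStat z (i + 1) := orderStat_mono z (by omega) (by omega) (by omega)
    have h2 : orderStat z (i + 1) ≤ B := orderStat_mono z (by omega) (by omega) (by omega)
    rw [min_eq_right h2, max_eq_right h1]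
  have p3 : ∀ i ∈ Finset.Ico (n - m') n, g (max A (min B (orderStat z (i + 1)))) = g B := by
    intro i hi
    have hi' := Finset.mem_Ico.1 hi
    have h2 : B ≤ orderStat z (i + 1) := orderStat_mono z (by omega) (by omega) (by omega)
    rw [min_eq_left h2, max_eq_right hAB]
  rw [Finset.sum_congr rfl p1, Finset.sum_congr rfl p2, Finset.sum_congr rfl p3]
  simp only [Finset.sum_const, Finset.card_range, Nat.card_Ico, nsmul_eq_mul]
  rw [show n - (n - m') = m' by omega]
  ring

end orderStat

/-! ### The Bahadur representation of order statistics -/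

section bahadur

variable {Ω : Type*} [MeasurableSpace Ω] {P : Measure Ω} {Y : ℕ → Ω → ℝ} {ν : Measure ℝ}

/-- The indicator function of `(-∞, s]`. -/
def below (s y : ℝ) : ℝ := if y ≤ s then 1 else 0

lemma measurable_below (s : ℝ) : Measurable (below s) :=
  Measurable.ite measurableSet_Iic measurable_const measurable_const

lemma below_nonneg (s y : ℝ) : 0 ≤ below s y := by unfold below; split_ifs <;> norm_num

lemma below_le_one (s y : ℝ) : below s y ≤ 1 := by unfold below; split_ifs <;> norm_num

lemma bounded_below (s : ℝ) : ∃ C, ∀ y, ‖below s y‖ ≤ C :=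
  ⟨1, fun y => by rw [Real.norm_of_nonneg (below_nonneg s y)]; exact below_le_one s y⟩

lemma below_mono {s u : ℝ} (h : s ≤ u) (y : ℝ) : below s y ≤ below u y := by
  unfold below
  split_ifs with h1 h2
  · exact le_rfl
  · exact absurd (h1.trans h) h2
  · norm_num
  · exact le_rfl

/-- The empirical distribution function. -/
def empCDF (Y : ℕ → Ω → ℝ) (s : ℝ) (x : ℕ × Ω) : ℝ :=
  (x.1 : ℝ)⁻¹ * ∑ i ∈ Finset.range x.1, below s (Y i x.2)

lemma card_le_eq {Ω : Type*} {Y : ℕ → Ω → ℝ} (s : ℝ) (x : ℕ × Ω) :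
    ((Finset.univ.filter fun j : Fin x.1 => Y j x.2 ≤ s).card : ℝ)
      = ∑ i ∈ Finset.range x.1, below s (Y i x.2) := by
  rw [Finset.sum_range, ← Finset.sum_boole]
  rfl

variable [IsProbabilityMeasure ν]

lemma integral_below (s : ℝ) : ∫ y, below s y ∂ν = cdf ν s := by
  have e : below s = (Set.Iic s).indicator 1 := by
    ext y; simp [below, Set.indicator_apply]
  rw [e, integral_indicator_one measurableSet_Iic, cdf_eq_real]

/-- The influence function of the quantile at `α`, where the law of the observations has
distribution function `p` and density `f`. -/
def quantileScore (α p f : ℝ) (y : ℝ) : ℝ := (p - below α y) / f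

lemma isScore_quantileScore {α p : ℝ} (hp : cdf ν α = p) (f : ℝ) :
    IsScore ν (quantileScore α p f) where
  measurable := (measurable_const.sub (measurable_below α)).div_const f
  bounded := by
    refine ⟨(|p| + 1) / |f|, fun y => ?_⟩
    unfold quantileScore
    rw [norm_div, Real.norm_eq_abs f]
    gcongr
    refine (norm_sub_le _ _).trans (add_le_add le_rfl ?_)
    rw [Real.norm_of_nonneg (below_nonneg α y)]
    exact below_le_one α y
  mean := by
    unfold quantileScore
    rw [integral_div, integral_sub (integrable_const _)
      (integrable_of_bounded (measurable_below α) (bounded_below α)), integral_below, hp]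
    simp

variable [IsProbabilityMeasure P]

/-- The oscillation of the empirical process over an interval of length `O(n^{-1/2})` is `o_P(1)`:
its variance is at most the probability of this interval. -/
lemma IsIID.tendsto_empirical_oscillation (hY : IsIID P Y ν) {α : ℝ}
    (hcont : ContinuousAt (cdf ν) α) {β : ℕ → ℝ} (hβ : Tendsto β atTop (𝓝 α)) :
    Tendsto (fun x : ℕ × Ω => √(x.1 : ℝ) * (empCDF Y (β x.1) x - empCDF Y α x
      - (cdf ν (β x.1) - cdf ν α))) (inProb P) (𝓝 0) := by
  set ψ : ℕ → ℝ → ℝ := fun n y => below (β n) y - below α y - (cdf ν (β n) - cdf ν α)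
  have hint : ∀ s, Integrable (below s) ν := fun s =>
    integrable_of_bounded (measurable_below s) (bounded_below s)
  have hintD : ∀ n, Integrable (fun y => below (β n) y - below α y) ν := fun n =>
    (hint _).sub (hint _)
  have hψ : ∀ n, IsScore ν (ψ n) := fun n => by
    refine ⟨((measurable_below _).sub (measurable_below _)).sub_const _, ?_, ?_⟩
    · refine ⟨1 + 1 + ‖cdf ν (β n) - cdf ν α‖, fun y => ?_⟩
      refine (norm_sub_le _ _).trans
        (add_le_add ((norm_sub_le _ _).trans (add_le_add ?_ ?_)) le_rfl)
      all_goals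
        rw [Real.norm_of_nonneg (below_nonneg _ y)]
        exact below_le_one _ y
    · simp only [ψ]
      rw [integral_sub (hintD n) (integrable_const _), integral_sub (hint _) (hint _),
        integral_below, integral_below]
      simp
  have hvar : ∀ n, ∫ y, ψ n y ^ 2 ∂ν ≤ |cdf ν (β n) - cdf ν α| := fun n => by
    -- the difference of two nested indicators is, up to a sign `ε`, equal to its square
    have hD : ∃ ε : ℝ, |ε| = 1 ∧ ∀ y, (below (β n) y - below α y) ^ 2
        = ε * (below (β n) y - below α y) := by
      have h01 : ∀ s y, below s y = 0 ∨ below s y = 1 := fun s y => by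
        unfold below; split_ifs <;> simp
      rcases le_total α (β n) with h | h
      · refine ⟨1, by simp, fun y => ?_⟩
        have := below_mono h y
        rcases h01 (β n) y with h1 | h1 <;> rcases h01 α y with h2 | h2 <;>
          rw [h1, h2] at this ⊢ <;> first | (norm_num; done) | (exfalso; linarith)
      · refine ⟨-1, by simp, fun y => ?_⟩
        have := below_mono h y
        rcases h01 (β n) y with h1 | h1 <;> rcases h01 α y with h2 | h2 <;>
          rw [h1, h2] at this ⊢ <;> first | (norm_num; done) | (exfalso; linarith)
    obtain ⟨ε, hε, hD⟩ := hD
    set m := cdf ν (β n) - cdf ν α with hm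
    have e : ∀ y, ψ n y ^ 2 = (ε - 2 * m) * (below (β n) y - below α y) + m ^ 2 := fun y => by
      have := hD y
      simp only [ψ]
      linear_combination this
    simp only [e]
    rw [integral_add ((hintD n).const_mul _) (integrable_const _), integral_const_mul,
      integral_sub (hint _) (hint _), integral_below, integral_below, ← hm]
    simp only [integral_const, probReal_univ, smul_eq_mul, one_mul]
    have h1 : ε * m ≤ |m| := by
      calc ε * m ≤ |ε * m| := le_abs_self _
        _ = |m| := by rw [abs_mul, hε, one_mul]
    nlinarith [sq_nonneg m]
  have h0 : Tendsto (fun n => |cdf ν (β n) - cdf ν α|) atTop (𝓝 0) := by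
    have := (tendsto_sub_nhds_zero_iff.2 (hcont.tendsto.comp hβ)).norm
    rwa [norm_zero] at this
  have key : Tendsto (fun x : ℕ × Ω => normSum Y (ψ x.1) x) (inProb P) (𝓝 0) := by
    rw [Metric.tendsto_nhds]
    intro δ hδ
    rw [eventually_inProb]
    have h1 : Tendsto (fun n => ENNReal.ofReal (|cdf ν (β n) - cdf ν α| / δ ^ 2)) atTop (𝓝 0) := by
      have := h0.div_const (δ ^ 2)
      rw [zero_div] at this
      rw [← ENNReal.ofReal_zero]
      exact (ENNReal.continuous_ofReal.tendsto 0).comp this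
    refine tendsto_of_tendsto_of_tendsto_of_le_of_le tendsto_const_nhds h1 (fun _ => zero_le)
      fun n => ?_
    refine le_trans (measure_mono fun ω hω => ?_) ((hY.measure_normSum_ge_le (hψ n) n hδ).trans
      (ENNReal.ofReal_le_ofReal (by gcongr; exact hvar n)))
    simpa [Real.dist_eq] using hω
  refine key.congr' ?_
  filter_upwards [tendsto_fst_inProb.eventually (eventually_gt_atTop 0)] with x hx
  have hx' : (0 : ℝ) < x.1 := by exact_mod_cast hx
  simp only [normSum, ψ, empCDF, Finset.sum_sub_distrib, smul_eq_mul, Finset.sum_const,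
    Finset.card_range, nsmul_eq_mul]
  have hs : √(x.1 : ℝ) ≠ 0 := (Real.sqrt_pos.2 hx').ne'
  have e : (x.1 : ℝ) = √(x.1 : ℝ) * √(x.1 : ℝ) := (Real.mul_self_sqrt hx'.le).symm
  have e2 : (√(x.1 : ℝ))⁻¹ = √(x.1 : ℝ) * (x.1 : ℝ)⁻¹ := by
    nth_rewrite 3 [e]
    field_simp
  rw [e2]
  field_simp

/-- **Bahadur representation**, with the remainder `o_P(n^{-1/2})`: an order statistic of central
rank is asymptotically linear. The event `√n (Y_{r:n} - α) ≤ s` is an event about the empirical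
distribution function at `α + s / √n`; letting `s` run through a finite grid gives the claim. -/
lemma IsIID.isAsympLinear_orderStat (hY : IsIID P Y ν) {α p f : ℝ} (hp : cdf ν α = p)
    (hf : 0 < f) (hderiv : HasDerivAt (cdf ν) f α) (hp0 : 0 < p) (hp1 : p < 1) {r : ℕ → ℕ}
    (hr : Tendsto (fun n : ℕ => √(n : ℝ) * ((r n : ℝ) / n - p)) atTop (𝓝 0)) :
    IsAsympLinear P Y (fun x => orderStat (fun j : Fin x.1 => Y j x.2) (r x.1)) α
      (quantileScore α p f) := by
  set T : ℕ × Ω → ℝ := fun x =>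
    √(x.1 : ℝ) * (orderStat (fun j : Fin x.1 => Y j x.2) (r x.1) - α) with hT
  set V : ℕ × Ω → ℝ := normSum Y (quantileScore α p f) with hV
  have hpos : ∀ᶠ x in inProb P, 0 < x.1 :=
    tendsto_fst_inProb.eventually (eventually_gt_atTop 0)
  have hinv : Tendsto (fun n : ℕ => (√(n : ℝ))⁻¹) atTop (𝓝 0) :=
    tendsto_inv_atTop_zero.comp (Real.tendsto_sqrt_atTop.comp tendsto_natCast_atTop_atTop)
  have hrank : ∀ᶠ x : ℕ × Ω in inProb P, 1 ≤ r x.1 ∧ r x.1 ≤ x.1 := by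
    have h1 : Tendsto (fun n : ℕ => (r n : ℝ) / n) atTop (𝓝 p) := by
      have h2 := hinv.mul hr
      rw [zero_mul] at h2
      rw [← tendsto_sub_nhds_zero_iff]
      refine h2.congr' ?_
      filter_upwards [eventually_gt_atTop 0] with n hn
      have : √(n : ℝ) ≠ 0 := (Real.sqrt_pos.2 (by exact_mod_cast hn)).ne'
      field_simp
    refine tendsto_fst_inProb.eventually (p := fun n => 1 ≤ r n ∧ r n ≤ n) ?_
    filter_upwards [h1.eventually_const_lt hp0, h1.eventually_lt_const hp1, eventually_gt_atTop 0]
      with n h2 h3 hn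
    have hn' : (0 : ℝ) < n := by exact_mod_cast hn
    rw [div_lt_one hn'] at h3
    have h2' : (0 : ℝ) < r n := by
      by_contra hcon
      have : (r n : ℝ) = 0 := le_antisymm (not_lt.1 hcon) (Nat.cast_nonneg _)
      rw [this, zero_div] at h2
      exact lt_irrefl _ h2
    exact ⟨by exact_mod_cast h2', by exact_mod_cast h3.le⟩
  -- the event `T ≤ s` in terms of a quantity that is close to `f * (s - V)`
  have hgrid : ∀ s : ℝ, ∃ E : ℕ × Ω → ℝ, Tendsto E (inProb P) (𝓝 0) ∧
      ∀ᶠ x in inProb P, (T x ≤ s ↔ 0 ≤ E x + f * (s - V x)) := by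
    intro s
    set β : ℕ → ℝ := fun n => α + s * (√(n : ℝ))⁻¹ with hβdef
    have hβ : Tendsto β atTop (𝓝 α) := by
      have := (hinv.const_mul s).const_add α
      rwa [mul_zero, add_zero] at this
    have hdet : Tendsto (fun n : ℕ => √(n : ℝ) * (cdf ν (β n) - cdf ν α) - f * s) atTop (𝓝 0) := by
      have h1 := (hasFDerivAt_iff_tendsto.1 hderiv.hasFDerivAt).comp hβ
      have h2 := h1.const_mul |s|
      rw [mul_zero] at h2
      rw [tendsto_zero_iff_norm_tendsto_zero]
      refine h2.congr' ?_
      filter_upwards [eventually_gt_atTop 0] with n hn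
      have hsq : 0 < √(n : ℝ) := Real.sqrt_pos.2 (by exact_mod_cast hn)
      rcases eq_or_ne s 0 with h0 | h0
      · simp [h0, hβdef]
      · have e1 : √(n : ℝ) * (cdf ν (β n) - cdf ν α) - f * s
            = √(n : ℝ) * (cdf ν (β n) - cdf ν α - (β n - α) * f) := by
          simp only [hβdef]; field_simp; ring
        have e2 : ‖β n - α‖ = |s| * (√(n : ℝ))⁻¹ := by
          simp only [hβdef, add_sub_cancel_left, norm_mul, Real.norm_eq_abs]
          rw [abs_of_pos (inv_pos.2 hsq)]
        rw [e1, norm_mul, Real.norm_of_nonneg hsq.le]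
        simp only [Function.comp_apply, e2]
        have : |s| ≠ 0 := abs_ne_zero.2 h0
        simp only [ContinuousLinearMap.toSpanSingleton_apply, smul_eq_mul]
        field_simp
    refine ⟨fun x => √(x.1 : ℝ) * (empCDF Y (β x.1) x - empCDF Y α x
      - (cdf ν (β x.1) - cdf ν α)) + (√(x.1 : ℝ) * (cdf ν (β x.1) - cdf ν α) - f * s)
      - √(x.1 : ℝ) * ((r x.1 : ℝ) / x.1 - p), ?_, ?_⟩
    · have := ((hY.tendsto_empirical_oscillation hderiv.continuousAt hβ).add
        (hdet.comp tendsto_fst_inProb)).sub (hr.comp tendsto_fst_inProb)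
      simpa using this
    · filter_upwards [hpos, hrank] with x hx hrk
      have hx' : (0 : ℝ) < x.1 := by exact_mod_cast hx
      have hsq : 0 < √(x.1 : ℝ) := Real.sqrt_pos.2 hx'
      have hVe : f * V x = √(x.1 : ℝ) * (p - empCDF Y α x) := by
        simp only [hV, normSum, quantileScore, empCDF, smul_eq_mul, ← Finset.sum_div,
          Finset.sum_sub_distrib, Finset.sum_const, Finset.card_range, nsmul_eq_mul]
        have e : (x.1 : ℝ) = √(x.1 : ℝ) * √(x.1 : ℝ) := (Real.mul_self_sqrt hx'.le).symm
        have e2 : (√(x.1 : ℝ))⁻¹ = √(x.1 : ℝ) * (x.1 : ℝ)⁻¹ := by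
          nth_rewrite 3 [e]
          field_simp
        rw [e2]
        field_simp
      have h1 : T x ≤ s ↔ orderStat (fun j : Fin x.1 => Y j x.2) (r x.1) ≤ β x.1 := by
        simp only [hT, hβdef]
        rw [← le_div_iff₀' hsq, div_eq_mul_inv]
        constructor <;> intro h <;> linarith
      rw [h1, orderStat_le_iff _ hrk.1 hrk.2, ← Nat.cast_le (α := ℝ), card_le_eq]
      have h2 : √(x.1 : ℝ) * (empCDF Y (β x.1) x - empCDF Y α x
          - (cdf ν (β x.1) - cdf ν α)) + (√(x.1 : ℝ) * (cdf ν (β x.1) - cdf ν α) - f * s)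
          - √(x.1 : ℝ) * ((r x.1 : ℝ) / x.1 - p) + f * (s - V x)
          = √(x.1 : ℝ) * (empCDF Y (β x.1) x - (r x.1 : ℝ) / x.1) := by
        linear_combination -hVe
      rw [h2, mul_nonneg_iff_of_pos_left hsq, sub_nonneg, empCDF, div_le_iff₀ hx', mul_comm,
        ← mul_assoc, mul_inv_cancel₀ hx'.ne', one_mul]
  choose E hE hTE using hgrid
  have hVt : IsTightSeq P V := hY.isTightSeq_normSum_real (isScore_quantileScore hp f)
  change Tendsto (fun x => T x - V x) (inProb P) (𝓝 0)
  rw [Metric.tendsto_nhds]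
  intro ε hε
  refine hVt.eventually fun K => ?_
  obtain ⟨N, hN⟩ := exists_nat_ge (4 * K / ε + 4)
  have hall : ∀ᶠ x in inProb P, ∀ j ∈ Finset.Icc (-(N : ℤ)) N,
      |E (j * (ε / 4)) x| < f * (ε / 4) ∧
        (T x ≤ j * (ε / 4) ↔ 0 ≤ E (j * (ε / 4)) x + f * (j * (ε / 4) - V x)) := by
    refine (Filter.eventually_all_finset _).2 fun j _ => ?_
    refine Eventually.and ?_ (hTE _)
    have := (hE (j * (ε / 4))).norm
    rw [norm_zero] at this
    exact this.eventually_lt_const (by positivity)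
  filter_upwards [hall] with x hx hK
  rw [Real.norm_eq_abs, abs_le] at hK
  have hV1 : -(N : ℝ) + 4 ≤ 4 * V x / ε := by
    rw [le_div_iff₀ hε]
    have : (4 * K / ε + 4) * ε ≤ N * ε := mul_le_mul_of_nonneg_right hN hε.le
    have e : (4 * K / ε + 4) * ε = 4 * K + 4 * ε := by field_simp
    nlinarith [hK.1]
  have hV2 : 4 * V x / ε ≤ (N : ℝ) - 4 := by
    rw [div_le_iff₀ hε]
    have : (4 * K / ε + 4) * ε ≤ N * ε := mul_le_mul_of_nonneg_right hN hε.le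
    have e : (4 * K / ε + 4) * ε = 4 * K + 4 * ε := by field_simp
    nlinarith [hK.2]
  rw [dist_zero_right, Real.norm_eq_abs, abs_lt]
  have hVε : V x = 4 * V x / ε * (ε / 4) := by field_simp
  constructor
  · -- a grid point between `V - ε` and `V - ε / 4`
    set j : ℤ := ⌈4 * V x / ε⌉ - 3 with hj
    have hc1 := Int.le_ceil (4 * V x / ε)
    have hc2 := Int.ceil_lt_add_one (4 * V x / ε)
    have hjr : (j : ℝ) = (⌈4 * V x / ε⌉ : ℝ) - 3 := by rw [hj]; push_cast; ring
    have hj1 : 4 * V x / ε - 3 ≤ j := by rw [hjr]; linarith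
    have hj2 : (j : ℝ) < 4 * V x / ε - 2 := by rw [hjr]; linarith
    have hmem : j ∈ Finset.Icc (-(N : ℤ)) N := by
      rw [Finset.mem_Icc]
      constructor
      · have : (-(N : ℝ)) ≤ j := by linarith
        exact_mod_cast this
      · have : (j : ℝ) ≤ N := by linarith
        exact_mod_cast this
    obtain ⟨g1, g2⟩ := hx j hmem
    have g3 : (j : ℝ) * (ε / 4) ≤ V x - 2 * (ε / 4) := by nlinarith
    have g4 : V x - 3 * (ε / 4) ≤ (j : ℝ) * (ε / 4) := by nlinarith
    have g5 : ¬ T x ≤ j * (ε / 4) := by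
      rw [g2, not_le]
      have := (abs_lt.1 g1).2
      nlinarith
    linarith [not_le.1 g5]
  · -- a grid point between `V + ε / 4` and `V + ε`
    set j : ℤ := ⌊4 * V x / ε⌋ + 3 with hj
    have hc1 := Int.floor_le (4 * V x / ε)
    have hc2 := Int.lt_floor_add_one (4 * V x / ε)
    have hjr : (j : ℝ) = (⌊4 * V x / ε⌋ : ℝ) + 3 := by rw [hj]; push_cast; ring
    have hj1 : 4 * V x / ε + 2 < j := by rw [hjr]; linarith
    have hj2 : (j : ℝ) ≤ 4 * V x / ε + 3 := by rw [hjr]; linarith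
    have hmem : j ∈ Finset.Icc (-(N : ℤ)) N := by
      rw [Finset.mem_Icc]
      constructor
      · have : (-(N : ℝ)) ≤ j := by linarith
        exact_mod_cast this
      · have : (j : ℝ) ≤ N := by linarith
        exact_mod_cast this
    obtain ⟨g1, g2⟩ := hx j hmem
    have g3 : V x + 2 * (ε / 4) ≤ (j : ℝ) * (ε / 4) := by nlinarith
    have g4 : (j : ℝ) * (ε / 4) ≤ V x + 3 * (ε / 4) := by nlinarith
    have g5 : T x ≤ j * (ε / 4) := by
      rw [g2]
      have := (abs_lt.1 g1).1
      nlinarith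
    linarith

end bahadur

/-! ### Winsorized means -/

section winsorizedMean

variable {Ω : Type*} [MeasurableSpace Ω] {P : Measure Ω} {Y : ℕ → Ω → ℝ} {ν : Measure ℝ}

/-- Moving the clamping bounds from `α < β` to `A`, `B` changes `g(A)` and `g(B)` for the clamped
data, and otherwise affects only the data between `α` and `A` and between `β` and `B`. -/
lemma abs_clamp_sub_le {g : ℝ → ℝ} {I : Set ℝ} {L : NNReal} (hg : LipschitzOnWith L g I)
    [I.OrdConnected] {A B α β : ℝ} (hA : A ∈ I) (hB : B ∈ I) (hα : α ∈ I) (hβ : β ∈ I)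
    (h : max A α < min B β) (y : ℝ) :
    |g (max A (min B y)) - g (max α (min β y)) - (g A - g α) * below α y
        - (g B - g β) * (1 - below β y)|
      ≤ L * |A - α| * (below (max A α) y - below (min A α) y)
        + L * |B - β| * (below (max B β) y - below (min B β) y) := by
  have hlip : ∀ {u v : ℝ}, u ∈ I → v ∈ I → |g u - g v| ≤ L * |u - v| := fun hu hv => by
    have := hg.dist_le_mul _ hu _ hv
    rwa [Real.dist_eq, Real.dist_eq] at this
  have hIcc : ∀ {u v w : ℝ}, u ∈ I → v ∈ I → u ≤ w → w ≤ v → w ∈ I := fun hu hv h1 h2 =>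
    Set.OrdConnected.out' hu hv ⟨h1, h2⟩
  obtain ⟨h1, h2⟩ := lt_min_iff.1 h
  obtain ⟨hAB, hαB⟩ := max_lt_iff.1 h1
  obtain ⟨hAβ, hαβ⟩ := max_lt_iff.1 h2
  have hL : (0 : ℝ) ≤ L := L.2
  have one : ∀ {s : ℝ}, y ≤ s → below s y = 1 := fun hs => by simp [below, hs]
  have zero : ∀ {s : ℝ}, s < y → below s y = 0 := fun hs => by simp [below, not_le.2 hs]
  have hLA : 0 ≤ L * |A - α| := mul_nonneg hL (abs_nonneg _)
  have hLB : 0 ≤ L * |B - β| := mul_nonneg hL (abs_nonneg _)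
  -- below `min B β` only the lower bounds matter, above it only the upper ones
  rcases lt_or_ge y (min B β) with hy | hy
  · obtain ⟨hyB, hyβ⟩ := lt_min_iff.1 hy
    rw [min_eq_right hyB.le, min_eq_right hyβ.le, one hyβ.le, one hy.le,
      one (hyB.le.trans (le_max_left B β))]
    rcases le_total A α with hc | hc
    · rw [max_eq_right hc, min_eq_left hc]
      rcases le_or_gt y A with h3 | h3
      · rw [one h3, one (h3.trans hc), max_eq_left h3, max_eq_left (h3.trans hc)]
        simp
      · rcases le_or_gt y α with h4 | h4
        · rw [zero h3, one h4, max_eq_right h3.le, max_eq_left h4]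
          have h5 := hlip (hIcc hA hα h3.le h4) hA
          have h6 : |y - A| ≤ |A - α| := by
            rw [abs_sub_comm A α, abs_of_pos (by linarith), abs_of_nonneg (by linarith)]
            linarith
          have h7 : (L : ℝ) * |y - A| ≤ L * |A - α| := mul_le_mul_of_nonneg_left h6 hL
          have e : g y - g α - (g A - g α) * 1 - (g B - g β) * (1 - 1) = g y - g A := by ring
          rw [e]
          linarith
        · rw [zero h3, zero h4, max_eq_right h3.le, max_eq_right h4.le]
          simp
    · rw [max_eq_left hc, min_eq_right hc]
      rcases le_or_gt y α with h3 | h3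
      · rw [one h3, one (h3.trans hc), max_eq_left h3, max_eq_left (h3.trans hc)]
        simp
      · rcases le_or_gt y A with h4 | h4
        · rw [zero h3, one h4, max_eq_left h4, max_eq_right h3.le]
          have h5 := hlip hA (hIcc hα hA h3.le h4)
          have h6 : |A - y| ≤ |A - α| := by
            rw [abs_of_nonneg (by linarith), abs_of_nonneg (by linarith)]
            linarith
          have h7 : (L : ℝ) * |A - y| ≤ L * |A - α| := mul_le_mul_of_nonneg_left h6 hL
          have e : g A - g y - (g A - g α) * 0 - (g B - g β) * (1 - 1) = g A - g y := by ring
          rw [e]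
          linarith
        · rw [zero h3, zero h4, max_eq_right h4.le, max_eq_right h3.le]
          simp
  · have hyA : max A α < y := h.trans_le hy
    obtain ⟨hyA', hyα'⟩ := max_lt_iff.1 hyA
    have hmA : A < min B y := lt_min hAB hyA'
    have hmα : α < min β y := lt_min hαβ hyα'
    rw [max_eq_right hmA.le, max_eq_right hmα.le, zero hyA, zero hyα',
      zero ((min_le_left A α).trans_lt hyA')]
    rcases le_total B β with hc | hc
    · rw [max_eq_right hc, min_eq_left hc]
      rw [min_eq_left hc] at hy
      rcases le_or_gt y β with h3 | h3
      · rw [one h3, min_eq_left hy, min_eq_right h3]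
        rcases eq_or_lt_of_le hy with h4 | h4
        · rw [← h4, sub_self]
          simp [below]
        · rw [zero h4]
          have h5 := hlip hB (hIcc hB hβ hy h3)
          have h6 : |B - y| ≤ |B - β| := by
            rw [abs_sub_comm, abs_sub_comm B β, abs_of_nonneg (by linarith),
              abs_of_nonneg (by linarith)]
            linarith
          have h7 : (L : ℝ) * |B - y| ≤ L * |B - β| := mul_le_mul_of_nonneg_left h6 hL
          have e : g B - g y - (g A - g α) * 0 - (g B - g β) * (1 - 1) = g B - g y := by ring
          rw [e]
          linarith
      · rw [zero h3, zero (hc.trans_lt h3), min_eq_left hy, min_eq_left h3.le]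
        simp
    · rw [max_eq_left hc, min_eq_right hc]
      rw [min_eq_right hc] at hy
      rcases le_or_gt y B with h3 | h3
      · rw [one h3, min_eq_right h3, min_eq_left hy]
        rcases eq_or_lt_of_le hy with h4 | h4
        · rw [← h4, sub_self]
          simp [below]
        · rw [zero h4]
          have h5 := hlip (hIcc hβ hB hy h3) hB
          have h6 : |y - B| ≤ |B - β| := by
            rw [abs_sub_comm, abs_of_nonneg (by linarith), abs_of_nonneg (by linarith)]
            linarith
          have h7 : (L : ℝ) * |y - B| ≤ L * |B - β| := mul_le_mul_of_nonneg_left h6 hL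
          have e : g y - g β - (g A - g α) * 0 - (g B - g β) * (1 - 0) = g y - g B := by ring
          rw [e]
          linarith
      · rw [zero h3, zero (hc.trans_lt h3), min_eq_left h3.le, min_eq_left hy]
        simp

lemma IsAsympLinear.of_tendsto_sub {est est' : ℕ × Ω → ℝ} {η : ℝ} {ψ : ℝ → ℝ}
    (h : IsAsympLinear P Y est η ψ)
    (h' : Tendsto (fun x => √((x : ℕ × Ω).1 : ℝ) * (est' x - est x)) (inProb P) (𝓝 0)) :
    IsAsympLinear P Y est' η ψ := by
  have h1 := Tendsto.add h h'
  rw [add_zero] at h1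
  refine h1.congr fun x => ?_
  simp only [smul_eq_mul]
  ring

lemma isAsympLinear_mean (φ : ℝ → ℝ) (m : ℝ) :
    IsAsympLinear P Y (fun x => (x.1 : ℝ)⁻¹ * ∑ i ∈ Finset.range x.1, φ (Y i x.2)) m
      (fun y => φ y - m) := by
  refine Tendsto.congr' ?_ tendsto_const_nhds
  filter_upwards [tendsto_fst_inProb.eventually (eventually_gt_atTop 0)] with x hx
  have hx' : (0 : ℝ) < x.1 := by exact_mod_cast hx
  have hsq : 0 < √(x.1 : ℝ) := Real.sqrt_pos.2 hx'
  have e : (x.1 : ℝ) = √(x.1 : ℝ) * √(x.1 : ℝ) := (Real.mul_self_sqrt hx'.le).symm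
  have e2 : (√(x.1 : ℝ))⁻¹ = √(x.1 : ℝ) * (x.1 : ℝ)⁻¹ := by
    nth_rewrite 3 [e]
    field_simp
  simp only [normSum, Finset.sum_sub_distrib, smul_eq_mul, Finset.sum_const, Finset.card_range,
    nsmul_eq_mul, e2]
  field_simp
  ring

variable [IsProbabilityMeasure P] [IsProbabilityMeasure ν]

lemma IsIID.tendsto_empCDF (hY : IsIID P Y ν) (s : ℝ) :
    Tendsto (empCDF Y s) (inProb P) (𝓝 (cdf ν s)) := by
  rw [← integral_below]
  exact hY.tendsto_mean (measurable_below s) (bounded_below s)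

lemma empCDF_mono {Ω : Type*} {Y : ℕ → Ω → ℝ} {s u : ℝ} (h : s ≤ u) (x : ℕ × Ω) :
    empCDF Y s x ≤ empCDF Y u x := by
  unfold empCDF
  gcongr
  exact below_mono h _

/-- The proportion of data between a consistent estimator of `α` and `α` itself tends to zero, if
the distribution function is continuous at `α`. -/
lemma IsIID.tendsto_empCDF_max_sub_min (hY : IsIID P Y ν) {α : ℝ}
    (hcont : ContinuousAt (cdf ν) α) {A : ℕ × Ω → ℝ} (hA : Tendsto A (inProb P) (𝓝 α)) :
    Tendsto (fun x => empCDF Y (max (A x) α) x - empCDF Y (min (A x) α) x) (inProb P) (𝓝 0) := by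
  rw [Metric.tendsto_nhds]
  intro ε hε
  obtain ⟨δ, hδ, hcδ⟩ := Metric.continuousAt_iff.1 hcont (ε / 4) (by positivity)
  have h1 : |cdf ν (α + δ / 2) - cdf ν α| < ε / 4 := by
    have := hcδ (x := α + δ / 2)
      (by rw [Real.dist_eq, add_sub_cancel_left, abs_of_pos] <;> linarith)
    rwa [Real.dist_eq] at this
  have h2 : |cdf ν (α - δ / 2) - cdf ν α| < ε / 4 := by
    have := hcδ (x := α - δ / 2) (by
      rw [Real.dist_eq, show α - δ / 2 - α = -(δ / 2) by ring, abs_neg, abs_of_pos] <;> linarith)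
    rwa [Real.dist_eq] at this
  have h3 := ((hY.tendsto_empCDF (α + δ / 2)).sub (hY.tendsto_empCDF (α - δ / 2)))
  have h4 : cdf ν (α + δ / 2) - cdf ν (α - δ / 2) < ε := by
    linarith [(abs_lt.1 h1).2, (abs_lt.1 h2).1]
  filter_upwards [h3.eventually_lt_const h4,
    (Metric.tendsto_nhds.1 hA) (δ / 2) (by positivity)] with x hx hAx
  rw [Real.dist_eq, abs_lt] at hAx
  have h5 : empCDF Y (max (A x) α) x ≤ empCDF Y (α + δ / 2) x :=
    empCDF_mono (max_le (by linarith) (by linarith)) x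
  have h6 : empCDF Y (α - δ / 2) x ≤ empCDF Y (min (A x) α) x :=
    empCDF_mono (le_min (by linarith) (by linarith)) x
  have h7 : empCDF Y (min (A x) α) x ≤ empCDF Y (max (A x) α) x :=
    empCDF_mono min_le_max x
  rw [dist_zero_right, Real.norm_of_nonneg (by linarith)]
  linarith

/-- Winsorized means are asymptotically linear. The influence function is that of a mean of
clamped data, corrected for the estimation of the two clamping bounds. -/
lemma IsIID.isAsympLinear_winsorized (hY : IsIID P Y ν) {α β p p' f f' : ℝ} (hαβ : α < β)
    (hp : cdf ν α = p) (hp' : cdf ν β = p') (hf : 0 < f) (hf' : 0 < f')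
    (hd : HasDerivAt (cdf ν) f α) (hd' : HasDerivAt (cdf ν) f' β)
    (hp0 : 0 < p) (hp1 : p < 1) (hp0' : 0 < p') (hp1' : p' < 1) {r r' : ℕ → ℕ}
    (hr : Tendsto (fun n : ℕ => √(n : ℝ) * ((r n : ℝ) / n - p)) atTop (𝓝 0))
    (hr' : Tendsto (fun n : ℕ => √(n : ℝ) * ((r' n : ℝ) / n - p')) atTop (𝓝 0))
    {g : ℝ → ℝ} {gα gβ : ℝ} (hgα : HasDerivAt g gα α) (hgβ : HasDerivAt g gβ β) {L : NNReal}
    (hL : LipschitzOnWith L g (Set.Icc (α - 1) (β + 1))) (m : ℝ) :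
    IsAsympLinear P Y (fun x => (x.1 : ℝ)⁻¹ * ∑ i ∈ Finset.range x.1,
        g (max (orderStat (fun j : Fin x.1 => Y j x.2) (r x.1))
          (min (orderStat (fun j : Fin x.1 => Y j x.2) (r' x.1)) (Y i x.2)))) m
      (fun y => g (max α (min β y)) - m + (p * (gα * quantileScore α p f y)
        + (1 - p') * (gβ * quantileScore β p' f' y))) := by
  set A : ℕ × Ω → ℝ := fun x => orderStat (fun j : Fin x.1 => Y j x.2) (r x.1) with hAdef
  set B : ℕ × Ω → ℝ := fun x => orderStat (fun j : Fin x.1 => Y j x.2) (r' x.1) with hBdef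
  have hA : IsAsympLinear P Y A α (quantileScore α p f) :=
    hY.isAsympLinear_orderStat hp hf hd hp0 hp1 hr
  have hB : IsAsympLinear P Y B β (quantileScore β p' f') :=
    hY.isAsympLinear_orderStat hp' hf' hd' hp0' hp1' hr'
  have sA := isScore_quantileScore (ν := ν) hp f
  have sB := isScore_quantileScore (ν := ν) hp' f'
  have tA := hY.isTightSeq_normSum_real sA
  have tB := hY.isTightSeq_normSum_real sB
  have cA : Tendsto A (inProb P) (𝓝 α) := hA.tendsto tA
  have cB : Tendsto B (inProb P) (𝓝 β) := hB.tendsto tB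
  have l1 : IsAsympLinear P Y (fun x => (g (A x) - g α) * empCDF Y α x) 0
      (fun y => p * (gα * quantileScore α p f y)) := by
    have h1 := hA.comp_hasFDerivAt tA hgα.hasFDerivAt
    have h2 := h1.sub_mul (hY.isTightSeq_normSum_real (sA.clm_comp _)) (hY.tendsto_empCDF α)
    simp only [hp] at h2
    simpa [mul_comm] using h2
  have l2 : IsAsympLinear P Y (fun x => (g (B x) - g β) * (1 - empCDF Y β x)) 0
      (fun y => (1 - p') * (gβ * quantileScore β p' f' y)) := by
    have h1 := hB.comp_hasFDerivAt tB hgβ.hasFDerivAt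
    have h2 := h1.sub_mul (hY.isTightSeq_normSum_real (sB.clm_comp _))
      ((hY.tendsto_empCDF β).const_sub 1)
    simp only [hp'] at h2
    simpa [mul_comm] using h2
  have l3 := (isAsympLinear_mean (P := P) (Y := Y) (fun y => g (max α (min β y))) m).add (l1.add l2)
  simp only [add_zero] at l3
  -- the error is at most `√n |A - α|`, which is tight, times a proportion that tends to zero, plus
  -- the same at the upper bound
  refine l3.of_tendsto_sub ?_
  have rA := (hA.isTightSeq tA).mul_tendsto_zero
    (hY.tendsto_empCDF_max_sub_min hd.continuousAt cA)
  have rB := (hB.isTightSeq tB).mul_tendsto_zero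
    (hY.tendsto_empCDF_max_sub_min hd'.continuousAt cB)
  have hbound := (rA.const_mul (L : ℝ)).add (rB.const_mul (L : ℝ))
  simp only [mul_zero, add_zero] at hbound
  refine squeeze_zero_norm' ?_ hbound
  filter_upwards [tendsto_fst_inProb.eventually (eventually_gt_atTop 0),
    (Metric.tendsto_nhds.1 cA) (min 1 ((β - α) / 4)) (lt_min one_pos (by linarith)),
    (Metric.tendsto_nhds.1 cB) (min 1 ((β - α) / 4)) (lt_min one_pos (by linarith))]
    with x hx hAx hBx
  have hx' : (0 : ℝ) < x.1 := by exact_mod_cast hx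
  have hsq : 0 < √(x.1 : ℝ) := Real.sqrt_pos.2 hx'
  rw [Real.dist_eq, lt_min_iff, abs_lt, abs_lt] at hAx hBx
  have hIA : A x ∈ Set.Icc (α - 1) (β + 1) := ⟨by linarith, by linarith⟩
  have hIB : B x ∈ Set.Icc (α - 1) (β + 1) := ⟨by linarith, by linarith⟩
  have hIα : α ∈ Set.Icc (α - 1) (β + 1) := ⟨by linarith, by linarith⟩
  have hIβ : β ∈ Set.Icc (α - 1) (β + 1) := ⟨by linarith, by linarith⟩
  have hsep : max (A x) α < min (B x) β :=
    max_lt (lt_min (by linarith) (by linarith)) (lt_min (by linarith) (by linarith))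
  have hpt := abs_clamp_sub_le hL hIA hIB hIα hIβ hsep
  have e1 : (x.1 : ℝ)⁻¹ * ∑ i ∈ Finset.range x.1, g (max (A x) (min (B x) (Y i x.2)))
      - ((x.1 : ℝ)⁻¹ * ∑ i ∈ Finset.range x.1, g (max α (min β (Y i x.2)))
        + ((g (A x) - g α) * empCDF Y α x + (g (B x) - g β) * (1 - empCDF Y β x)))
      = (x.1 : ℝ)⁻¹ * ∑ i ∈ Finset.range x.1,
        (g (max (A x) (min (B x) (Y i x.2))) - g (max α (min β (Y i x.2)))
          - (g (A x) - g α) * below α (Y i x.2) - (g (B x) - g β) * (1 - below β (Y i x.2))) := by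
    simp only [Finset.sum_sub_distrib, ← Finset.mul_sum, empCDF, Finset.sum_const,
      Finset.card_range, nsmul_eq_mul, mul_one]
    field_simp
    ring
  rw [e1, norm_mul, norm_mul, Real.norm_of_nonneg hsq.le,
    Real.norm_of_nonneg (inv_nonneg.2 hx'.le)]
  have e2 : ‖∑ i ∈ Finset.range x.1,
        (g (max (A x) (min (B x) (Y i x.2))) - g (max α (min β (Y i x.2)))
          - (g (A x) - g α) * below α (Y i x.2) - (g (B x) - g β) * (1 - below β (Y i x.2)))‖
      ≤ L * |A x - α| * (x.1 * (empCDF Y (max (A x) α) x - empCDF Y (min (A x) α) x))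
        + L * |B x - β| * (x.1 * (empCDF Y (max (B x) β) x - empCDF Y (min (B x) β) x)) := by
    refine (norm_sum_le _ _).trans ((Finset.sum_le_sum fun i _ => hpt (Y i x.2)).trans_eq ?_)
    simp only [Finset.sum_add_distrib, ← Finset.mul_sum, Finset.sum_sub_distrib, empCDF]
    field_simp
  calc √(x.1 : ℝ) * ((x.1 : ℝ)⁻¹ * _) ≤ √(x.1 : ℝ) * ((x.1 : ℝ)⁻¹ * _) :=
        mul_le_mul_of_nonneg_left
          (mul_le_mul_of_nonneg_left e2 (inv_nonneg.2 hx'.le)) hsq.le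
    _ = _ := by
      simp only [norm_smul, Real.norm_of_nonneg hsq.le, Real.norm_eq_abs]
      field_simp

end winsorizedMean

/-! ### The standardized observations -/

/-- The law of a standard normal variable clamped to `[γ, ξ]`. -/
def clampLaw (γ ξ : ℝ) : Measure ℝ := (gaussianReal 0 1).map fun x => max γ (min ξ x)

lemma measurable_clamp (γ ξ : ℝ) : Measurable fun x : ℝ => max γ (min ξ x) :=
  measurable_const.max (measurable_const.min measurable_id)

instance (γ ξ : ℝ) : IsProbabilityMeasure (clampLaw γ ξ) :=
  Measure.isProbabilityMeasure_map (measurable_clamp γ ξ).aemeasurable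

lemma integral_clampLaw (γ ξ : ℝ) {f : ℝ → ℝ} (hf : Measurable f) :
    ∫ y, f y ∂(clampLaw γ ξ) = ∫ x, f (max γ (min ξ x)) ∂(gaussianReal 0 1) :=
  integral_map (measurable_clamp γ ξ).aemeasurable hf.aestronglyMeasurable

lemma cdf_clampLaw {γ ξ s : ℝ} (h1 : γ ≤ s) (h2 : s < ξ) : cdf (clampLaw γ ξ) s = Phi s := by
  rw [Phi, cdf_eq_real, cdf_eq_real, clampLaw,
    map_measureReal_apply (measurable_clamp γ ξ) measurableSet_Iic]
  congr 1
  ext x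
  simp [h1, not_le.2 h2]

lemma hasDerivAt_cdf_clampLaw {γ ξ s : ℝ} (h1 : γ < s) (h2 : s < ξ) :
    HasDerivAt (cdf (clampLaw γ ξ)) (phi s) s := by
  refine (hasDerivAt_Phi s).congr_of_eventuallyEq ?_
  filter_upwards [Ioo_mem_nhds h1 h2] with u hu
  exact cdf_clampLaw hu.1.le hu.2

/-- Outside a null set, a function of a clamped normal variable that is constant on both sides of
an interval inside `[γ, ξ]` is a function that is constant on both tails. -/
lemma integral_clampLaw_tails {γ ξ p r L R : ℝ} {f g : ℝ → ℝ} (hf : Measurable f)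
    (hg : Continuous g) (h1 : γ ≤ p) (hpr : p < r) (h2 : r ≤ ξ)
    (hl : ∀ y, γ ≤ y → y ≤ p → f y = L) (hm : ∀ y, p < y → y < r → f y = g y)
    (hr : ∀ y, r < y → y ≤ ξ → f y = R) (hξ : r = ξ → f ξ = R) :
    ∫ y, f y ∂(clampLaw γ ξ) = Phi p * L + (∫ x in p..r, g x * phi x) + (1 - Phi r) * R := by
  rw [integral_clampLaw γ ξ hf, ← integral_tails hpr.le hg]
  have := nullSingletonClass_gaussianReal (μ := 0) (v := 1) one_ne_zero
  have hne : ∀ᵐ x ∂(gaussianReal 0 1), x ≠ r := by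
    rw [ae_iff]
    simp
  refine integral_congr_ae ?_
  filter_upwards [hne] with x hx
  unfold tails
  have hγξ : γ < ξ := by linarith
  rcases le_or_gt x p with h | h
  · rw [if_pos h]
    exact hl _ (le_max_left _ _) (max_le h1 ((min_le_right _ _).trans h))
  · rw [if_neg (not_le.2 h)]
    have hγx : γ ≤ x := h1.trans h.le
    rcases lt_or_gt_of_ne hx with h' | h'
    · rw [if_pos h', min_eq_right (h'.le.trans h2), max_eq_right hγx]
      exact hm x h h'
    · rw [if_neg (not_lt.2 h'.le), max_eq_right (le_min hγξ.le hγx)]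
      rcases eq_or_lt_of_le h2 with h3 | h3
      · rw [min_eq_left (by linarith)]
        exact hξ h3
      · exact hr _ (lt_min h3 h') (min_le_left _ _)

/-- The standardized observation `(h(z) - θ)/σ`. -/
def standardize (c t θ σ z : ℝ) : ℝ := (hZ c t z - θ) / σ

lemma measurable_standardize (c t θ σ : ℝ) : Measurable (standardize c t θ σ) := by
  unfold standardize hZ
  fun_prop

lemma standardize_payment {c t T θ σ : ℝ} (hc : 0 < c) (htT : t < T) (hσ : 0 < σ) (x : ℝ) :
    standardize c t θ σ (payment c t T (θ + σ * x))
      = max ((t - θ) / σ) (min ((T - θ) / σ) x) := by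
  have hmono : Monotone fun u : ℝ => (u - θ) / σ := fun u v h =>
    div_le_div_of_nonneg_right (sub_le_sub_right h θ) hσ.le
  rw [standardize, hZ_payment hc htT]
  have e : x = (θ + σ * x - θ) / σ := by field_simp; ring
  conv_rhs => rw [e]
  have h1 := hmono.map_max (a := t) (b := min T (θ + σ * x))
  have h2 := hmono.map_min (a := T) (b := θ + σ * x)
  rw [h1, h2]

lemma isIID_standardize {Ω : Type*} [MeasurableSpace Ω] {P : Measure Ω} {c t T θ σ : ℝ} (hc : 0 < c)
    (htT : t < T) (hσ : 0 < σ) {Z : ℕ → Ω → ℝ}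
    (hlaw : ∀ i, HasLaw (Z i) (paymentLaw c t T !₂[θ, σ]) P) (hindep : iIndepFun Z P) :
    IsIID P (fun i ω => standardize c t θ σ (Z i ω)) (clampLaw ((t - θ) / σ) ((T - θ) / σ)) where
  law i := by
    refine HasLaw.fun_comp (Y := standardize c t θ σ)
      ⟨(measurable_standardize c t θ σ).aemeasurable,
      ?_⟩ (hlaw i)
    rw [paymentLaw_eq_map, Measure.map_map (g := standardize c t θ σ)
      (f := fun x => payment c t T (!₂[θ, σ] 0 + !₂[θ, σ] 1 * x)) (measurable_standardize c t θ σ)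
      ((continuous_payment c t T).measurable.comp (by fun_prop)), clampLaw]
    congr 1
    ext x
    simp [standardize_payment hc htT hσ]
  indep := hindep.comp (fun _ => standardize c t θ σ) fun _ => measurable_standardize c t θ σ

/-! ### Covariance matrices of influence functions -/

section covariance

variable {ν : Measure ℝ} [IsProbabilityMeasure ν]

lemma integrable_mul_of_bounded {f g : ℝ → ℝ} (hf : Measurable f) (hg : Measurable g)
    (bf : ∃ C, ∀ y, ‖f y‖ ≤ C) (bg : ∃ C, ∀ y, ‖g y‖ ≤ C) :
    Integrable (fun y => f y * g y) ν := by
  obtain ⟨C, hC⟩ := bf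
  obtain ⟨D, hD⟩ := bg
  refine integrable_of_bounded (hf.mul hg) ⟨C * D, fun y => ?_⟩
  refine (norm_mul _ _).trans_le ?_
  exact mul_le_mul (hC y) (hD y) (norm_nonneg _) ((norm_nonneg _).trans (hC y))

lemma integral_lin_mul_lin {f g : ℝ → ℝ} (hf : Measurable f) (hg : Measurable g)
    (bf : ∃ C, ∀ y, ‖f y‖ ≤ C) (bg : ∃ C, ∀ y, ‖g y‖ ≤ C) (u w u' w' : ℝ) :
    ∫ y, (u * f y + w * g y) * (u' * f y + w' * g y) ∂ν
      = u * u' * (∫ y, f y * f y ∂ν) + (u * w' + w * u') * (∫ y, f y * g y ∂ν)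
        + w * w' * (∫ y, g y * g y ∂ν) := by
  have i1 := (integrable_mul_of_bounded (ν := ν) hf hf bf bf).const_mul (u * u')
  have i2 := (integrable_mul_of_bounded (ν := ν) hf hg bf bg).const_mul (u * w' + w * u')
  have i3 := (integrable_mul_of_bounded (ν := ν) hg hg bg bg).const_mul (w * w')
  have e : ∀ y, (u * f y + w * g y) * (u' * f y + w' * g y) = u * u' * (f y * f y)
      + (u * w' + w * u') * (f y * g y) + w * w' * (g y * g y) := fun y => by ring
  have i12 : Integrable (fun y => u * u' * (f y * f y) + (u * w' + w * u') * (f y * g y)) ν :=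
    i1.add i2
  simp only [e]
  rw [integral_add i12 i3, integral_add i1 i2, integral_const_mul, integral_const_mul,
    integral_const_mul]

lemma posSemidef_of_eq_integral {ψ : ℝ → Param} (hψ : IsScore ν ψ)
    {S : Matrix (Fin 2) (Fin 2) ℝ} (hcov : ∀ i j, S i j = ∫ y, ψ y i * ψ y j ∂ν) :
    S.PosSemidef := by
  refine Matrix.PosSemidef.of_dotProduct_mulVec_nonneg ?_ fun x => ?_
  · ext i j
    simp only [Matrix.conjTranspose_apply, star_trivial, hcov, mul_comm]
  · have hms : ∀ i, Measurable fun y => ψ y i := fun i =>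
      (EuclideanSpace.proj (𝕜 := ℝ) i).continuous.measurable.comp hψ.measurable
    have hbd : ∀ i, ∃ C, ∀ y, ‖ψ y i‖ ≤ C := fun i => by
      obtain ⟨D, hD⟩ := hψ.bounded
      exact ⟨D, fun y => (PiLp.norm_apply_le _ i).trans (hD y)⟩
    have h := integral_lin_mul_lin (ν := ν) (hms 0) (hms 1) (hbd 0) (hbd 1) (x 0) (x 1) (x 0) (x 1)
    have h0 : 0 ≤ ∫ y, (x 0 * ψ y 0 + x 1 * ψ y 1) * (x 0 * ψ y 0 + x 1 * ψ y 1) ∂ν :=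
      integral_nonneg fun y => mul_self_nonneg _
    have h10 : S 1 0 = S 0 1 := by simp only [hcov, mul_comm]
    rw [h, ← hcov, ← hcov, ← hcov] at h0
    simp only [Matrix.mulVec, dotProduct, Fin.sum_univ_two, star_trivial, Pi.star_apply, h10]
    linarith

end covariance

/-! ### The constants `c*_k` as covariances -/

section kappa

variable {a b : ℝ}

/-- The influence function of the winsorized `k`-th moment of standard normal data, as a function
of the data. -/
def winsorScore (a b : ℝ) (k : ℕ) (y : ℝ) : ℝ :=
  max (q a) (min (q (1 - b)) y) ^ k - ck a b k
    + (a * (k * q a ^ (k - 1) * quantileScore (q a) a (phi (q a)) y)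
      + (1 - (1 - b)) * (k * q (1 - b) ^ (k - 1)
        * quantileScore (q (1 - b)) (1 - b) (phi (q (1 - b))) y))

lemma ckA_eq (ha : 0 < a) (hab : a < 1 - b) (hb : 0 < b) (k : ℕ) :
    ckA a b k = k * a * q a ^ (k - 1) / phi (q a) := (hasDerivAt_ck_left ha hab hb k).deriv

lemma ckB_eq (ha : 0 < a) (hab : a < 1 - b) (hb : 0 < b) (k : ℕ) :
    ckB a b k = -(k * b * q (1 - b) ^ (k - 1) / phi (q (1 - b))) :=
  (hasDerivAt_ck_right ha hab hb k).deriv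

lemma winsorScore_eq (ha : 0 < a) (hab : a < 1 - b) (hb : 0 < b) (k : ℕ) (y : ℝ) :
    winsorScore a b k y = max (q a) (min (q (1 - b)) y) ^ k - ck a b k
      + ckA a b k * (a - below (q a) y) - ckB a b k * (1 - b - below (q (1 - b)) y) := by
  rw [ckA_eq ha hab hb, ckB_eq ha hab hb]
  unfold winsorScore quantileScore
  have := (phi_pos (q a)).ne'
  have := (phi_pos (q (1 - b))).ne'
  field_simp
  ring

lemma measurable_winsorScore (k : ℕ) : Measurable (winsorScore a b k) := by
  unfold winsorScore quantileScore
  have h1 := measurable_below (q a)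
  have h2 := measurable_below (q (1 - b))
  have h3 := measurable_clamp (q a) (q (1 - b))
  exact ((h3.pow_const k).sub_const _).add
    ((((((measurable_const.sub h1).div_const _).const_mul _).const_mul _)).add
      (((measurable_const.sub h2).div_const _).const_mul _ |>.const_mul _))

lemma winsorScore_left (ha : 0 < a) (hab : a < 1 - b) (hb : 0 < b) (k : ℕ) {y : ℝ} (hy : y ≤ q a) :
    winsorScore a b k y = q a ^ k - ck a b k + ckA a b k * (a - 1) + ckB a b k * b := by
  have hq := q_lt_q ha hab (by linarith)
  rw [winsorScore_eq ha hab hb, min_eq_right (hy.trans hq.le), max_eq_left hy]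
  simp only [below, if_pos hy, if_pos (hy.trans hq.le)]
  ring

lemma winsorScore_mid (ha : 0 < a) (hab : a < 1 - b) (hb : 0 < b) (k : ℕ) {y : ℝ} (hy : q a < y)
    (hy' : y < q (1 - b)) :
    winsorScore a b k y = y ^ k + (ckA a b k * a + ckB a b k * b - ck a b k) := by
  rw [winsorScore_eq ha hab hb, min_eq_right hy'.le, max_eq_right hy.le]
  simp only [below, if_neg (not_le.2 hy), if_pos hy'.le]
  ring

lemma winsorScore_right (ha : 0 < a) (hab : a < 1 - b) (hb : 0 < b) (k : ℕ) {y : ℝ}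
    (hy : q (1 - b) < y) :
    winsorScore a b k y = q (1 - b) ^ k - ck a b k + ckA a b k * a + ckB a b k * (b - 1) := by
  have hq := q_lt_q ha hab (by linarith)
  rw [winsorScore_eq ha hab hb, min_eq_left hy.le, max_eq_right hq.le]
  simp only [below, if_neg (not_le.2 (hq.trans hy)), if_neg (not_le.2 hy)]
  ring

lemma bounded_winsorScore (ha : 0 < a) (hab : a < 1 - b) (hb : 0 < b) (k : ℕ) :
    ∃ C, ∀ y, ‖winsorScore a b k y‖ ≤ C := by
  have hq := q_lt_q ha hab (by linarith)
  obtain ⟨K, hK⟩ := (isCompact_Icc (a := q a) (b := q (1 - b))).exists_bound_of_continuousOn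
    (continuous_pow k).continuousOn
  refine ⟨K + |ck a b k| + |ckA a b k| * (|a| + 1) + |ckB a b k| * (|1 - b| + 1), fun y => ?_⟩
  rw [winsorScore_eq ha hab hb]
  have h1 : ‖max (q a) (min (q (1 - b)) y) ^ k‖ ≤ K :=
    hK _ ⟨le_max_left _ _, max_le hq.le (min_le_left _ _)⟩
  have hbel : ∀ s u : ℝ, ‖u - below s y‖ ≤ |u| + 1 := fun s u => by
    refine (norm_sub_le _ _).trans (add_le_add le_rfl ?_)
    rw [Real.norm_of_nonneg (below_nonneg s y)]
    exact below_le_one s y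
  refine (norm_sub_le _ _).trans (add_le_add ((norm_add_le _ _).trans
    (add_le_add ((norm_sub_le _ _).trans (add_le_add h1 le_rfl)) ?_)) ?_)
  · rw [norm_mul]
    exact mul_le_mul_of_nonneg_left (hbel _ _) (abs_nonneg _)
  · rw [norm_mul]
    exact mul_le_mul_of_nonneg_left (hbel _ _) (abs_nonneg _)

lemma integral_winsorScore {γ ξ : ℝ} (ha : 0 < a) (hab : a < 1 - b) (hb : 0 < b) (hγ : γ < q a)
    (hξ : q (1 - b) < ξ) (k : ℕ) : ∫ y, winsorScore a b k y ∂(clampLaw γ ξ) = 0 := by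
  have hq := q_lt_q ha hab (by linarith)
  have hc : Continuous fun y : ℝ =>
      y ^ k + (ckA a b k * a + ckB a b k * b - ck a b k) := by fun_prop
  rw [integral_clampLaw_tails (measurable_winsorScore k) hc hγ.le hq hξ.le
    (fun y _ hy => winsorScore_left ha hab hb k hy) (fun y h h' => winsorScore_mid ha hab hb k h h')
    (fun y h _ => winsorScore_right ha hab hb k h) (fun h => absurd h hξ.ne),
    Phi_q ha (by linarith), Phi_q (ha.trans hab) (by linarith)]
  simp only [add_mul]
  have hi : ∀ j : ℕ, IntervalIntegrable (fun y => y ^ j * phi y) volume (q a) (q (1 - b)) :=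
    fun j => ((continuous_pow j).mul continuous_phi).intervalIntegrable _ _
  have hi' : IntervalIntegrable (fun y => (ckA a b k * a + ckB a b k * b - ck a b k) * phi y) volume
      (q a) (q (1 - b)) := (continuous_const.mul continuous_phi).intervalIntegrable _ _
  rw [intervalIntegral.integral_add (hi k) hi', intervalIntegral.integral_const_mul,
    ← Phi_sub, Phi_q ha (by linarith),
    Phi_q (ha.trans hab) (by linarith)]
  have h1 := ck_eq ha hab hb k
  linear_combination (-1) * h1

lemma deriv_ck_sub_mul (ha : 0 < a) (hab : a < 1 - b) (hb : 0 < b) (i j : ℕ) :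
    deriv (fun x => ck x b (i + j) - ck x b i * ck x b j) a
      = ckA a b (i + j) - (ckA a b i * ck a b j + ck a b i * ckA a b j) := by
  have h := (hasDerivAt_ck_left ha hab hb (i + j)).sub
    ((hasDerivAt_ck_left ha hab hb i).mul (hasDerivAt_ck_left ha hab hb j))
  rw [ckA_eq ha hab hb, ckA_eq ha hab hb, ckA_eq ha hab hb]
  exact h.deriv

lemma deriv_ck_sub_mul' (ha : 0 < a) (hab : a < 1 - b) (hb : 0 < b) (i j : ℕ) :
    deriv (fun y => ck a y (i + j) - ck a y i * ck a y j) b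
      = ckB a b (i + j) - (ckB a b i * ck a b j + ck a b i * ckB a b j) := by
  have h := (hasDerivAt_ck_right ha hab hb (i + j)).sub
    ((hasDerivAt_ck_right ha hab hb i).mul (hasDerivAt_ck_right ha hab hb j))
  rw [ckB_eq ha hab hb, ckB_eq ha hab hb, ckB_eq ha hab hb]
  exact h.deriv

/-- The expression that defines `c*_1`, `2 c*_2` and `4 c*_3` is the covariance of the influence
functions of the winsorized moments of standard normal data. -/
lemma ckCov_eq_integral {γ ξ : ℝ} (ha : 0 < a) (hab : a < 1 - b) (hb : 0 < b) (hγ : γ < q a)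
    (hξ : q (1 - b) < ξ) {i j : ℕ} (hi : 1 ≤ i) (hj : 1 ≤ j) :
    ckCov a b i j = ∫ y, winsorScore a b i y * winsorScore a b j y ∂(clampLaw γ ξ) := by
  have hq := q_lt_q ha hab (by linarith)
  set ei := ckA a b i * a + ckB a b i * b - ck a b i with hei
  set ej := ckA a b j * a + ckB a b j * b - ck a b j with hej
  have hc : Continuous fun y : ℝ => (y ^ i + ei) * (y ^ j + ej) := by fun_prop
  rw [integral_clampLaw_tails (f := fun y => winsorScore a b i y * winsorScore a b j y)
    ((measurable_winsorScore i).mul (measurable_winsorScore j)) hc hγ.le hq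
    hξ.le
    (fun y _ hy => by
      rw [winsorScore_left ha hab hb i hy, winsorScore_left ha hab hb j hy])
    (fun y h h' => by
      rw [winsorScore_mid ha hab hb i h h', winsorScore_mid ha hab hb j h h'])
    (fun y h _ => by
      rw [winsorScore_right ha hab hb i h, winsorScore_right ha hab hb j h])
    (fun h => absurd h hξ.ne), Phi_q ha (by linarith), Phi_q (ha.trans hab) (by linarith)]
  have hI : ∀ (e : ℝ) (l : ℕ),
      IntervalIntegrable (fun y => e * (y ^ l * phi y)) volume (q a) (q (1 - b)) := fun e l =>
    (continuous_const.mul ((continuous_pow l).mul continuous_phi)).intervalIntegrable _ _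
  have hM : ∀ l, ∫ y in (q a)..(q (1 - b)), y ^ l * phi y
      = ck a b l - a * q a ^ l - b * q (1 - b) ^ l := fun l => by
    have := ck_eq ha hab hb l
    linarith
  have h0 : ∫ y in (q a)..(q (1 - b)), y ^ 0 * phi y = 1 - a - b := truncMoment_q_zero ha hab hb
  have hmid : ∫ y in (q a)..(q (1 - b)), (y ^ i + ei) * (y ^ j + ej) * phi y
      = (ck a b (i + j) - a * q a ^ (i + j) - b * q (1 - b) ^ (i + j))
        + ej * (ck a b i - a * q a ^ i - b * q (1 - b) ^ i)
        + ei * (ck a b j - a * q a ^ j - b * q (1 - b) ^ j) + ei * ej * (1 - a - b) := by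
    rw [← hM, ← hM, ← hM, ← h0, ← intervalIntegral.integral_const_mul,
      ← intervalIntegral.integral_const_mul, ← intervalIntegral.integral_const_mul]
    have hI1 : IntervalIntegrable (fun y => y ^ (i + j) * phi y) volume (q a) (q (1 - b)) := by
      simpa using hI 1 (i + j)
    rw [← intervalIntegral.integral_add hI1 (hI _ _),
      ← intervalIntegral.integral_add (hI1.add (hI _ _)) (hI _ _),
      ← intervalIntegral.integral_add ((hI1.add (hI _ _)).add (hI _ _)) (hI _ _)]
    refine intervalIntegral.integral_congr fun y _ => ?_
    ring
  rw [hmid, ckCov, deriv_ck_sub_mul ha hab hb, deriv_ck_sub_mul' ha hab hb]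
  have hAs : ckA a b (i + j) = q a ^ i * ckA a b j + q a ^ j * ckA a b i := by
    obtain ⟨i', rfl⟩ := Nat.exists_eq_add_of_le' hi
    obtain ⟨j', rfl⟩ := Nat.exists_eq_add_of_le' hj
    rw [ckA_eq ha hab hb, ckA_eq ha hab hb, ckA_eq ha hab hb,
      show i' + 1 + (j' + 1) - 1 = i' + j' + 1 by omega, Nat.add_sub_cancel, Nat.add_sub_cancel]
    push_cast
    ring
  have hBs : ckB a b (i + j) = q (1 - b) ^ i * ckB a b j + q (1 - b) ^ j * ckB a b i := by
    obtain ⟨i', rfl⟩ := Nat.exists_eq_add_of_le' hi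
    obtain ⟨j', rfl⟩ := Nat.exists_eq_add_of_le' hj
    rw [ckB_eq ha hab hb, ckB_eq ha hab hb, ckB_eq ha hab hb,
      show i' + 1 + (j' + 1) - 1 = i' + j' + 1 by omega, Nat.add_sub_cancel, Nat.add_sub_cancel]
    push_cast
    ring
  rw [hAs, hBs, hei, hej]
  ring

/-- The covariance matrix of the influence functions of the first two winsorized moments is
nonsingular: no nontrivial combination of them is constant between the clamping bounds. -/
lemma ckCov_det_pos (ha : 0 < a) (hab : a < 1 - b) (hb : 0 < b) :
    0 < ckCov a b 1 1 * ckCov a b 2 2 - ckCov a b 1 2 ^ 2 := by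
  have hq := q_lt_q ha hab (by linarith)
  set γ := q a - 1
  set ξ := q (1 - b) + 1
  have hγ : γ < q a := by simp [γ]
  have hξ : q (1 - b) < ξ := by simp [ξ]
  have hQ : ∀ x1 x2 : ℝ, (x1 ≠ 0 ∨ x2 ≠ 0) → 0 < x1 * x1 * ckCov a b 1 1
      + (x1 * x2 + x2 * x1) * ckCov a b 1 2 + x2 * x2 * ckCov a b 2 2 := fun x1 x2 hx => by
    rw [ckCov_eq_integral ha hab hb hγ hξ le_rfl le_rfl,
      ckCov_eq_integral ha hab hb hγ hξ le_rfl one_le_two,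
      ckCov_eq_integral ha hab hb hγ hξ one_le_two one_le_two,
      ← integral_lin_mul_lin (measurable_winsorScore 1) (measurable_winsorScore 2)
        (bounded_winsorScore ha hab hb 1) (bounded_winsorScore ha hab hb 2)]
    set e := x1 * (ckA a b 1 * a + ckB a b 1 * b - ck a b 1)
      + x2 * (ckA a b 2 * a + ckB a b 2 * b - ck a b 2) with he
    have hc : Continuous fun y : ℝ => (e + x1 * y + x2 * y ^ 2) ^ 2 := by fun_prop
    have hmeas : Measurable fun y => x1 * winsorScore a b 1 y + x2 * winsorScore a b 2 y :=
      ((measurable_winsorScore 1).const_mul _).add ((measurable_winsorScore 2).const_mul _)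
    rw [integral_clampLaw_tails (f := fun y => (x1 * winsorScore a b 1 y + x2 * winsorScore a b 2 y)
        * (x1 * winsorScore a b 1 y + x2 * winsorScore a b 2 y)) (hmeas.mul hmeas) hc hγ.le hq hξ.le
      (fun y _ hy => by
        rw [winsorScore_left ha hab hb 1 hy, winsorScore_left ha hab hb 2 hy])
      (fun y h h' => by
        rw [winsorScore_mid ha hab hb 1 h h', winsorScore_mid ha hab hb 2 h h', he]
        ring)
      (fun y h _ => by
        rw [winsorScore_right ha hab hb 1 h, winsorScore_right ha hab hb 2 h])
      (fun h => absurd h hξ.ne)]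
    have h1 := integral_sq_quadratic_pos hq hx e
    have h2 := Phi_pos (q a)
    have h3 := Phi_lt_one (q (1 - b))
    have h4 : 0 ≤ Phi (q a) * ((x1 * (q a ^ 1 - ck a b 1 + ckA a b 1 * (a - 1) + ckB a b 1 * b)
        + x2 * (q a ^ 2 - ck a b 2 + ckA a b 2 * (a - 1) + ckB a b 2 * b))
        * (x1 * (q a ^ 1 - ck a b 1 + ckA a b 1 * (a - 1) + ckB a b 1 * b)
        + x2 * (q a ^ 2 - ck a b 2 + ckA a b 2 * (a - 1) + ckB a b 2 * b))) :=
      mul_nonneg h2.le (mul_self_nonneg _)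
    have h5 : 0 ≤ (1 - Phi (q (1 - b))) * ((x1 * (q (1 - b) ^ 1 - ck a b 1 + ckA a b 1 * a
        + ckB a b 1 * (b - 1)) + x2 * (q (1 - b) ^ 2 - ck a b 2 + ckA a b 2 * a
        + ckB a b 2 * (b - 1))) * (x1 * (q (1 - b) ^ 1 - ck a b 1 + ckA a b 1 * a
        + ckB a b 1 * (b - 1)) + x2 * (q (1 - b) ^ 2 - ck a b 2 + ckA a b 2 * a
        + ckB a b 2 * (b - 1)))) :=
      mul_nonneg (by linarith) (mul_self_nonneg _)
    linarith
  have h11 := hQ 1 0 (by simp)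
  have h11' : 0 < ckCov a b 1 1 := by linarith
  have h := hQ (-ckCov a b 1 2) (ckCov a b 1 1) (Or.inr h11'.ne')
  have e : -ckCov a b 1 2 * -ckCov a b 1 2 * ckCov a b 1 1
      + (-ckCov a b 1 2 * ckCov a b 1 1 + ckCov a b 1 1 * -ckCov a b 1 2) * ckCov a b 1 2
      + ckCov a b 1 1 * ckCov a b 1 1 * ckCov a b 2 2
      = ckCov a b 1 1 * (ckCov a b 1 1 * ckCov a b 2 2 - ckCov a b 1 2 ^ 2) := by ring
  rw [e] at h
  exact (mul_pos_iff_of_pos_left h11').1 h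

lemma det_SMWM_pos (ha : 0 < a) (hab : a < 1 - b) (hb : 0 < b) {σ : ℝ} (hσ : 0 < σ) :
    0 < (SMWM a b σ).det := by
  have h1 := ckCov_det_pos ha hab hb
  have h2 := ck_two_sub_sq_pos ha hab hb
  have e : (SMWM a b σ).det = (σ ^ 2 / (ck a b 2 - ck a b 1 ^ 2) ^ 2) ^ 2
      * ((ck a b 2 - ck a b 1 ^ 2) ^ 2
        * ((ckCov a b 1 1 * ckCov a b 2 2 - ckCov a b 1 2 ^ 2) / 4)) := by
    simp only [SMWM, cs1, cs2, cs3, Matrix.det_fin_two, Matrix.smul_apply, smul_eq_mul,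
      Matrix.of_apply, Matrix.cons_val', Matrix.cons_val_zero, Matrix.cons_val_one,
      Matrix.cons_val_fin_one]
    ring
  rw [e]
  positivity

end kappa

/-! ### The winsorized moments of the sample -/

lemma monotone_standardize {c : ℝ} (hc : 0 < c) (t θ : ℝ) {σ : ℝ} (hσ : 0 < σ) :
    Monotone (standardize c t θ σ) := fun u v h => by
  unfold standardize hZ
  gcongr

lemma hZ_eq_standardize (c t θ : ℝ) {σ : ℝ} (hσ : 0 < σ) (z : ℝ) :
    hZ c t z = θ + σ * standardize c t θ σ z := by
  unfold standardize
  field_simp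
  ring

/-- The winsorized mean of the `k`-th powers of a sample, in terms of the clamped data. -/
def winsorMean {n : ℕ} (m m' : ℕ) (y : Fin n → ℝ) (k : ℕ) : ℝ :=
  (n : ℝ)⁻¹ * ∑ j, max (orderStat y (m + 1)) (min (orderStat y (n - m')) (y j)) ^ k

lemma sampleMoment_eq {c t θ σ : ℝ} (hc : 0 < c) (hσ : 0 < σ) {n m m' : ℕ} (h : m + m' < n)
    (z : Fin n → ℝ) (k : ℕ) :
    sampleMoment c t m m' z k = (n : ℝ)⁻¹ * ∑ j, (θ + σ *
      max (orderStat (fun j => standardize c t θ σ (z j)) (m + 1))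
        (min (orderStat (fun j => standardize c t θ σ (z j)) (n - m'))
          (standardize c t θ σ (z j)))) ^ k := by
  have hm := monotone_standardize hc t θ hσ
  rw [sampleMoment, winsorized_sum_eq (fun z => hZ c t z ^ k) z h, one_div,
    orderStat_comp hm z (by omega) (by omega), orderStat_comp hm z (by omega) (by omega)]
  congr 1
  refine Finset.sum_congr rfl fun j _ => ?_
  rw [hZ_eq_standardize c t θ hσ, hm.map_max, hm.map_min]

lemma sampleMoment_one {c t θ σ : ℝ} (hc : 0 < c) (hσ : 0 < σ) {n m m' : ℕ} (h : m + m' < n)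
    (z : Fin n → ℝ) :
    sampleMoment c t m m' z 1
      = θ + σ * winsorMean m m' (fun j => standardize c t θ σ (z j)) 1 := by
  have hn : (n : ℝ) ≠ 0 := by exact_mod_cast (by omega : n ≠ 0)
  rw [sampleMoment_eq (θ := θ) hc hσ h, winsorMean]
  simp only [pow_one, Finset.sum_add_distrib, ← Finset.mul_sum, Finset.sum_const, Finset.card_univ,
    Fintype.card_fin, nsmul_eq_mul]
  field_simp

lemma sampleMoment_two {c t θ σ : ℝ} (hc : 0 < c) (hσ : 0 < σ) {n m m' : ℕ} (h : m + m' < n)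
    (z : Fin n → ℝ) :
    sampleMoment c t m m' z 2
      = θ ^ 2 + 2 * θ * σ * winsorMean m m' (fun j => standardize c t θ σ (z j)) 1
        + σ ^ 2 * winsorMean m m' (fun j => standardize c t θ σ (z j)) 2 := by
  have hn : (n : ℝ) ≠ 0 := by exact_mod_cast (by omega : n ≠ 0)
  have e : ∀ u : ℝ, (θ + σ * u) ^ 2 = θ ^ 2 + 2 * θ * σ * u ^ 1 + σ ^ 2 * u ^ 2 := fun u => by ring
  rw [sampleMoment_eq (θ := θ) hc hσ h, winsorMean, winsorMean]
  simp only [e, Finset.sum_add_distrib, ← Finset.mul_sum, Finset.sum_const, Finset.card_univ,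
    Fintype.card_fin, nsmul_eq_mul]
  field_simp

/-- The estimator in terms of the winsorized moments of the standardized sample. -/
lemma mwm_eq {c t θ σ a b : ℝ} (hc : 0 < c) (hσ : 0 < σ) {n m m' : ℕ} (h : m + m' < n)
    (z : Fin n → ℝ) (V1 V2 : ℝ) (h1 : V1 = winsorMean m m' (fun j => standardize c t θ σ (z j)) 1)
    (h2 : V2 = winsorMean m m' (fun j => standardize c t θ σ (z j)) 2) :
    mwm c t a b m m' z = !₂[θ + σ * (V1 - ck a b 1 * √((V2 - V1 ^ 2) / (ck a b 2 - ck a b 1 ^ 2))),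
      σ * √((V2 - V1 ^ 2) / (ck a b 2 - ck a b 1 ^ 2))] := by
  have e : √((σ ^ 2 * (V2 - V1 ^ 2)) / (ck a b 2 - ck a b 1 ^ 2))
      = σ * √((V2 - V1 ^ 2) / (ck a b 2 - ck a b 1 ^ 2)) := by
    rw [mul_div_assoc, Real.sqrt_mul (sq_nonneg σ), Real.sqrt_sq hσ.le]
  simp only [mwm, sampleMoment_one (θ := θ) hc hσ h, sampleMoment_two (θ := θ) hc hσ h, ← h1, ← h2]
  rw [show θ ^ 2 + 2 * θ * σ * V1 + σ ^ 2 * V2 - (θ + σ * V1) ^ 2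
      = σ ^ 2 * (V2 - V1 ^ 2) by ring, e]
  congr 2
  ring

lemma measurable_mwm (c t a b : ℝ) {n : ℕ} (m m' : ℕ) :
    Measurable (mwm c t a b m m' : (Fin n → ℝ) → Param) := by
  have hs : ∀ k, Measurable fun z : Fin n → ℝ => sampleMoment c t m m' z k := fun k => by
    have ho : ∀ i, Measurable fun z : Fin n → ℝ => hZ c t (orderStat z i) ^ k := fun i =>
      (((measurable_orderStat i).div_const c).add_const t).pow_const k
    unfold sampleMoment
    exact ((((ho _).const_mul _).add (Finset.measurable_sum _ fun i _ => ho i)).add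
      ((ho _).const_mul _)).const_mul _
  have hsq : Measurable fun z : Fin n → ℝ => √((sampleMoment c t m m' z 2
      - sampleMoment c t m m' z 1 ^ 2) / (ck a b 2 - ck a b 1 ^ 2)) :=
    (((hs 2).sub ((hs 1).pow_const 2)).div_const _).sqrt
  refine (PiLp.continuous_toLp 2 fun _ : Fin 2 => ℝ).measurable.comp
    (measurable_pi_iff.2 fun i => ?_)
  fin_cases i
  · exact (hs 1).sub (hsq.const_mul _)
  · exact hsq

section ranks

variable {a b : ℝ} {m m' : ℕ → ℕ}

lemma tendsto_div_of_sqrt (hm : Tendsto (fun n : ℕ => √(n : ℝ) * ((m n : ℝ) / n - a)) atTop (𝓝 0)) :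
    Tendsto (fun n : ℕ => (m n : ℝ) / n) atTop (𝓝 a) := by
  have h1 : Tendsto (fun n : ℕ => (√(n : ℝ))⁻¹) atTop (𝓝 0) :=
    tendsto_inv_atTop_zero.comp (Real.tendsto_sqrt_atTop.comp tendsto_natCast_atTop_atTop)
  have h2 := h1.mul hm
  rw [← tendsto_sub_nhds_zero_iff]
  rw [zero_mul] at h2
  refine h2.congr' ?_
  filter_upwards [eventually_gt_atTop 0] with n hn
  have : 0 < √(n : ℝ) := Real.sqrt_pos.2 (by exact_mod_cast hn)
  field_simp

lemma tendsto_sqrt_succ (hm : Tendsto (fun n : ℕ => √(n : ℝ) * ((m n : ℝ) / n - a)) atTop (𝓝 0)) :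
    Tendsto (fun n : ℕ => √(n : ℝ) * (((m n + 1 : ℕ) : ℝ) / n - a)) atTop (𝓝 0) := by
  have h1 : Tendsto (fun n : ℕ => (√(n : ℝ))⁻¹) atTop (𝓝 0) :=
    tendsto_inv_atTop_zero.comp (Real.tendsto_sqrt_atTop.comp tendsto_natCast_atTop_atTop)
  have h2 := hm.add h1
  rw [add_zero] at h2
  refine h2.congr' ?_
  filter_upwards [eventually_gt_atTop 0] with n hn
  have hn' : (0 : ℝ) < n := by exact_mod_cast hn
  have hs : 0 < √(n : ℝ) := Real.sqrt_pos.2 hn'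
  have e : (√(n : ℝ))⁻¹ = √(n : ℝ) * (1 / n) := by
    conv_rhs => rw [← Real.sq_sqrt hn'.le, Real.sqrt_sq hs.le]
    field_simp
  rw [e]
  push_cast
  ring

lemma eventually_add_lt (hab : a < 1 - b)
    (hm : Tendsto (fun n : ℕ => √(n : ℝ) * ((m n : ℝ) / n - a)) atTop (𝓝 0))
    (hm' : Tendsto (fun n : ℕ => √(n : ℝ) * ((m' n : ℝ) / n - b)) atTop (𝓝 0)) :
    ∀ᶠ n in atTop, m n + m' n < n := by
  have h := (tendsto_div_of_sqrt hm).add (tendsto_div_of_sqrt hm')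
  filter_upwards [h.eventually_lt_const (show a + b < 1 by linarith), eventually_gt_atTop 0]
    with n h1 hn
  have hn' : (0 : ℝ) < n := by exact_mod_cast hn
  rw [← add_div, div_lt_one hn'] at h1
  exact_mod_cast h1

lemma tendsto_sqrt_sub (hab : a < 1 - b)
    (hm : Tendsto (fun n : ℕ => √(n : ℝ) * ((m n : ℝ) / n - a)) atTop (𝓝 0))
    (hm' : Tendsto (fun n : ℕ => √(n : ℝ) * ((m' n : ℝ) / n - b)) atTop (𝓝 0)) :
    Tendsto (fun n : ℕ => √(n : ℝ) * (((n - m' n : ℕ) : ℝ) / n - (1 - b))) atTop (𝓝 0) := by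
  have h := hm'.neg
  rw [neg_zero] at h
  refine h.congr' ?_
  filter_upwards [eventually_add_lt hab hm hm', eventually_gt_atTop 0] with n h1 hn
  have hn' : (0 : ℝ) < n := by exact_mod_cast hn
  rw [Nat.cast_sub (by omega)]
  field_simp
  ring

end ranks

section estimator

variable {Ω : Type*} [MeasurableSpace Ω] {P : Measure Ω} [IsProbabilityMeasure P]
  {Y : ℕ → Ω → ℝ} {a b γ ξ : ℝ} {m m' : ℕ → ℕ}

lemma isAsympLinear_winsorMean (hY : IsIID P Y (clampLaw γ ξ)) (ha : 0 < a) (hab : a < 1 - b)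
    (hb : 0 < b) (hγ : γ < q a) (hξ : q (1 - b) < ξ)
    (hm : Tendsto (fun n : ℕ => √(n : ℝ) * ((m n : ℝ) / n - a)) atTop (𝓝 0))
    (hm' : Tendsto (fun n : ℕ => √(n : ℝ) * ((m' n : ℝ) / n - b)) atTop (𝓝 0)) (k : ℕ) :
    IsAsympLinear P Y (fun x => winsorMean (m x.1) (m' x.1) (fun j : Fin x.1 => Y j x.2) k)
      (ck a b k) (winsorScore a b k) := by
  have hq := q_lt_q ha hab (by linarith)
  have hLip : ∃ L, LipschitzOnWith L (fun y : ℝ => y ^ k) (Set.Icc (q a - 1) (q (1 - b) + 1)) :=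
    ((contDiff_id.pow k).contDiffOn (n := 1)).exists_lipschitzOnWith one_ne_zero (convex_Icc _ _)
      isCompact_Icc
  obtain ⟨L, hL⟩ := hLip
  have h := hY.isAsympLinear_winsorized hq
    ((cdf_clampLaw hγ.le (hq.trans hξ)).trans (Phi_q ha (by linarith)))
    ((cdf_clampLaw (hγ.trans hq).le hξ).trans (Phi_q (ha.trans hab) (by linarith)))
    (phi_pos _) (phi_pos _) (hasDerivAt_cdf_clampLaw hγ (hq.trans hξ))
    (hasDerivAt_cdf_clampLaw (hγ.trans hq) hξ) ha (by linarith) (ha.trans hab) (by linarith)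
    (tendsto_sqrt_succ hm) (tendsto_sqrt_sub hab hm hm') (hasDerivAt_pow k (q a))
    (hasDerivAt_pow k (q (1 - b))) hL (ck a b k)
  refine IsAsympLinear.congr h (Eventually.of_forall fun x => ?_)
  rw [winsorMean, Finset.sum_range]

/-- The influence function of `(θ̂, σ̂)`. -/
def mwmScore (a b σ : ℝ) (y : ℝ) : Param :=
  let Δ := ck a b 2 - ck a b 1 ^ 2
  !₂[σ * ck a b 2 / Δ * winsorScore a b 1 y + -(σ * ck a b 1 / (2 * Δ)) * winsorScore a b 2 y,
    -(σ * ck a b 1 / Δ) * winsorScore a b 1 y + σ / (2 * Δ) * winsorScore a b 2 y]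

lemma isScore_toLp {ν : Measure ℝ} [IsProbabilityMeasure ν] {f g : ℝ → ℝ} (hf : IsScore ν f)
    (hg : IsScore ν g) : IsScore ν (fun y => (!₂[f y, g y] : Param)) := by
  have hms : Measurable fun y => (!₂[f y, g y] : Param) := by
    refine (PiLp.continuous_toLp 2 fun _ : Fin 2 => ℝ).measurable.comp
      (measurable_pi_iff.2 fun i => ?_)
    fin_cases i
    · exact hf.measurable
    · exact hg.measurable
  have hbd : ∃ C, ∀ y, ‖(!₂[f y, g y] : Param)‖ ≤ C := by
    obtain ⟨C, hC⟩ := hf.bounded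
    obtain ⟨D, hD⟩ := hg.bounded
    refine ⟨√(C ^ 2 + D ^ 2), fun y => ?_⟩
    rw [EuclideanSpace.norm_eq, Fin.sum_univ_two]
    refine Real.sqrt_le_sqrt (add_le_add ?_ ?_)
    · exact pow_le_pow_left₀ (norm_nonneg _) (hC y) 2
    · exact pow_le_pow_left₀ (norm_nonneg _) (hD y) 2
  refine ⟨hms, hbd, ?_⟩
  have hint := integrable_of_bounded (ν := ν) hms hbd
  ext i
  have h := (EuclideanSpace.proj (𝕜 := ℝ) i).integral_comp_comm hint
  refine h.symm.trans ?_
  fin_cases i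
  · exact hf.mean
  · exact hg.mean

lemma isScore_lin {ν : Measure ℝ} [IsProbabilityMeasure ν] {f g : ℝ → ℝ} (hf : IsScore ν f)
    (hg : IsScore ν g) (u w : ℝ) : IsScore ν (fun y => u * f y + w * g y) where
  measurable := (hf.measurable.const_mul u).add (hg.measurable.const_mul w)
  bounded := by
    obtain ⟨C, hC⟩ := hf.bounded
    obtain ⟨D, hD⟩ := hg.bounded
    refine ⟨‖u‖ * C + ‖w‖ * D, fun y => (norm_add_le _ _).trans (add_le_add ?_ ?_)⟩
    · rw [norm_mul]
      exact mul_le_mul_of_nonneg_left (hC y) (norm_nonneg _)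
    · rw [norm_mul]
      exact mul_le_mul_of_nonneg_left (hD y) (norm_nonneg _)
  mean := by
    rw [integral_add ((integrable_of_bounded hf.measurable hf.bounded).const_mul u)
      ((integrable_of_bounded hg.measurable hg.bounded).const_mul w), integral_const_mul,
      integral_const_mul, hf.mean, hg.mean, mul_zero, mul_zero, add_zero]

lemma isScore_winsorScore (ha : 0 < a) (hab : a < 1 - b) (hb : 0 < b) (hγ : γ < q a)
    (hξ : q (1 - b) < ξ) (k : ℕ) : IsScore (clampLaw γ ξ) (winsorScore a b k) :=
  ⟨measurable_winsorScore k, bounded_winsorScore ha hab hb k,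
    integral_winsorScore ha hab hb hγ hξ k⟩

lemma isScore_mwmScore (ha : 0 < a) (hab : a < 1 - b) (hb : 0 < b) (hγ : γ < q a)
    (hξ : q (1 - b) < ξ) (σ : ℝ) : IsScore (clampLaw γ ξ) (mwmScore a b σ) := by
  have h := isScore_winsorScore ha hab hb hγ hξ
  exact isScore_toLp (isScore_lin (h 1) (h 2) _ _) (isScore_lin (h 1) (h 2) _ _)

/-- The covariance matrix of the influence function of `(θ̂, σ̂)` is `S_{z,MWM}`. -/
lemma SMWM_eq_integral (ha : 0 < a) (hab : a < 1 - b) (hb : 0 < b) (hγ : γ < q a)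
    (hξ : q (1 - b) < ξ) (σ : ℝ) (i j : Fin 2) :
    SMWM a b σ i j = ∫ y, mwmScore a b σ y i * mwmScore a b σ y j ∂(clampLaw γ ξ) := by
  have hD := (ck_two_sub_sq_pos ha hab hb).ne'
  have key := fun u w u' w' : ℝ => integral_lin_mul_lin (ν := clampLaw γ ξ)
    (measurable_winsorScore 1) (measurable_winsorScore 2) (bounded_winsorScore ha hab hb 1)
    (bounded_winsorScore ha hab hb 2) u w u' w'
  simp only [← ckCov_eq_integral ha hab hb hγ hξ le_rfl le_rfl,
    ← ckCov_eq_integral ha hab hb hγ hξ le_rfl one_le_two,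
    ← ckCov_eq_integral ha hab hb hγ hξ one_le_two one_le_two] at key
  fin_cases i <;> fin_cases j <;> refine Eq.trans ?_ (key _ _ _ _).symm <;>
    simp [SMWM, cs1, cs2, cs3] <;> field_simp <;> ring

end estimator

/-! ### Asymptotics of the winsorized moment estimator -/

section mwmAsymptotics

variable {Ω : Type*} [MeasurableSpace Ω] {P : Measure Ω} [IsProbabilityMeasure P]
  {Z : ℕ → Ω → ℝ} {c t T θ σ a b : ℝ} {m m' : ℕ → ℕ}

lemma normalCDF_lt_iff (ha : 0 < a) (ha1 : a < 1) (x : ℝ) :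
    normalCDF !₂[θ, σ] x < a ↔ (x - θ) / σ < q a := by
  conv_lhs => rw [← Phi_q ha ha1]
  exact strictMono_Phi.lt_iff_lt

lemma lt_normalCDF_iff (ha : 0 < a) (ha1 : a < 1) (x : ℝ) :
    a < normalCDF !₂[θ, σ] x ↔ q a < (x - θ) / σ := by
  conv_lhs => rw [← Phi_q ha ha1]
  exact strictMono_Phi.lt_iff_lt

/-- The closed-form estimators `(θ̂, σ̂)` of the samples `Z 0, …, Z (n - 1)`. -/
def mwmSeq {Ω : Type*} (c t a b : ℝ) (m m' : ℕ → ℕ) (Z : ℕ → Ω → ℝ) (n : ℕ) (ω : Ω) : Param :=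
  mwm c t a b (m n) (m' n) (fun i : Fin n => Z i ω)

/-- The delta method for the closed form of the estimator. -/
lemma isAsympLinear_mwm {Y : ℕ → Ω → ℝ} {γ ξ : ℝ} (hY : IsIID P Y (clampLaw γ ξ))
    (hYZ : ∀ i ω, Y i ω = standardize c t θ σ (Z i ω)) (hc : 0 < c) (hσ : 0 < σ) (ha : 0 < a)
    (hab : a < 1 - b) (hb : 0 < b) (hγ : γ < q a) (hξ : q (1 - b) < ξ)
    (hm : Tendsto (fun n : ℕ => √(n : ℝ) * ((m n : ℝ) / n - a)) atTop (𝓝 0))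
    (hm' : Tendsto (fun n : ℕ => √(n : ℝ) * ((m' n : ℝ) / n - b)) atTop (𝓝 0)) :
    IsAsympLinear P Y
      (fun x => mwmSeq c t a b m m' Z x.1 x.2) !₂[θ, σ] (mwmScore a b σ) := by
  set V : ℕ × Ω → Param := fun x =>
    !₂[winsorMean (m x.1) (m' x.1) (fun j : Fin x.1 => Y j x.2) 1,
      winsorMean (m x.1) (m' x.1) (fun j : Fin x.1 => Y j x.2) 2] with hVdef
  have hV : IsAsympLinear P Y V !₂[ck a b 1, ck a b 2]
      (fun y => !₂[winsorScore a b 1 y, winsorScore a b 2 y]) := by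
    refine isAsympLinear_euclidean fun i => ?_
    fin_cases i
    · exact isAsympLinear_winsorMean hY ha hab hb hγ hξ hm hm' 1
    · exact isAsympLinear_winsorMean hY ha hab hb hγ hξ hm hm' 2
  have hs := isScore_winsorScore ha hab hb hγ hξ
  have hT := hY.isTightSeq_normSum (isScore_toLp (hs 1) (hs 2))
  set c1 := ck a b 1 with hc1
  set c2 := ck a b 2 with hc2
  have hΔ : 0 < c2 - c1 ^ 2 := ck_two_sub_sq_pos ha hab hb
  have hp0 : HasFDerivAt (fun v : Param => v 0) (EuclideanSpace.proj (𝕜 := ℝ) (0 : Fin 2))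
      !₂[c1, c2] := (EuclideanSpace.proj (𝕜 := ℝ) (0 : Fin 2)).hasFDerivAt
  have hp1 : HasFDerivAt (fun v : Param => v 1) (EuclideanSpace.proj (𝕜 := ℝ) (1 : Fin 2))
      !₂[c1, c2] := (EuclideanSpace.proj (𝕜 := ℝ) (1 : Fin 2)).hasFDerivAt
  have hsq := ((hp1.sub (hp0.pow 2)).mul_const (c2 - c1 ^ 2)⁻¹).sqrt (by
    simpa using hΔ.ne')
  have hone : √((c2 - c1 ^ 2) * (c2 - c1 ^ 2)⁻¹) = 1 := by
    rw [mul_inv_cancel₀ hΔ.ne', Real.sqrt_one]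
  have g0 := (hV.comp_hasFDerivAt hT ((hp0.sub (hsq.const_mul c1)).const_mul σ |>.const_add θ))
  have g1 := (hV.comp_hasFDerivAt hT (hsq.const_mul σ))
  have hG : IsAsympLinear P Y (fun x => (!₂[θ + σ * (V x 0 - c1 * √((V x 1 - V x 0 ^ 2)
      * (c2 - c1 ^ 2)⁻¹)), σ * √((V x 1 - V x 0 ^ 2) * (c2 - c1 ^ 2)⁻¹)] : Param)) !₂[θ, σ]
      (mwmScore a b σ) := by
    refine isAsympLinear_euclidean fun i => ?_
    fin_cases i
    · convert g0 using 1
      · ext x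
        simp
      · simp [hone]
      · ext y
        simp [mwmScore, ← hc1, ← hc2, hone]
        field_simp
        ring
    · convert g1 using 1
      · ext x
        simp
      · simp [hone]
      · ext y
        simp [mwmScore, ← hc1, ← hc2, hone]
        field_simp
        ring
  refine hG.congr ?_
  filter_upwards [tendsto_fst_inProb.eventually (eventually_add_lt hab hm hm')] with x hx
  rw [mwmSeq, mwm_eq (θ := θ) hc hσ hx _ (V x 0) (V x 1)
    (by simp [hVdef, hYZ]) (by simp [hVdef, hYZ])]
  simp only [div_eq_mul_inv, ← hc1, ← hc2]

lemma isAN_mwm (hc : 0 < c) (htT : t < T) (hσ : 0 < σ)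
    (hlaw : ∀ i, HasLaw (Z i) (paymentLaw c t T !₂[θ, σ]) P) (hindep : iIndepFun Z P)
    (ha : 0 < a) (hab : a < 1 - b) (hb : 0 < b) (hγ : (t - θ) / σ < q a)
    (hξ : q (1 - b) < (T - θ) / σ)
    (hm : Tendsto (fun n : ℕ => √(n : ℝ) * ((m n : ℝ) / n - a)) atTop (𝓝 0))
    (hm' : Tendsto (fun n : ℕ => √(n : ℝ) * ((m' n : ℝ) / n - b)) atTop (𝓝 0)) :
    IsAN P (mwmSeq c t a b m m' Z) !₂[θ, σ] (SMWM a b σ) := by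
  obtain ⟨Y, hYZ, hY⟩ : ∃ Y : ℕ → Ω → ℝ, (∀ i ω, Y i ω = standardize c t θ σ (Z i ω)) ∧
      IsIID P Y (clampLaw ((t - θ) / σ) ((T - θ) / σ)) :=
    ⟨_, fun _ _ => rfl, isIID_standardize hc htT hσ hlaw hindep⟩
  have hψ := isScore_mwmScore ha hab hb hγ hξ σ
  have hcov := SMWM_eq_integral ha hab hb hγ hξ σ
  have hAL := isAsympLinear_mwm (m := m) (m' := m') hY hYZ hc hσ ha hab hb hγ hξ hm hm'
  refine IsAsympLinear.isAN hY hψ hAL (fun n => ?_)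
    (posSemidef_of_eq_integral hψ hcov) hcov
  exact (measurable_mwm c t a b (m n) (m' n)).comp_aemeasurable
    (aemeasurable_pi_lambda _ fun i => (hlaw i).aemeasurable)

/-- The closed-form estimator is consistent, so that it eventually lies in the open part of the
parameter region in which it solves the moment equations. -/
lemma tendsto_measure_isMWM (hc : 0 < c) (htT : t < T) (hσ : 0 < σ)
    (hlaw : ∀ i, HasLaw (Z i) (paymentLaw c t T !₂[θ, σ]) P) (hindep : iIndepFun Z P)
    (ha : 0 < a) (hab : a < 1 - b) (hb : 0 < b) (hγ : (t - θ) / σ < q a)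
    (hξ : q (1 - b) < (T - θ) / σ)
    (hm : Tendsto (fun n : ℕ => √(n : ℝ) * ((m n : ℝ) / n - a)) atTop (𝓝 0))
    (hm' : Tendsto (fun n : ℕ => √(n : ℝ) * ((m' n : ℝ) / n - b)) atTop (𝓝 0)) :
    Tendsto (fun n : ℕ => P {ω | IsMWM c t T a b (m n) (m' n) (fun i : Fin n => Z i ω)
      (mwmSeq c t a b m m' Z n ω)}) atTop (𝓝 1) := by
  obtain ⟨Y, hYZ, hY⟩ : ∃ Y : ℕ → Ω → ℝ, (∀ i ω, Y i ω = standardize c t θ σ (Z i ω)) ∧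
      IsIID P Y (clampLaw ((t - θ) / σ) ((T - θ) / σ)) :=
    ⟨_, fun _ _ => rfl, isIID_standardize hc htT hσ hlaw hindep⟩
  have hAL := isAsympLinear_mwm (m := m) (m' := m') hY hYZ hc hσ ha hab hb hγ hξ hm hm'
  have hψ : IsTightSeq P (normSum Y (mwmScore a b σ)) :=
    hY.isTightSeq_normSum (ι := Fin 2) (isScore_mwmScore ha hab hb hγ hξ σ)
  have hT : Tendsto (fun x : ℕ × Ω => mwmSeq c t a b m m' Z x.1 x.2) (inProb P) (𝓝 !₂[θ, σ]) :=
    hAL.tendsto hψ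
  have c0 : ContinuousAt (fun η : Param => η 0) !₂[θ, σ] :=
    (EuclideanSpace.proj (𝕜 := ℝ) (0 : Fin 2)).continuous.continuousAt
  have c1 : ContinuousAt (fun η : Param => η 1) !₂[θ, σ] :=
    (EuclideanSpace.proj (𝕜 := ℝ) (1 : Fin 2)).continuous.continuousAt
  have hcdf : ∀ x, ContinuousAt (fun η : Param => normalCDF η x) !₂[θ, σ] := fun x =>
    continuous_Phi.continuousAt.comp ((continuousAt_const.sub c0).div c1 hσ.ne')
  have e1 : ∀ᶠ x in inProb P, 0 < mwmSeq c t a b m m' Z x.1 x.2 1 :=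
    (c1.tendsto.comp hT).eventually_const_lt hσ
  have e2 : ∀ᶠ x in inProb P, normalCDF (mwmSeq c t a b m m' Z x.1 x.2) t < a :=
    ((hcdf t).tendsto.comp hT).eventually_lt_const
    ((normalCDF_lt_iff ha (by linarith) t).2 hγ)
  have e3 : ∀ᶠ x in inProb P, 1 - b < normalCDF (mwmSeq c t a b m m' Z x.1 x.2) T :=
    ((hcdf T).tendsto.comp hT).eventually_const_lt
    ((lt_normalCDF_iff (ha.trans hab) (by linarith) T).2 hξ)
  refine tendsto_measure_one_of_eventually (p := fun x => IsMWM c t T a b (m x.1) (m' x.1)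
    (fun i : Fin x.1 => Z i x.2) (mwmSeq c t a b m m' Z x.1 x.2)) ?_
  filter_upwards [e1, e2, e3] with x h1 h2 h3
  rw [isMWM_iff hc htT]
  exact ⟨h1, ⟨h2.le, hab, h3.le⟩, by rw [mwmSeq]⟩

lemma tendsto_measure_censored (hc : 0 < c) (htT : t < T) (hσ : 0 < σ)
    (hlaw : ∀ i, HasLaw (Z i) (paymentLaw c t T !₂[θ, σ]) P) (hindep : iIndepFun Z P)
    (ha : 0 < a) (hab : a < 1 - b) (hb : 0 < b) (hγ : (t - θ) / σ < q a)
    (hξ : q (1 - b) < (T - θ) / σ)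
    (hm : Tendsto (fun n : ℕ => √(n : ℝ) * ((m n : ℝ) / n - a)) atTop (𝓝 0))
    (hm' : Tendsto (fun n : ℕ => √(n : ℝ) * ((m' n : ℝ) / n - b)) atTop (𝓝 0)) :
    Tendsto (fun n : ℕ => P {ω | Nat.card {i : Fin n // Z i ω = 0} ≤ m n ∧
      Nat.card {i : Fin n // Z i ω = c * (T - t)} ≤ m' n}) atTop (𝓝 1) := by
  have hY := isIID_standardize hc htT hσ hlaw hindep
  set Y : ℕ → Ω → ℝ := fun i ω => standardize c t θ σ (Z i ω) with hYdef
  have hq := q_lt_q ha hab (by linarith)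
  -- the upper count is compared with the empirical distribution function at a point `s` below
  -- the atom at `(T - θ) / σ`, yet above the quantile
  obtain ⟨s, hs1, hs2⟩ := exists_between hξ
  have l1 := hY.tendsto_empCDF ((t - θ) / σ)
  have l2 := hY.tendsto_empCDF s
  rw [cdf_clampLaw le_rfl (hγ.trans (hq.trans hξ))] at l1
  rw [cdf_clampLaw (hγ.trans (hq.trans hs1)).le hs2] at l2
  have m1 := (tendsto_div_of_sqrt hm).comp (tendsto_fst_inProb (P := P))
  have m2 := (tendsto_div_of_sqrt hm').comp (tendsto_fst_inProb (P := P))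
  have p1 : Phi ((t - θ) / σ) < a := by
    conv_rhs => rw [← Phi_q ha (by linarith)]
    exact strictMono_Phi hγ
  have p2 : 1 - b < Phi s := by
    conv_lhs => rw [← Phi_q (ha.trans hab) (by linarith)]
    exact strictMono_Phi hs1
  have d1 := (m1.sub l1).eventually_const_lt (sub_pos.2 p1)
  have d2 := (m2.add l2).eventually_const_lt (show 1 < b + Phi s by linarith)
  refine tendsto_measure_one_of_eventually (p := fun x =>
    Nat.card {i : Fin x.1 // Z i x.2 = 0} ≤ m x.1 ∧
      Nat.card {i : Fin x.1 // Z i x.2 = c * (T - t)} ≤ m' x.1) ?_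
  filter_upwards [d1, d2, tendsto_fst_inProb.eventually (eventually_gt_atTop 0)] with x h1 h2 hx
  classical
  have hx' : (0 : ℝ) < x.1 := by exact_mod_cast hx
  have hcard := fun u : ℝ => card_le_eq (Y := Y) u x
  simp only [Function.comp_apply, empCDF, ← hcard] at h1 h2
  rw [Nat.card_eq_fintype_card, Nat.card_eq_fintype_card, Fintype.card_subtype,
    Fintype.card_subtype]
  constructor
  · have hle : (Finset.univ.filter fun i : Fin x.1 => Z i x.2 = 0).card
        ≤ (Finset.univ.filter fun i : Fin x.1 => Y i x.2 ≤ (t - θ) / σ).card := by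
      refine Finset.card_le_card (Finset.monotone_filter_right _ fun i _ hi => ?_)
      simp [hYdef, standardize, hZ, show Z i x.2 = 0 from hi]
    have h3 : ((Finset.univ.filter fun i : Fin x.1 => Y i x.2 ≤ (t - θ) / σ).card : ℝ)
        < m x.1 := by
      rw [inv_mul_eq_div, ← sub_div] at h1
      have := (div_pos_iff_of_pos_right hx').1 h1
      linarith
    exact hle.trans (by exact_mod_cast h3.le)
  · have hle : (Finset.univ.filter fun i : Fin x.1 => Z i x.2 = c * (T - t)).card
        + (Finset.univ.filter fun i : Fin x.1 => Y i x.2 ≤ s).card ≤ x.1 := by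
      rw [← Finset.card_union_of_disjoint]
      · exact (Finset.card_le_univ _).trans_eq (Fintype.card_fin _)
      · refine Finset.disjoint_filter.2 fun i _ hi => ?_
        have : Y i x.2 = (T - θ) / σ := by
          simp only [hYdef, standardize, hZ, hi]
          field_simp
          ring
        rw [this, not_le]
        exact hs2
    rw [inv_mul_eq_div, ← add_div, one_lt_div hx'] at h2
    have h3 : ((Finset.univ.filter fun i : Fin x.1 => Z i x.2 = c * (T - t)).card : ℝ)
        + ((Finset.univ.filter fun i : Fin x.1 => Y i x.2 ≤ s).card : ℝ) ≤ x.1 := by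
      exact_mod_cast hle
    have h4 : ((Finset.univ.filter fun i : Fin x.1 => Z i x.2 = c * (T - t)).card : ℝ)
        ≤ m' x.1 := by linarith
    exact_mod_cast h4

end mwmAsymptotics

/-! ### The likelihood in natural coordinates -/

/-- The sufficient statistic of one observation, as a function of the payment `w`, measured in units
of the maximal payment: the indicators of the two censoring events, and for an uncensored
payment the coefficients of `u²`, `2uv` and `v²` in `((1 - w) u + w v)²`. -/
def censorStat (w : ℝ) : EuclideanSpace ℝ (Fin 5) :=
  if w ≤ 0 then !₂[1, 0, 0, 0, 0] else if 1 ≤ w then !₂[0, 1, 0, 0, 0]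
  else !₂[0, 0, (1 - w) ^ 2, w * (1 - w), w ^ 2]

/-- The number of uncensored observations, in terms of the sufficient statistic. -/
def uncensored (s : EuclideanSpace ℝ (Fin 5)) : ℝ := s 2 + 2 * s 3 + s 4

/-- The log-likelihood, up to a constant, in the coordinates `u = (t - θ)/σ` and `v = (T - θ)/σ`.
It is linear in the sufficient statistic and concave in `(u, v)`. -/
def logLik (s : EuclideanSpace ℝ (Fin 5)) (u v : ℝ) : ℝ :=
  s 0 * Real.log (Phi u) + s 1 * Real.log (1 - Phi v) + uncensored s * Real.log (v - u)
    - (s 2 * u ^ 2 + 2 * s 3 * (u * v) + s 4 * v ^ 2) / 2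

/-- The derivative of the log-likelihood with respect to `u`. -/
def scoreU (s : EuclideanSpace ℝ (Fin 5)) (u v : ℝ) : ℝ :=
  s 0 * (phi u / Phi u) - uncensored s / (v - u) - (s 2 * u + s 3 * v)

/-- The derivative of the log-likelihood with respect to `v`. -/
def scoreV (s : EuclideanSpace ℝ (Fin 5)) (u v : ℝ) : ℝ :=
  -(s 1 * (phi v / (1 - Phi v))) + uncensored s / (v - u) - (s 3 * u + s 4 * v)

/-- The parameter `(θ, σ)` with `(t - θ)/σ = u` and `(t + R - θ)/σ = v`. -/
def paramOf (t R u v : ℝ) : Param := !₂[t - u * (R / (v - u)), R / (v - u)]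

lemma censorStat_nonneg (w : ℝ) : 0 ≤ censorStat w 0 ∧ 0 ≤ censorStat w 1 := by
  unfold censorStat
  split_ifs <;> simp

lemma censorStat_quadratic_nonneg (w x y : ℝ) :
    0 ≤ censorStat w 2 * x ^ 2 + 2 * censorStat w 3 * (x * y) + censorStat w 4 * y ^ 2 := by
  unfold censorStat
  split_ifs
  · simp
  · simp
  · have := sq_nonneg ((1 - w) * x + w * y)
    simp
    linarith

/-- A critical point of the log-likelihood is its unique maximizer. -/
lemma logLik_lt {s : EuclideanSpace ℝ (Fin 5)} (h0 : 0 ≤ s 0) (h1 : 0 ≤ s 1)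
    (hQ : ∀ x y : ℝ, 0 ≤ s 2 * x ^ 2 + 2 * s 3 * (x * y) + s 4 * y ^ 2) (hp : 0 < uncensored s)
    {u v u' v' : ℝ} (huv : u < v) (huv' : u' < v') (hU : scoreU s u v = 0) (hV : scoreV s u v = 0)
    (hne : ¬ (u' = u ∧ v' = v)) : logLik s u' v' < logLik s u v := by
  have e0 := mul_le_mul_of_nonneg_left (log_Phi_le u u') h0
  have e1 := mul_le_mul_of_nonneg_left (log_one_sub_Phi_le v v') h1
  have hd : 0 < v - u := sub_pos.2 huv
  have hd' : 0 < v' - u' := sub_pos.2 huv'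
  have hlog : Real.log (v' - u') = Real.log (v - u) + Real.log ((v' - u') / (v - u)) := by
    rw [Real.log_div hd'.ne' hd.ne']
    ring
  have hU' : s 0 * (phi u / Phi u) = uncensored s / (v - u) + (s 2 * u + s 3 * v) := by
    unfold scoreU at hU
    linarith
  have hV' : s 1 * (phi v / (1 - Phi v)) = uncensored s / (v - u) - (s 3 * u + s 4 * v) := by
    unfold scoreV at hV
    linarith
  have hr : (v' - u') / (v - u) - 1 = ((v' - v) - (u' - u)) / (v - u) := by
    field_simp
    ring
  -- the second-order remainder is strictly negative
  have key : uncensored s * (Real.log ((v' - u') / (v - u)) - ((v' - u') / (v - u) - 1))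
      < (s 2 * (u' - u) ^ 2 + 2 * s 3 * ((u' - u) * (v' - v)) + s 4 * (v' - v) ^ 2) / 2 := by
    have hq := hQ (u' - u) (v' - v)
    by_cases h : (v' - u') / (v - u) = 1
    · rw [h, Real.log_one]
      rw [div_eq_one_iff_eq hd.ne'] at h
      have hvv : v' - v = u' - u := by linarith
      have hx : u' - u ≠ 0 := fun hx => hne ⟨by linarith, by linarith⟩
      have := mul_pos hp (pow_pos (abs_pos.2 hx) 2)
      rw [sq_abs, uncensored] at this
      rw [hvv]
      linarith
    · have hl := Real.log_lt_sub_one_of_pos (div_pos hd' hd) h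
      have := mul_neg_of_pos_of_neg hp (sub_neg.2 hl)
      linarith
  have e2 : s 0 * (phi u / Phi u * (u' - u))
      = (uncensored s / (v - u) + (s 2 * u + s 3 * v)) * (u' - u) := by rw [← hU']; ring
  have e3 : s 1 * (phi v / (1 - Phi v) * (v' - v))
      = (uncensored s / (v - u) - (s 3 * u + s 4 * v)) * (v' - v) := by rw [← hV']; ring
  rw [hr] at key
  have e4 : uncensored s * (((v' - v) - (u' - u)) / (v - u))
      = uncensored s / (v - u) * (v' - v) - uncensored s / (v - u) * (u' - u) := by ring
  rw [mul_sub, e4] at key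
  rw [mul_add, e2] at e0
  rw [mul_sub, e3] at e1
  unfold logLik
  rw [hlog]
  linarith

lemma eq_paramOf {t T : ℝ} {η : Param} (hη : 0 < η 1) (htT : t < T) :
    η = paramOf t (T - t) ((t - η 0) / η 1) ((T - η 0) / η 1) := by
  have e : (T - t) / ((T - η 0) / η 1 - (t - η 0) / η 1) = η 1 := by
    have := sub_pos.2 htT
    rw [← sub_div, show T - η 0 - (t - η 0) = T - t by ring]
    field_simp
  rw [paramOf, e]
  ext i
  fin_cases i
  · simp
    field_simp
    ring
  · simp

lemma paramOf_coords {t T u v : ℝ} (htT : t < T) (huv : u < v) :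
    0 < paramOf t (T - t) u v 1 ∧
      (t - paramOf t (T - t) u v 0) / paramOf t (T - t) u v 1 = u ∧
      (T - paramOf t (T - t) u v 0) / paramOf t (T - t) u v 1 = v := by
  have h1 := sub_pos.2 htT
  have h2 := sub_pos.2 huv
  refine ⟨div_pos h1 h2, ?_, ?_⟩
  · simp [paramOf]
    field_simp
  · simp [paramOf]
    field_simp
    ring

open Classical in
/-- The factor of the density that does not involve the parameter. -/
def baseWeight (c R z : ℝ) : ℝ := if 0 < z ∧ z < c * R then (c * R * √(2 * Real.pi))⁻¹ else 1

lemma baseWeight_pos {c R : ℝ} (hc : 0 < c) (hR : 0 < R) (z : ℝ) : 0 < baseWeight c R z := by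
  unfold baseWeight
  split_ifs <;> positivity

lemma paymentPDF_eq {c t T z : ℝ} {η : Param} (hc : 0 < c) (htT : t < T) (hη : 0 < η 1)
    (hz0 : 0 ≤ z) (hz : z ≤ c * (T - t)) :
    paymentPDF c t T η z = baseWeight c (T - t) z
      * Real.exp (logLik (censorStat (z / (c * (T - t)))) ((t - η 0) / η 1) ((T - η 0) / η 1)) := by
  have hR := sub_pos.2 htT
  have hcR := mul_pos hc hR
  set u := (t - η 0) / η 1 with hu
  set v := (T - η 0) / η 1 with hv
  have hvu : v - u = (T - t) / η 1 := by rw [hu, hv]; ring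
  have hvu0 : 0 < v - u := hvu ▸ div_pos hR hη
  rcases hz0.eq_or_lt with h | h
  · subst h
    simp [paymentPDF, baseWeight, censorStat, logLik, uncensored, normalCDF, ← hu,
      Real.exp_log (Phi_pos u)]
  rcases hz.eq_or_lt with h' | h'
  · subst h'
    have : ¬ (c * (T - t) ≤ 0) := not_le.2 hcR
    simp [paymentPDF, baseWeight, censorStat, logLik, uncensored, normalCDF, ← hv, hcR.ne',
      Real.exp_log (sub_pos.2 (Phi_lt_one v)), not_le.2 (zero_lt_one (α := ℝ))]
  · have hw0 : ¬ (z / (c * (T - t)) ≤ 0) := not_le.2 (div_pos h hcR)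
    have hw1 : ¬ (1 ≤ z / (c * (T - t))) := not_le.2 ((div_lt_one hcR).2 h')
    set w := z / (c * (T - t)) with hw
    have hpt : (z / c + t - η 0) / η 1 = (1 - w) * u + w * v := by
      rw [hw, hu, hv]
      field_simp
      ring
    have hl : logLik (censorStat w) u v
        = Real.log (v - u) + -((1 - w) * u + w * v) ^ 2 / 2 := by
      rw [logLik, censorStat, if_neg hw0, if_neg hw1]
      simp [uncensored]
      ring
    rw [paymentPDF, if_neg h.ne', if_neg h'.ne, if_pos ⟨h, h'⟩, baseWeight, if_pos ⟨h, h'⟩,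
      normalPDF, hpt, phi_eq, hl, Real.exp_add, Real.exp_log hvu0, hvu]
    field_simp

lemma logLik_add (s s' : EuclideanSpace ℝ (Fin 5)) (u v : ℝ) :
    logLik (s + s') u v = logLik s u v + logLik s' u v := by
  simp only [logLik, uncensored, PiLp.add_apply]
  ring

lemma logLik_sum {κ : Type*} (I : Finset κ) (s : κ → EuclideanSpace ℝ (Fin 5)) (u v : ℝ) :
    logLik (∑ i ∈ I, s i) u v = ∑ i ∈ I, logLik (s i) u v := by
  classical
  induction I using Finset.induction_on with
  | empty => simp [logLik, uncensored]
  | insert i I hi ih => rw [Finset.sum_insert hi, Finset.sum_insert hi, logLik_add, ih]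

lemma likelihood_eq {c t T : ℝ} {η : Param} (hc : 0 < c) (htT : t < T) (hη : 0 < η 1) {n : ℕ}
    {z : Fin n → ℝ} (hz : ∀ i, 0 ≤ z i ∧ z i ≤ c * (T - t)) :
    likelihood c t T z η = (∏ i, baseWeight c (T - t) (z i))
      * Real.exp (logLik (∑ i, censorStat (z i / (c * (T - t))))
        ((t - η 0) / η 1) ((T - η 0) / η 1)) := by
  rw [likelihood, logLik_sum, Real.exp_sum, ← Finset.prod_mul_distrib]
  exact Finset.prod_congr rfl fun i _ => paymentPDF_eq hc htT hη (hz i).1 (hz i).2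

/-- If the likelihood equations have a solution, the likelihood has a unique maximizer, which is
that solution. -/
lemma isLikelihoodMax_iff {c t T u v : ℝ} (hc : 0 < c) (htT : t < T) {n : ℕ} {z : Fin n → ℝ}
    (hz : ∀ i, 0 ≤ z i ∧ z i ≤ c * (T - t)) {s : EuclideanSpace ℝ (Fin 5)}
    (hs : s = ∑ i, censorStat (z i / (c * (T - t)))) (hp : 0 < uncensored s) (huv : u < v)
    (hU : scoreU s u v = 0) (hV : scoreV s u v = 0) (η : Param) :
    IsLikelihoodMax c t T z η ↔ η = paramOf t (T - t) u v := by
  have hsi : ∀ k, s k = ∑ i, censorStat (z i / (c * (T - t))) k := fun k => by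
    rw [hs, WithLp.ofLp_sum, Finset.sum_apply]
  have h0 : 0 ≤ s 0 := by
    rw [hsi]
    exact Finset.sum_nonneg fun i _ => (censorStat_nonneg _).1
  have h1 : 0 ≤ s 1 := by
    rw [hsi]
    exact Finset.sum_nonneg fun i _ => (censorStat_nonneg _).2
  have hQ : ∀ x y : ℝ, 0 ≤ s 2 * x ^ 2 + 2 * s 3 * (x * y) + s 4 * y ^ 2 := fun x y => by
    rw [hsi, hsi, hsi, Finset.mul_sum, Finset.sum_mul, Finset.sum_mul, Finset.sum_mul,
      ← Finset.sum_add_distrib, ← Finset.sum_add_distrib]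
    exact Finset.sum_nonneg fun i _ => censorStat_quadratic_nonneg _ x y
  have hK : 0 < ∏ i, baseWeight c (T - t) (z i) :=
    Finset.prod_pos fun i _ => baseWeight_pos hc (sub_pos.2 htT) _
  obtain ⟨p1, pu, pv⟩ := paramOf_coords htT huv
  have hlt : ∀ η' : Param, 0 < η' 1 → η' ≠ paramOf t (T - t) u v →
      likelihood c t T z η' < likelihood c t T z (paramOf t (T - t) u v) := fun η' hη' hne => by
    rw [likelihood_eq hc htT hη' hz, likelihood_eq hc htT p1 hz, pu, pv, ← hs]
    refine mul_lt_mul_of_pos_left (Real.exp_lt_exp.2 ?_) hK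
    refine logLik_lt h0 h1 hQ hp huv ?_ hU hV fun h => hne ?_
    · exact div_lt_div_of_pos_right (sub_lt_sub_right htT _) hη'
    · rw [eq_paramOf hη' htT, h.1, h.2]
  constructor
  · intro h
    by_contra hne
    exact not_le.2 (hlt η h.1 hne) (h.2 _ p1)
  · rintro rfl
    refine ⟨p1, fun η' hη' => ?_⟩
    by_cases h : η' = paramOf t (T - t) u v
    · rw [h]
    · exact (hlt η' hη' h).le

/-! ### The solution of the likelihood equations -/

lemma hasStrictFDerivAt_toLp {X : Type*} [NormedAddCommGroup X] [NormedSpace ℝ X] {f g : X → ℝ}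
    {f' g' : X →L[ℝ] ℝ} {x : X} (hf : HasStrictFDerivAt f f' x) (hg : HasStrictFDerivAt g g' x) :
    ∃ L : X →L[ℝ] Param, HasStrictFDerivAt (fun y => (!₂[f y, g y] : Param)) L x ∧
      ∀ h, L h 0 = f' h ∧ L h 1 = g' h := by
  refine ⟨(EuclideanSpace.equiv (Fin 2) ℝ).symm.toContinuousLinearMap ∘L
    ContinuousLinearMap.pi ![f', g'], hasStrictFDerivAt_euclidean.2 fun i => ?_,
    fun h => ⟨rfl, rfl⟩⟩
  fin_cases i
  · exact hf
  · exact hg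

/-- The left-hand sides of the likelihood equations, as a function of the sufficient statistic and
of the coordinates `(u, v)`. -/
def scoreMap (x : EuclideanSpace ℝ (Fin 5) × Param) : Param :=
  !₂[scoreU x.1 (x.2 0) (x.2 1), scoreV x.1 (x.2 0) (x.2 1)]

/-- Minus the second derivative of the log-likelihood with respect to `u`. -/
def infoUU (s : EuclideanSpace ℝ (Fin 5)) (u v : ℝ) : ℝ :=
  s 0 * (u * phi u / Phi u + (phi u / Phi u) ^ 2) + uncensored s / (v - u) ^ 2 + s 2

/-- Minus the mixed second derivative of the log-likelihood. -/
def infoUV (s : EuclideanSpace ℝ (Fin 5)) (u v : ℝ) : ℝ := s 3 - uncensored s / (v - u) ^ 2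

/-- Minus the second derivative of the log-likelihood with respect to `v`. -/
def infoVV (s : EuclideanSpace ℝ (Fin 5)) (u v : ℝ) : ℝ :=
  s 1 * ((phi v / (1 - Phi v)) ^ 2 - v * phi v / (1 - Phi v)) + uncensored s / (v - u) ^ 2 + s 4

lemma hasStrictDerivAt_phi_div_Phi (x : ℝ) :
    HasStrictDerivAt (fun y => phi y / Phi y) (-(x * phi x / Phi x + (phi x / Phi x) ^ 2)) x := by
  refine hasStrictDerivAt_of_hasDerivAt_of_continuousAt
    (f' := fun x => -(x * phi x / Phi x + (phi x / Phi x) ^ 2))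
    (Eventually.of_forall hasDerivAt_phi_div_Phi) ?_
  have h1 := continuous_phi
  have h2 := continuous_Phi
  have h3 : ∀ x, Phi x ≠ 0 := fun x => (Phi_pos x).ne'
  exact (((continuous_id.mul h1).div h2 h3).add ((h1.div h2 h3).pow 2)).neg.continuousAt

lemma hasStrictDerivAt_phi_div_one_sub_Phi (x : ℝ) :
    HasStrictDerivAt (fun y => phi y / (1 - Phi y))
      ((phi x / (1 - Phi x)) ^ 2 - x * phi x / (1 - Phi x)) x := by
  have h := (hasStrictDerivAt_phi_div_Phi (-x)).comp x (hasStrictDerivAt_neg x)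
  rw [Phi_neg, phi_neg] at h
  refine (h.congr_deriv (by ring)).congr_of_eventuallyEq (Eventually.of_forall fun y => ?_)
  simp only [Function.comp_apply, Phi_neg, phi_neg]

lemma hasStrictFDerivAt_scoreMap (s : EuclideanSpace ℝ (Fin 5)) (β : Param) (hβ : β 0 < β 1) :
    ∃ f' : EuclideanSpace ℝ (Fin 5) × Param →L[ℝ] Param, HasStrictFDerivAt scoreMap f' (s, β) ∧
      ∀ h, f' h 0 = scoreU h.1 (β 0) (β 1)
          - (infoUU s (β 0) (β 1) * h.2 0 + infoUV s (β 0) (β 1) * h.2 1) ∧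
        f' h 1 = scoreV h.1 (β 0) (β 1)
          - (infoUV s (β 0) (β 1) * h.2 0 + infoVV s (β 0) (β 1) * h.2 1) := by
  have hd : β 1 - β 0 ≠ 0 := (sub_pos.2 hβ).ne'
  have hP0 : Phi (β 0) ≠ 0 := (Phi_pos _).ne'
  have hP1 : 1 - Phi (β 1) ≠ 0 := (sub_pos.2 (Phi_lt_one _)).ne'
  have hm : ∀ i, HasStrictFDerivAt (fun x : EuclideanSpace ℝ (Fin 5) × Param => x.1 i)
      ((EuclideanSpace.proj (𝕜 := ℝ) i) ∘L ContinuousLinearMap.fst ℝ _ _) (s, β) := fun i =>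
    (EuclideanSpace.proj (𝕜 := ℝ) i).hasStrictFDerivAt.comp (s, β) hasStrictFDerivAt_fst
  have hb : ∀ i, HasStrictFDerivAt (fun x : EuclideanSpace ℝ (Fin 5) × Param => x.2 i)
      ((EuclideanSpace.proj (𝕜 := ℝ) i) ∘L ContinuousLinearMap.snd ℝ _ _) (s, β) := fun i =>
    (EuclideanSpace.proj (𝕜 := ℝ) i).hasStrictFDerivAt.comp (s, β) hasStrictFDerivAt_snd
  have hl := (hasStrictDerivAt_phi_div_Phi (β 0)).comp_hasStrictFDerivAt_of_eq (s, β) (hb 0) rfl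
  have hr := (hasStrictDerivAt_phi_div_one_sub_Phi (β 1)).comp_hasStrictFDerivAt_of_eq
    (s, β) (hb 1) rfl
  have hi := (hasStrictDerivAt_inv hd).comp_hasStrictFDerivAt_of_eq (s, β) ((hb 1).sub (hb 0)) rfl
  have hp := ((hm 2).add ((hm 3).const_mul 2)).add (hm 4)
  have hU := (((hm 0).mul hl).sub (hp.mul hi)).sub (((hm 2).mul (hb 0)).add ((hm 3).mul (hb 1)))
  have hV := (((hm 1).mul hr).neg.add (hp.mul hi)).sub
    (((hm 3).mul (hb 0)).add ((hm 4).mul (hb 1)))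
  obtain ⟨f', hf, h⟩ := hasStrictFDerivAt_toLp hU hV
  refine ⟨f', hf.congr_of_eventuallyEq (Eventually.of_forall fun x => ?_), fun x => ?_⟩
  · simp only [scoreMap, scoreU, scoreV, uncensored, div_eq_mul_inv]
    rfl
  · rw [(h x).1, (h x).2]
    constructor
    · simp [scoreU, infoUU, infoUV, uncensored]
      field_simp
      ring
    · simp [scoreV, infoVV, infoUV, uncensored]
      field_simp
      ring

/-- Near a sufficient statistic for which the likelihood equations have a nondegenerate solution,
they have a solution that depends differentiably on the sufficient statistic. -/
lemma exists_likelihood_solution {s : EuclideanSpace ℝ (Fin 5)} {β : Param} (hβ : β 0 < β 1)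
    (hU : scoreU s (β 0) (β 1) = 0) (hV : scoreV s (β 0) (β 1) = 0)
    (hdet : infoUU s (β 0) (β 1) * infoVV s (β 0) (β 1) - infoUV s (β 0) (β 1) ^ 2 ≠ 0) :
    ∃ (G : EuclideanSpace ℝ (Fin 5) → Param) (G' : EuclideanSpace ℝ (Fin 5) →L[ℝ] Param),
      HasStrictFDerivAt G G' s ∧ G s = β ∧
      (∀ᶠ m in 𝓝 s, scoreU m (G m 0) (G m 1) = 0 ∧ scoreV m (G m 0) (G m 1) = 0) ∧
      ∀ m, infoUU s (β 0) (β 1) * G' m 0 + infoUV s (β 0) (β 1) * G' m 1 = scoreU m (β 0) (β 1) ∧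
        infoUV s (β 0) (β 1) * G' m 0 + infoVV s (β 0) (β 1) * G' m 1
          = scoreV m (β 0) (β 1) := by
  obtain ⟨f', hf, hf'⟩ := hasStrictFDerivAt_scoreMap s β hβ
  set A := infoUU s (β 0) (β 1)
  set B := infoUV s (β 0) (β 1)
  set C := infoVV s (β 0) (β 1)
  have hinj : Function.Injective (f' ∘L ContinuousLinearMap.inr ℝ _ _ : Param →L[ℝ] Param) := by
    refine (injective_iff_map_eq_zero _).2 fun b hb => ?_
    have e := hf' (0, b)
    have hb' : f' (0, b) = 0 := hb
    rw [hb'] at e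
    simp [scoreU, scoreV, uncensored] at e
    have e0 : (A * C - B ^ 2) * b 0 = 0 := by linear_combination C * e.1 - B * e.2
    have e1 : (A * C - B ^ 2) * b 1 = 0 := by linear_combination A * e.2 - B * e.1
    ext i
    fin_cases i
    · exact (mul_eq_zero.1 e0).resolve_left hdet
    · exact (mul_eq_zero.1 e1).resolve_left hdet
  have hinv : (f' ∘L ContinuousLinearMap.inr ℝ _ _ : Param →L[ℝ] Param).IsInvertible :=
    ⟨(LinearEquiv.ofInjectiveEndo _ hinj).toContinuousLinearEquiv, by ext b; rfl⟩
  have hG := hf.hasStrictFDerivAt_implicitFunctionOfProdDomain hinv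
  have hz : scoreMap (s, β) = 0 := by
    ext i
    fin_cases i
    · exact hU
    · exact hV
  refine ⟨_, _, hG, ?_, ?_, fun m => ?_⟩
  · exact (hf.eventually_apply_eq_iff_implicitFunctionOfProdDomain hinv).self_of_nhds.1 rfl
  · filter_upwards [hf.eventually_apply_implicitFunctionOfProdDomain hinv] with m hm
    rw [hz] at hm
    exact ⟨congrArg (fun b : Param => b 0) hm, congrArg (fun b : Param => b 1) hm⟩
  · set x := (-(f' ∘L ContinuousLinearMap.inr ℝ _ _ : Param →L[ℝ] Param).inverse
      ∘L (f' ∘L ContinuousLinearMap.inl ℝ _ _)) m with hx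
    have e : f' (m, x) = 0 := by
      have e1 : f' (m, x) = f' (m, 0) + f' (0, x) := by
        rw [← map_add]
        simp
      have e2 : f' (0, x) = -f' (m, 0) := by
        set L : Param →L[ℝ] Param := f' ∘L ContinuousLinearMap.inr ℝ _ _
        have h2 : L (-L.inverse (f' (m, 0))) = -f' (m, 0) := by
          rw [map_neg, hinv.self_apply_inverse]
        exact h2
      rw [e1, e2, add_neg_cancel]
    have e' := hf' (m, x)
    rw [e] at e'
    simp only [PiLp.zero_apply] at e'
    exact ⟨by linarith [e'.1], by linarith [e'.2]⟩

/-- The derivative of the maximum likelihood estimate as a function of the sufficient statistic. -/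
lemma exists_paramOf_solution {t R : ℝ} {s : EuclideanSpace ℝ (Fin 5)} {β : Param} (hβ : β 0 < β 1)
    {G : EuclideanSpace ℝ (Fin 5) → Param} {G' : EuclideanSpace ℝ (Fin 5) →L[ℝ] Param}
    (hG : HasStrictFDerivAt G G' s) (hGs : G s = β) :
    ∃ K' : EuclideanSpace ℝ (Fin 5) →L[ℝ] Param,
      HasFDerivAt (fun m => paramOf t R (G m 0) (G m 1)) K' s ∧
      ∀ m, K' m 1 = -(R / (β 1 - β 0) ^ 2) * (G' m 1 - G' m 0) ∧
        K' m 0 = -(R / (β 1 - β 0) * G' m 0) - β 0 * K' m 1 := by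
  have hd : β 1 - β 0 ≠ 0 := (sub_pos.2 hβ).ne'
  have hg := hasStrictFDerivAt_euclidean.1 hG
  have hi := (hasStrictDerivAt_inv hd).comp_hasStrictFDerivAt_of_eq s ((hg 1).sub (hg 0))
    (by rw [← hGs]; rfl)
  have h1 := hi.const_mul R
  have h0 := ((hg 0).mul h1).const_sub t
  obtain ⟨K', hK, h⟩ := hasStrictFDerivAt_toLp h0 h1
  refine ⟨K', (hK.congr_of_eventuallyEq (Eventually.of_forall fun x => ?_)).hasFDerivAt,
    fun x => ?_⟩
  · simp only [paramOf, div_eq_mul_inv]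
    rfl
  · rw [(h x).1, (h x).2]
    constructor
    · simp
      field_simp
    · simp [hGs]
      field_simp
      exact Or.inl trivial

/-! ### Truncated normal moments and the Fisher information -/

/-- Integration by parts for truncated normal moments. -/
lemma truncMoment_succ (p r : ℝ) (k : ℕ) :
    truncMoment p r (k + 1)
      = k * truncMoment p r (k - 1) + p ^ k * phi p - r ^ k * phi r := by
  have hd : ∀ y ∈ Set.uIcc p r, HasDerivAt (fun y => -(y ^ k * phi y))
      (y ^ (k + 1) * phi y - k * (y ^ (k - 1) * phi y)) y := fun y _ => by
    refine ((hasDerivAt_pow k y).mul (hasDerivAt_phi y)).neg.congr_deriv ?_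
    ring
  have hi : ∀ k, IntervalIntegrable (fun y => y ^ k * phi y) volume p r := fun k =>
    ((continuous_pow k).mul continuous_phi).intervalIntegrable _ _
  have h := intervalIntegral.integral_eq_sub_of_hasDerivAt hd ((hi _).sub ((hi _).const_mul _))
  rw [intervalIntegral.integral_sub (hi _) ((hi _).const_mul _),
    intervalIntegral.integral_const_mul] at h
  unfold truncMoment
  linarith

lemma truncMoment_one (p r : ℝ) : truncMoment p r 1 = phi p - phi r := by
  simpa using truncMoment_succ p r 0

lemma truncMoment_two (p r : ℝ) :
    truncMoment p r 2 = truncMoment p r 0 + p * phi p - r * phi r := by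
  simpa using truncMoment_succ p r 1

lemma truncMoment_three (p r : ℝ) :
    truncMoment p r 3 = 2 * truncMoment p r 1 + p ^ 2 * phi p - r ^ 2 * phi r := by
  simpa using truncMoment_succ p r 2

lemma truncMoment_four (p r : ℝ) :
    truncMoment p r 4 = 3 * truncMoment p r 2 + p ^ 3 * phi p - r ^ 3 * phi r := by
  simpa using truncMoment_succ p r 3

/-- The sufficient statistic of a standardized observation. -/
def obsStat (γ ξ y : ℝ) : EuclideanSpace ℝ (Fin 5) := censorStat ((y - γ) / (ξ - γ))

/-- The expectation of the sufficient statistic. -/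
def meanStat (γ ξ : ℝ) : EuclideanSpace ℝ (Fin 5) :=
  !₂[Phi γ, 1 - Phi ξ,
    (ξ ^ 2 * truncMoment γ ξ 0 - 2 * ξ * truncMoment γ ξ 1 + truncMoment γ ξ 2) / (ξ - γ) ^ 2,
    (-(γ * ξ) * truncMoment γ ξ 0 + (γ + ξ) * truncMoment γ ξ 1 - truncMoment γ ξ 2)
      / (ξ - γ) ^ 2,
    (γ ^ 2 * truncMoment γ ξ 0 - 2 * γ * truncMoment γ ξ 1 + truncMoment γ ξ 2) / (ξ - γ) ^ 2]

section stat

variable {γ ξ : ℝ}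

lemma obsStat_left (h : γ < ξ) {y : ℝ} (hy : y ≤ γ) : obsStat γ ξ y = !₂[1, 0, 0, 0, 0] := by
  rw [obsStat, censorStat, if_pos (div_nonpos_of_nonpos_of_nonneg (by linarith) (by linarith))]

lemma obsStat_right (h : γ < ξ) {y : ℝ} (hy : ξ ≤ y) : obsStat γ ξ y = !₂[0, 1, 0, 0, 0] := by
  rw [obsStat, censorStat, if_neg (not_le.2 (div_pos (by linarith) (by linarith))),
    if_pos ((one_le_div (by linarith)).2 (by linarith))]

lemma obsStat_mid {y : ℝ} (hy : γ < y) (hy' : y < ξ) :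
    obsStat γ ξ y = !₂[0, 0, (ξ - y) ^ 2 / (ξ - γ) ^ 2, (y - γ) * (ξ - y) / (ξ - γ) ^ 2,
      (y - γ) ^ 2 / (ξ - γ) ^ 2] := by
  have hd : ξ - γ ≠ 0 := by linarith
  have e : 1 - (y - γ) / (ξ - γ) = (ξ - y) / (ξ - γ) := by
    field_simp
    ring
  rw [obsStat, censorStat, if_neg (not_le.2 (div_pos (by linarith) (by linarith))),
    if_neg (not_le.2 ((div_lt_one (by linarith)).2 (by linarith))), e, div_pow, div_pow,
    div_mul_div_comm, sq (ξ - γ)]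

lemma measurable_censorStat : Measurable censorStat := by
  unfold censorStat
  refine Measurable.ite measurableSet_Iic measurable_const
    (Measurable.ite measurableSet_Ici measurable_const ?_)
  refine (PiLp.continuous_toLp 2 fun _ : Fin 5 => ℝ).measurable.comp
    (measurable_pi_iff.2 fun i => ?_)
  fin_cases i <;> simp <;> fun_prop

lemma measurable_obsStat (γ ξ : ℝ) : Measurable (obsStat γ ξ) :=
  measurable_censorStat.comp (by fun_prop)

lemma norm_censorStat_le (w : ℝ) : ‖censorStat w‖ ≤ √5 := by
  rw [EuclideanSpace.norm_eq]
  refine Real.sqrt_le_sqrt ?_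
  have h : ∀ i, ‖censorStat w i‖ ^ 2 ≤ 1 := fun i => by
    rw [sq_le_one_iff₀ (norm_nonneg _), Real.norm_eq_abs, abs_le]
    unfold censorStat
    split_ifs with h1 h2
    · fin_cases i <;> simp
    · fin_cases i <;> simp
    · have h3 : 0 < w := not_le.1 h1
      have h4 : 0 < 1 - w := sub_pos.2 (not_le.1 h2)
      fin_cases i <;> simp [abs_of_pos h3, abs_of_pos h4] <;> (constructor <;> nlinarith)
  exact (Finset.sum_le_sum fun i _ => h i).trans (by simp)

lemma bounded_obsStat (γ ξ : ℝ) : ∃ C, ∀ y, ‖obsStat γ ξ y‖ ≤ C :=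
  ⟨√5, fun _ => norm_censorStat_le _⟩

lemma measurable_obsStat_apply (γ ξ : ℝ) (i : Fin 5) : Measurable fun y => obsStat γ ξ y i :=
  (EuclideanSpace.proj (𝕜 := ℝ) i).continuous.measurable.comp (measurable_obsStat γ ξ)

lemma integral_obsStat (h : γ < ξ) (i : Fin 5) :
    ∫ y, obsStat γ ξ y i ∂(clampLaw γ ξ) = meanStat γ ξ i := by
  have hd : ξ - γ ≠ 0 := by linarith
  have key : ∀ (L R e0 e1 e2 : ℝ), obsStat γ ξ γ i = L → obsStat γ ξ ξ i = R →
      (∀ y, γ < y → y < ξ → obsStat γ ξ y i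
        = e0 + e1 * y + e2 * y ^ 2 + 0 * y ^ 3 + 0 * y ^ 4) →
      ∫ y, obsStat γ ξ y i ∂(clampLaw γ ξ) = Phi γ * L + (e0 * truncMoment γ ξ 0
        + e1 * truncMoment γ ξ 1 + e2 * truncMoment γ ξ 2) + (1 - Phi ξ) * R := by
    intro L R e0 e1 e2 hL hR hm
    have hc : Continuous fun y : ℝ =>
        e0 + e1 * y + e2 * y ^ 2 + 0 * y ^ 3 + 0 * y ^ 4 := by fun_prop
    rw [integral_clampLaw_tails (measurable_obsStat_apply γ ξ i) hc le_rfl h le_rfl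
      (fun y _ hy => by rw [obsStat_left h hy, ← obsStat_left h le_rfl, hL]) hm
      (fun y hy hy' => absurd hy' (not_le.2 hy)) (fun _ => hR), integral_mul_phi_quartic]
    ring
  have hl := obsStat_left h le_rfl
  have hr := obsStat_right h le_rfl
  fin_cases i
  · refine (key 1 0 0 0 0 (by simp [hl]) (by simp [hr]) fun y h1 h2 => ?_).trans ?_
    · simp [obsStat_mid h1 h2]
    · simp [meanStat]
  · refine (key 0 1 0 0 0 (by simp [hl]) (by simp [hr]) fun y h1 h2 => ?_).trans ?_
    · simp [obsStat_mid h1 h2]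
    · simp [meanStat]
  · refine (key 0 0 (ξ ^ 2 / (ξ - γ) ^ 2) (-(2 * ξ) / (ξ - γ) ^ 2) (1 / (ξ - γ) ^ 2)
      (by simp [hl]) (by simp [hr]) fun y h1 h2 => ?_).trans ?_
    · simp [obsStat_mid h1 h2]
      field_simp
      ring
    · simp [meanStat]
      field_simp
      ring
  · refine (key 0 0 (-(γ * ξ) / (ξ - γ) ^ 2) ((γ + ξ) / (ξ - γ) ^ 2) (-1 / (ξ - γ) ^ 2)
      (by simp [hl]) (by simp [hr]) fun y h1 h2 => ?_).trans ?_
    · simp [obsStat_mid h1 h2]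
      field_simp
      ring
    · simp [meanStat]
      field_simp
      ring
  · refine (key 0 0 (γ ^ 2 / (ξ - γ) ^ 2) (-(2 * γ) / (ξ - γ) ^ 2) (1 / (ξ - γ) ^ 2)
      (by simp [hl]) (by simp [hr]) fun y h1 h2 => ?_).trans ?_
    · simp [obsStat_mid h1 h2]
      field_simp
      ring
    · simp [meanStat]
      field_simp
      ring

lemma uncensored_meanStat (h : γ < ξ) : uncensored (meanStat γ ξ) = Phi ξ - Phi γ := by
  have hd : ξ - γ ≠ 0 := by linarith
  rw [← truncMoment_zero]
  simp [uncensored, meanStat]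
  field_simp
  ring

/-- The true parameter solves the expected likelihood equations. -/
lemma score_meanStat (h : γ < ξ) :
    scoreU (meanStat γ ξ) γ ξ = 0 ∧ scoreV (meanStat γ ξ) γ ξ = 0 := by
  have hd : ξ - γ ≠ 0 := by linarith
  have hP0 : Phi γ ≠ 0 := (Phi_pos _).ne'
  have hP1 : 1 - Phi ξ ≠ 0 := (sub_pos.2 (Phi_lt_one _)).ne'
  rw [scoreU, scoreV, uncensored_meanStat h, ← truncMoment_zero]
  simp only [meanStat, truncMoment_two, truncMoment_one]
  constructor
  · simp
    field_simp
    ring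
  · simp
    field_simp
    ring

lemma scoreU_obsStat_mid {y : ℝ} (hy : γ < y) (hy' : y < ξ) :
    scoreU (obsStat γ ξ y) γ ξ = -(1 + ξ * y - y ^ 2) / (ξ - γ) := by
  have hd : ξ - γ ≠ 0 := by linarith
  simp [scoreU, uncensored, obsStat_mid hy hy']
  field_simp
  ring

lemma scoreV_obsStat_mid {y : ℝ} (hy : γ < y) (hy' : y < ξ) :
    scoreV (obsStat γ ξ y) γ ξ = (1 + γ * y - y ^ 2) / (ξ - γ) := by
  have hd : ξ - γ ≠ 0 := by linarith
  simp [scoreV, uncensored, obsStat_mid hy hy']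
  field_simp
  ring

lemma scoreU_obsStat_left (h : γ < ξ) {y : ℝ} (hy : y ≤ γ) :
    scoreU (obsStat γ ξ y) γ ξ = phi γ / Phi γ := by
  simp [scoreU, uncensored, obsStat_left h hy]

lemma scoreV_obsStat_left (h : γ < ξ) {y : ℝ} (hy : y ≤ γ) : scoreV (obsStat γ ξ y) γ ξ = 0 := by
  simp [scoreV, uncensored, obsStat_left h hy]

lemma scoreU_obsStat_right (h : γ < ξ) {y : ℝ} (hy : ξ ≤ y) : scoreU (obsStat γ ξ y) γ ξ = 0 := by
  simp [scoreU, uncensored, obsStat_right h hy]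

lemma scoreV_obsStat_right (h : γ < ξ) {y : ℝ} (hy : ξ ≤ y) :
    scoreV (obsStat γ ξ y) γ ξ = -(phi ξ / (1 - Phi ξ)) := by
  simp [scoreV, uncensored, obsStat_right h hy]

lemma measurable_scoreU_obsStat (γ ξ : ℝ) : Measurable fun y => scoreU (obsStat γ ξ y) γ ξ := by
  have h := measurable_obsStat_apply γ ξ
  unfold scoreU uncensored
  exact (((h 0).mul_const _).sub ((((h 2).add ((h 3).const_mul 2)).add (h 4)).div_const _)).sub
    (((h 2).mul_const _).add ((h 3).mul_const _))

lemma measurable_scoreV_obsStat (γ ξ : ℝ) : Measurable fun y => scoreV (obsStat γ ξ y) γ ξ := by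
  have h := measurable_obsStat_apply γ ξ
  unfold scoreV uncensored
  exact (((h 1).mul_const _).neg.add ((((h 2).add ((h 3).const_mul 2)).add (h 4)).div_const _)).sub
    (((h 3).mul_const _).add ((h 4).mul_const _))

lemma bounded_scores (h : γ < ξ) : (∃ C, ∀ y, ‖scoreU (obsStat γ ξ y) γ ξ‖ ≤ C) ∧
    ∃ C, ∀ y, ‖scoreV (obsStat γ ξ y) γ ξ‖ ≤ C := by
  -- both scores are constant on the tails and continuous in between
  have key : ∀ (f g : ℝ → ℝ) (L R : ℝ), Continuous g → (∀ y, y ≤ γ → f y = L) →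
      (∀ y, ξ ≤ y → f y = R) → (∀ y, γ < y → y < ξ → f y = g y) → ∃ C, ∀ y, ‖f y‖ ≤ C := by
    intro f g L R hg hL hR hm
    obtain ⟨K, hK⟩ := (isCompact_Icc (a := γ) (b := ξ)).exists_bound_of_continuousOn
      hg.continuousOn
    refine ⟨max K (max ‖L‖ ‖R‖), fun y => ?_⟩
    rcases le_or_gt y γ with h1 | h1
    · rw [hL y h1]
      exact (le_max_left _ _).trans (le_max_right _ _)
    rcases le_or_gt ξ y with h2 | h2
    · rw [hR y h2]
      exact (le_max_right _ _).trans (le_max_right _ _)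
    · rw [hm y h1 h2]
      exact (hK y ⟨h1.le, h2.le⟩).trans (le_max_left _ _)
  exact ⟨key _ (fun y => -(1 + ξ * y - y ^ 2) / (ξ - γ)) _ _ (by fun_prop)
      (fun y hy => scoreU_obsStat_left h hy) (fun y hy => scoreU_obsStat_right h hy)
      (fun y h1 h2 => scoreU_obsStat_mid h1 h2),
    key _ (fun y => (1 + γ * y - y ^ 2) / (ξ - γ)) _ _ (by fun_prop)
      (fun y hy => scoreV_obsStat_left h hy) (fun y hy => scoreV_obsStat_right h hy)
      (fun y h1 h2 => scoreV_obsStat_mid h1 h2)⟩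

/-- The information equality: the covariance matrix of the score is the expectation of minus the
second derivative of the log-likelihood. -/
lemma info_eq_integral (h : γ < ξ) :
    ∫ y, scoreU (obsStat γ ξ y) γ ξ * scoreU (obsStat γ ξ y) γ ξ ∂(clampLaw γ ξ)
        = infoUU (meanStat γ ξ) γ ξ ∧
      ∫ y, scoreU (obsStat γ ξ y) γ ξ * scoreV (obsStat γ ξ y) γ ξ ∂(clampLaw γ ξ)
        = infoUV (meanStat γ ξ) γ ξ ∧
      ∫ y, scoreV (obsStat γ ξ y) γ ξ * scoreV (obsStat γ ξ y) γ ξ ∂(clampLaw γ ξ)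
        = infoVV (meanStat γ ξ) γ ξ := by
  have hd : ξ - γ ≠ 0 := by linarith
  have hP0 : Phi γ ≠ 0 := (Phi_pos _).ne'
  have hP1 : 1 - Phi ξ ≠ 0 := (sub_pos.2 (Phi_lt_one _)).ne'
  have mU := measurable_scoreU_obsStat γ ξ
  have mV := measurable_scoreV_obsStat γ ξ
  have key : ∀ (f : ℝ → ℝ) (L R e0 e1 e2 e3 e4 : ℝ), Measurable f → (∀ y, y ≤ γ → f y = L) →
      f ξ = R → (∀ y, γ < y → y < ξ → f y = e0 + e1 * y + e2 * y ^ 2 + e3 * y ^ 3 + e4 * y ^ 4) →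
      ∫ y, f y ∂(clampLaw γ ξ) = Phi γ * L + (e0 * truncMoment γ ξ 0 + e1 * truncMoment γ ξ 1
        + e2 * truncMoment γ ξ 2 + e3 * truncMoment γ ξ 3 + e4 * truncMoment γ ξ 4)
        + (1 - Phi ξ) * R := by
    intro f L R e0 e1 e2 e3 e4 hf hL hR hm
    have hc : Continuous fun y : ℝ =>
        e0 + e1 * y + e2 * y ^ 2 + e3 * y ^ 3 + e4 * y ^ 4 := by
      fun_prop
    rw [integral_clampLaw_tails hf hc le_rfl h le_rfl (fun y _ hy => hL y hy) hm
      (fun y hy hy' => absurd hy' (not_le.2 hy)) (fun _ => hR), integral_mul_phi_quartic]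
  refine ⟨?_, ?_, ?_⟩
  · rw [key (fun y => scoreU (obsStat γ ξ y) γ ξ * scoreU (obsStat γ ξ y) γ ξ)
      ((phi γ / Phi γ) * (phi γ / Phi γ)) 0 (1 / (ξ - γ) ^ 2) (2 * ξ / (ξ - γ) ^ 2)
      ((ξ ^ 2 - 2) / (ξ - γ) ^ 2) (-(2 * ξ) / (ξ - γ) ^ 2) (1 / (ξ - γ) ^ 2) (mU.mul mU)
      (fun y hy => by rw [scoreU_obsStat_left h hy])
      (by rw [scoreU_obsStat_right h le_rfl, mul_zero])
      (fun y h1 h2 => by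
        rw [scoreU_obsStat_mid h1 h2]
        field_simp
        ring), infoUU, uncensored_meanStat h, ← truncMoment_zero]
    simp only [meanStat, truncMoment_four, truncMoment_three, truncMoment_two, truncMoment_one]
    simp
    field_simp
    ring
  · rw [key (fun y => scoreU (obsStat γ ξ y) γ ξ * scoreV (obsStat γ ξ y) γ ξ) 0 0
      (-1 / (ξ - γ) ^ 2) (-(γ + ξ) / (ξ - γ) ^ 2)
      ((2 - γ * ξ) / (ξ - γ) ^ 2) ((γ + ξ) / (ξ - γ) ^ 2) (-1 / (ξ - γ) ^ 2) (mU.mul mV)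
      (fun y hy => by rw [scoreV_obsStat_left h hy, mul_zero])
      (by rw [scoreU_obsStat_right h le_rfl, zero_mul])
      (fun y h1 h2 => by
        rw [scoreU_obsStat_mid h1 h2, scoreV_obsStat_mid h1 h2]
        field_simp
        ring), infoUV, uncensored_meanStat h, ← truncMoment_zero]
    simp only [meanStat, truncMoment_four, truncMoment_three, truncMoment_two, truncMoment_one]
    simp
    field_simp
    ring
  · rw [key (fun y => scoreV (obsStat γ ξ y) γ ξ * scoreV (obsStat γ ξ y) γ ξ) 0
      ((phi ξ / (1 - Phi ξ)) * (phi ξ / (1 - Phi ξ))) (1 / (ξ - γ) ^ 2)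
      (2 * γ / (ξ - γ) ^ 2) ((γ ^ 2 - 2) / (ξ - γ) ^ 2) (-(2 * γ) / (ξ - γ) ^ 2)
      (1 / (ξ - γ) ^ 2) (mV.mul mV)
      (fun y hy => by rw [scoreV_obsStat_left h hy, mul_zero])
      (by rw [scoreV_obsStat_right h le_rfl, neg_mul_neg])
      (fun y h1 h2 => by
        rw [scoreV_obsStat_mid h1 h2]
        field_simp
        ring), infoVV, uncensored_meanStat h, ← truncMoment_zero]
    simp only [meanStat, truncMoment_four, truncMoment_three, truncMoment_two, truncMoment_one]
    simp
    field_simp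
    ring

/-- The information matrix is positive definite: its quadratic form contains the integral of the
square of a nonzero affine function against the normal density. -/
lemma info_det_pos (h : γ < ξ) : 0 < infoUU (meanStat γ ξ) γ ξ * infoVV (meanStat γ ξ) γ ξ
    - infoUV (meanStat γ ξ) γ ξ ^ 2 := by
  have hd : 0 < ξ - γ := sub_pos.2 h
  have hJ : 0 < truncMoment γ ξ 0 := by
    rw [truncMoment_zero]
    exact sub_pos.2 (strictMono_Phi h)
  have hQ : ∀ a b : ℝ, (a ≠ 0 ∨ b ≠ 0) → 0 < infoUU (meanStat γ ξ) γ ξ * a ^ 2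
      + 2 * infoUV (meanStat γ ξ) γ ξ * (a * b) + infoVV (meanStat γ ξ) γ ξ * b ^ 2 := by
    intro a b hab
    have h0 : 0 ≤ Phi γ * (γ * phi γ / Phi γ + (phi γ / Phi γ) ^ 2) * a ^ 2 :=
      mul_nonneg (mul_nonneg (Phi_pos γ).le (deriv_phi_div_Phi_nonneg γ)) (sq_nonneg _)
    have h1 : 0 ≤ (1 - Phi ξ) * ((phi ξ / (1 - Phi ξ)) ^ 2 - ξ * phi ξ / (1 - Phi ξ)) * b ^ 2 := by
      have := deriv_phi_div_Phi_nonneg (-ξ)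
      rw [Phi_neg, phi_neg, neg_mul, neg_div, neg_add_eq_sub] at this
      exact mul_nonneg (mul_nonneg (sub_pos.2 (Phi_lt_one ξ)).le this) (sq_nonneg _)
    have hexp : ∫ y in γ..ξ, ((ξ * a - γ * b) + (b - a) * y + 0 * y ^ 2) ^ 2 * phi y
        = (ξ * a - γ * b) ^ 2 * truncMoment γ ξ 0
          + 2 * (ξ * a - γ * b) * (b - a) * truncMoment γ ξ 1
          + (b - a) ^ 2 * truncMoment γ ξ 2 := by
      have := integral_mul_phi_quartic γ ξ ((ξ * a - γ * b) ^ 2) (2 * (ξ * a - γ * b) * (b - a))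
        ((b - a) ^ 2) 0 0
      rw [zero_mul, zero_mul, add_zero, add_zero] at this
      rw [← this]
      refine intervalIntegral.integral_congr fun y _ => ?_
      ring
    have h2 : 0 < truncMoment γ ξ 0 * (a - b) ^ 2
        + ((ξ * a - γ * b) ^ 2 * truncMoment γ ξ 0
          + 2 * (ξ * a - γ * b) * (b - a) * truncMoment γ ξ 1
          + (b - a) ^ 2 * truncMoment γ ξ 2) := by
      by_cases hne : b - a = 0
      · have hb : b = a := by linarith
        subst hb
        have ha : b ≠ 0 := by tauto
        have : 0 < (ξ - γ) ^ 2 * b ^ 2 * truncMoment γ ξ 0 := by positivity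
        linarith
      · rw [← hexp]
        have := integral_sq_quadratic_pos h (x1 := b - a) (x2 := 0) (Or.inl hne) (ξ * a - γ * b)
        have := mul_nonneg hJ.le (sq_nonneg (a - b))
        linarith
    have h3 := div_pos h2 (pow_pos hd 2)
    have e : infoUU (meanStat γ ξ) γ ξ * a ^ 2 + 2 * infoUV (meanStat γ ξ) γ ξ * (a * b)
          + infoVV (meanStat γ ξ) γ ξ * b ^ 2
        = Phi γ * (γ * phi γ / Phi γ + (phi γ / Phi γ) ^ 2) * a ^ 2
          + (1 - Phi ξ) * ((phi ξ / (1 - Phi ξ)) ^ 2 - ξ * phi ξ / (1 - Phi ξ)) * b ^ 2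
          + (truncMoment γ ξ 0 * (a - b) ^ 2
            + ((ξ * a - γ * b) ^ 2 * truncMoment γ ξ 0
              + 2 * (ξ * a - γ * b) * (b - a) * truncMoment γ ξ 1
              + (b - a) ^ 2 * truncMoment γ ξ 2)) / (ξ - γ) ^ 2 := by
      rw [infoUU, infoUV, infoVV, uncensored_meanStat h, ← truncMoment_zero]
      simp [meanStat]
      ring
    rw [e]
    linarith
  have hA := hQ 1 0 (by simp)
  have hA' : 0 < infoUU (meanStat γ ξ) γ ξ := by linarith
  have hD := hQ (-infoUV (meanStat γ ξ) γ ξ) (infoUU (meanStat γ ξ) γ ξ) (Or.inr hA'.ne')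
  refine (mul_pos_iff_of_pos_left hA').1 (hD.trans_eq ?_)
  ring

end stat

/-! ### The matrix `S_{z,MLE}` -/

section matrix

variable {t T θ σ γ ξ : ℝ}

/-- The Fisher information in the coordinates `(u, v)`. -/
lemma info_explicit (h : γ < ξ) :
    infoUU (meanStat γ ξ) γ ξ = γ * phi γ + phi γ ^ 2 / Phi γ
        + ((2 + ξ ^ 2) * (Phi ξ - Phi γ) - 2 * ξ * (phi γ - phi ξ) + γ * phi γ - ξ * phi ξ)
          / (ξ - γ) ^ 2 ∧
      infoUV (meanStat γ ξ) γ ξ = (-(2 + γ * ξ) * (Phi ξ - Phi γ) + (γ + ξ) * (phi γ - phi ξ)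
          - γ * phi γ + ξ * phi ξ) / (ξ - γ) ^ 2 ∧
      infoVV (meanStat γ ξ) γ ξ = phi ξ ^ 2 / (1 - Phi ξ) - ξ * phi ξ
        + ((2 + γ ^ 2) * (Phi ξ - Phi γ) - 2 * γ * (phi γ - phi ξ) + γ * phi γ - ξ * phi ξ)
          / (ξ - γ) ^ 2 := by
  have hd : ξ - γ ≠ 0 := by linarith
  have hP0 : Phi γ ≠ 0 := (Phi_pos _).ne'
  have hP1 : 1 - Phi ξ ≠ 0 := (sub_pos.2 (Phi_lt_one _)).ne'
  simp only [infoUU, infoUV, infoVV, uncensored_meanStat h]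
  simp only [meanStat, truncMoment_two, truncMoment_one, truncMoment_zero]
  refine ⟨?_, ?_, ?_⟩ <;> simp <;> field_simp <;> ring

/-- `S_{z,MLE}` is the inverse of the Fisher information in the coordinates `(u, v)`, transformed
to the coordinates `(θ, σ)`. -/
lemma SMLE_eq (hσ : 0 < σ) (htT : t < T) (hγ : (t - θ) / σ = γ) (hξ : (T - θ) / σ = ξ)
    {A B C : ℝ} (hA : A = infoUU (meanStat γ ξ) γ ξ) (hB : B = infoUV (meanStat γ ξ) γ ξ)
    (hC : C = infoVV (meanStat γ ξ) γ ξ) :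
    SMLE t T !₂[θ, σ] = (1 / ((ξ - γ) ^ 2 * (A * C - B ^ 2))) •
      (!![-σ, -γ; 0, 1] * !![(ξ - γ) ^ 2 * C, σ * ((ξ - γ) * (B + C));
        σ * ((ξ - γ) * (B + C)), σ ^ 2 * (A + 2 * B + C)] * !![-σ, -γ; 0, 1].transpose) := by
  have h : γ < ξ := by
    rw [← hγ, ← hξ]
    exact div_lt_div_of_pos_right (sub_lt_sub_right htT _) hσ
  have hd : ξ - γ ≠ 0 := by linarith
  have hP0 : Phi γ ≠ 0 := (Phi_pos _).ne'
  have hP0' : 1 - Phi γ ≠ 0 := (sub_pos.2 (Phi_lt_one _)).ne'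
  have hP1 : 1 - Phi ξ ≠ 0 := (sub_pos.2 (Phi_lt_one _)).ne'
  have hJe : (1 - Phi γ) - (1 - Phi ξ) = Phi ξ - Phi γ := by ring
  have hJ : Phi ξ - Phi γ ≠ 0 := (sub_pos.2 (strictMono_Phi h)).ne'
  have hR : T - t = σ * (ξ - γ) := by
    rw [← hγ, ← hξ]
    field_simp
    ring
  obtain ⟨iA, iB, iC⟩ := info_explicit h
  have hdet : A * C - B ^ 2 ≠ 0 := by
    rw [hA, hB, hC]
    exact (info_det_pos h).ne'
  rw [← hA] at iA
  rw [← hB] at iB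
  rw [← hC] at iC
  -- up to sign and the common factor `1 / (Φ(ξ) - Φ(γ))`, these are the entries of the information
  -- matrix with respect to the directions `(1, 1)` and `(0, ξ - γ)` of the `(u, v)`-plane
  obtain ⟨ψ1, h1⟩ : ∃ ψ1, ψ1 = -(1 + γ * (phi γ / ((1 - Phi γ) - (1 - Phi ξ)))
    - ξ * (phi ξ / ((1 - Phi γ) - (1 - Phi ξ)))
    + phi γ / Phi γ * (phi γ / ((1 - Phi γ) - (1 - Phi ξ)))
    + phi ξ / (1 - Phi ξ) * (phi ξ / ((1 - Phi γ) - (1 - Phi ξ)))) := ⟨_, rfl⟩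
  obtain ⟨ψ2, h2⟩ : ∃ ψ2, ψ2 = (T - t) * (phi ξ / ((1 - Phi γ) - (1 - Phi ξ))) / σ
      * (phi ξ / (1 - Phi ξ) - ξ) + (phi γ / ((1 - Phi γ) - (1 - Phi ξ))
      - phi ξ / ((1 - Phi γ) - (1 - Phi ξ)) - γ) := ⟨_, rfl⟩
  obtain ⟨ψ3, h3⟩ : ∃ ψ3, ψ3 = ((T - t) / σ) ^ 2 * (phi ξ / ((1 - Phi γ) - (1 - Phi ξ)))
      * (ξ - phi ξ / (1 - Phi ξ)) - (2 - γ * (phi γ / ((1 - Phi γ) - (1 - Phi ξ))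
      - phi ξ / ((1 - Phi γ) - (1 - Phi ξ)) - γ)
      - (phi ξ / ((1 - Phi γ) - (1 - Phi ξ))) * (T - t) / σ) := ⟨_, rfl⟩
  have hS : SMLE t T !₂[θ, σ] = ((((1 - Phi γ) - (1 - Phi ξ)) / (1 - Phi γ))⁻¹
      / ((1 - Phi γ) * (ψ1 * ψ3 - ψ2 ^ 2))) • (!![-σ, -γ; 0, 1]
        * !![-ψ3, σ * ψ2; σ * ψ2, -σ ^ 2 * ψ1] * !![-σ, -γ; 0, 1].transpose) := by
    subst hγ hξ h1 h2 h3
    rfl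
  rw [hJe] at h1 h2 h3 hS
  rw [hR] at h2 h3
  have k1 : ψ1 = -(A + 2 * B + C) / (Phi ξ - Phi γ) := by
    rw [h1, iA, iB, iC]
    field_simp
    ring
  have k2 : ψ2 = (ξ - γ) * (B + C) / (Phi ξ - Phi γ) := by
    rw [h2, iB, iC]
    field_simp
    ring
  have k3 : ψ3 = -((ξ - γ) ^ 2 * C) / (Phi ξ - Phi γ) := by
    rw [h3, iC]
    field_simp
    ring
  have kd : ψ1 * ψ3 - ψ2 ^ 2 = (ξ - γ) ^ 2 * (A * C - B ^ 2) / (Phi ξ - Phi γ) ^ 2 := by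
    rw [k1, k2, k3]
    field_simp
    ring
  have kM : !![-ψ3, σ * ψ2; σ * ψ2, -σ ^ 2 * ψ1] = (1 / (Phi ξ - Phi γ)) •
      !![(ξ - γ) ^ 2 * C, σ * ((ξ - γ) * (B + C));
        σ * ((ξ - γ) * (B + C)), σ ^ 2 * (A + 2 * B + C)] := by
    rw [k1, k2, k3]
    ext i j
    fin_cases i <;> fin_cases j <;> simp <;> ring
  rw [hS, kd, kM, Matrix.mul_smul, Matrix.smul_mul, smul_smul]
  congr 1
  field_simp

lemma SMLE_apply (hσ : 0 < σ) (htT : t < T) (hγ : (t - θ) / σ = γ) (hξ : (T - θ) / σ = ξ)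
    {A B C : ℝ} (hA : A = infoUU (meanStat γ ξ) γ ξ) (hB : B = infoUV (meanStat γ ξ) γ ξ)
    (hC : C = infoVV (meanStat γ ξ) γ ξ) (i j : Fin 2) :
    SMLE t T !₂[θ, σ] i j = (1 / ((ξ - γ) ^ 2 * (A * C - B ^ 2))) *
      (!![(σ * (ξ - γ)) ^ 2 * C + 2 * (γ * σ ^ 2 * (ξ - γ) * (B + C)) + (γ * σ) ^ 2
            * (A + 2 * B + C),
          -(σ ^ 2 * (ξ - γ) * (B + C)) - γ * σ ^ 2 * (A + 2 * B + C);
          -(σ ^ 2 * (ξ - γ) * (B + C)) - γ * σ ^ 2 * (A + 2 * B + C),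
          σ ^ 2 * (A + 2 * B + C)] : Matrix (Fin 2) (Fin 2) ℝ) i j := by
  have ht : !![-σ, -γ; 0, 1].transpose = !![-σ, 0; -γ, 1] := by
    ext i j
    fin_cases i <;> fin_cases j <;> rfl
  rw [SMLE_eq hσ htT hγ hξ hA hB hC, ht, Matrix.mul_fin_two, Matrix.mul_fin_two, Matrix.smul_apply,
    smul_eq_mul]
  congr 1
  fin_cases i <;> fin_cases j <;> simp <;> ring

lemma det_SMLE_pos (hσ : 0 < σ) (htT : t < T) : 0 < (SMLE t T !₂[θ, σ]).det := by
  have h : (t - θ) / σ < (T - θ) / σ := div_lt_div_of_pos_right (sub_lt_sub_right htT _) hσ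
  have hd := sub_pos.2 h
  have hI := info_det_pos h
  rw [SMLE_eq hσ htT rfl rfl rfl rfl rfl]
  set γ := (t - θ) / σ
  set ξ := (T - θ) / σ
  set A := infoUU (meanStat γ ξ) γ ξ
  set B := infoUV (meanStat γ ξ) γ ξ
  set C := infoVV (meanStat γ ξ) γ ξ
  rw [Matrix.det_smul, Matrix.det_mul, Matrix.det_mul, Matrix.det_transpose, Matrix.det_fin_two_of,
    Matrix.det_fin_two_of]
  have e : (-σ * 1 - -γ * 0) * ((ξ - γ) ^ 2 * C * (σ ^ 2 * (A + 2 * B + C))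
      - σ * ((ξ - γ) * (B + C)) * (σ * ((ξ - γ) * (B + C)))) * (-σ * 1 - -γ * 0)
      = σ ^ 4 * (ξ - γ) ^ 2 * (A * C - B ^ 2) := by ring
  rw [e]
  positivity

end matrix

/-! ### Asymptotics of the maximum likelihood estimator -/

lemma scoreU_sub (s s' : EuclideanSpace ℝ (Fin 5)) (u v : ℝ) :
    scoreU (s - s') u v = scoreU s u v - scoreU s' u v := by
  simp only [scoreU, uncensored, PiLp.sub_apply]
  ring

lemma scoreV_sub (s s' : EuclideanSpace ℝ (Fin 5)) (u v : ℝ) :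
    scoreV (s - s') u v = scoreV s u v - scoreV s' u v := by
  simp only [scoreV, uncensored, PiLp.sub_apply]
  ring

lemma scoreU_smul (r : ℝ) (s : EuclideanSpace ℝ (Fin 5)) (u v : ℝ) :
    scoreU (r • s) u v = r * scoreU s u v := by
  simp only [scoreU, uncensored, PiLp.smul_apply, smul_eq_mul]
  ring

lemma scoreV_smul (r : ℝ) (s : EuclideanSpace ℝ (Fin 5)) (u v : ℝ) :
    scoreV (r • s) u v = r * scoreV s u v := by
  simp only [scoreV, uncensored, PiLp.smul_apply, smul_eq_mul]
  ring

lemma continuous_uncensored : Continuous uncensored := by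
  unfold uncensored
  fun_prop

section mleAsymptotics

variable {Ω : Type*} [MeasurableSpace Ω] {P : Measure Ω} {Z : ℕ → Ω → ℝ} {c t T θ σ : ℝ}

lemma ae_payment_mem (hc : 0 < c) (htT : t < T)
    (hlaw : ∀ i, HasLaw (Z i) (paymentLaw c t T !₂[θ, σ]) P) :
    ∀ᵐ ω ∂P, ∀ i, 0 ≤ Z i ω ∧ Z i ω ≤ c * (T - t) := by
  rw [ae_all_iff]
  intro i
  have hms : MeasurableSet (Set.Icc 0 (c * (T - t))) := measurableSet_Icc
  have h1 : ∀ᵐ z ∂(paymentLaw c t T !₂[θ, σ]), z ∈ Set.Icc 0 (c * (T - t)) := by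
    refine (ae_map_iff (continuous_payment c t T).measurable.aemeasurable hms).2
      (ae_of_all _ fun x => ?_)
    rw [payment_eq hc htT]
    refine ⟨mul_nonneg hc.le (sub_nonneg.2 (le_max_left _ _)), ?_⟩
    gcongr
    exact max_le htT.le (min_le_left _ _)
  rw [← (hlaw i).map_eq] at h1
  exact ae_of_ae_map (hlaw i).aemeasurable h1

lemma censorStat_eq_obsStat (hc : 0 < c) (htT : t < T) (hσ : 0 < σ) (z : ℝ) :
    censorStat (z / (c * (T - t)))
      = obsStat ((t - θ) / σ) ((T - θ) / σ) (standardize c t θ σ z) := by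
  rw [obsStat, standardize, hZ]
  congr 1
  have := (sub_pos.2 htT).ne'
  rw [← sub_div, ← sub_div, div_div_div_cancel_right₀ hσ.ne', show T - θ - (t - θ) = T - t by ring]
  field_simp
  ring

/-- The average sufficient statistic of the first observations. -/
def avgStat (γ ξ : ℝ) (Y : ℕ → Ω → ℝ) (x : ℕ × Ω) : EuclideanSpace ℝ (Fin 5) :=
  (x.1 : ℝ)⁻¹ • ∑ i ∈ Finset.range x.1, obsStat γ ξ (Y i x.2)

lemma isAsympLinear_avgStat (γ ξ : ℝ) (Y : ℕ → Ω → ℝ) :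
    IsAsympLinear P Y (avgStat γ ξ Y) (meanStat γ ξ) (fun y => obsStat γ ξ y - meanStat γ ξ) := by
  refine isAsympLinear_euclidean fun i => ?_
  refine (isAsympLinear_mean (fun y => obsStat γ ξ y i) (meanStat γ ξ i)).congr
    (Eventually.of_forall fun x => ?_)
  simp [avgStat]

lemma isScore_obsStat {γ ξ : ℝ} (h : γ < ξ) :
    IsScore (clampLaw γ ξ) (fun y => obsStat γ ξ y - meanStat γ ξ) where
  measurable := (measurable_obsStat γ ξ).sub_const _
  bounded := by
    obtain ⟨C, hC⟩ := bounded_obsStat γ ξ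
    exact ⟨C + ‖meanStat γ ξ‖, fun y => (norm_sub_le _ _).trans (by linarith [hC y])⟩
  mean := by
    have hint := integrable_of_bounded (ν := clampLaw γ ξ) (measurable_obsStat γ ξ)
      (bounded_obsStat γ ξ)
    rw [integral_sub hint (integrable_const _), integral_const]
    ext i
    have e := (EuclideanSpace.proj (𝕜 := ℝ) i).integral_comp_comm hint
    have e' : (∫ y, obsStat γ ξ y ∂(clampLaw γ ξ)) i = meanStat γ ξ i :=
      e.symm.trans (integral_obsStat h i)
    simp [e']

/-- With probability tending to one, the maximum likelihood estimate is the solution of the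
likelihood equations near the true parameter. -/
lemma eventually_mle_eq (hc : 0 < c) (htT : t < T) (hσ : 0 < σ)
    (hlaw : ∀ i, HasLaw (Z i) (paymentLaw c t T !₂[θ, σ]) P) {γ ξ : ℝ}
    (hγ : (t - θ) / σ = γ) (hξ : (T - θ) / σ = ξ) {Y : ℕ → Ω → ℝ}
    (hYZ : ∀ i ω, Y i ω = standardize c t θ σ (Z i ω)) (h : γ < ξ)
    (hav : Tendsto (avgStat γ ξ Y) (inProb P) (𝓝 (meanStat γ ξ)))
    {G : EuclideanSpace ℝ (Fin 5) → Param} (hG : ContinuousAt G (meanStat γ ξ))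
    (hGs : G (meanStat γ ξ) = !₂[γ, ξ])
    (hsol : ∀ᶠ m in 𝓝 (meanStat γ ξ), scoreU m (G m 0) (G m 1) = 0 ∧ scoreV m (G m 0) (G m 1) = 0)
    {mle : (n : ℕ) → (Fin n → ℝ) → Param} (hmle : IsMLE c t T mle) :
    ∀ᶠ x in inProb P, paramOf t (T - t) (G (avgStat γ ξ Y x) 0) (G (avgStat γ ξ Y x) 1)
      = mle x.1 (fun i : Fin x.1 => Z i x.2) := by
  have hunc : ∀ᶠ x in inProb P, 0 < uncensored (avgStat γ ξ Y x) := by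
    refine ((continuous_uncensored.tendsto _).comp hav).eventually_const_lt ?_
    rw [uncensored_meanStat h]
    exact sub_pos.2 (strictMono_Phi h)
  have hGc := hG.tendsto.comp hav
  rw [hGs] at hGc
  have hlt : ∀ᶠ x in inProb P, G (avgStat γ ξ Y x) 0 < G (avgStat γ ξ Y x) 1 :=
    (((EuclideanSpace.proj (𝕜 := ℝ) (0 : Fin 2)).continuous.tendsto _).comp hGc).eventually_lt
      (((EuclideanSpace.proj (𝕜 := ℝ) (1 : Fin 2)).continuous.tendsto _).comp hGc) h
  have hran : ∀ᶠ x in inProb P, ∀ i, 0 ≤ Z i x.2 ∧ Z i x.2 ≤ c * (T - t) :=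
    eventually_inProb_of_ae (p := fun x => ∀ i, 0 ≤ Z i x.2 ∧ Z i x.2 ≤ c * (T - t))
      (Eventually.of_forall fun _ => ae_payment_mem hc htT hlaw)
  filter_upwards [hunc, hlt, hran, hav.eventually hsol,
    tendsto_fst_inProb.eventually (eventually_gt_atTop 0)] with x h1 h2 h3 h4 h5
  have hn : (0 : ℝ) < x.1 := by exact_mod_cast h5
  have hs : (x.1 : ℝ) • avgStat γ ξ Y x
      = ∑ i : Fin x.1, censorStat (Z i x.2 / (c * (T - t))) := by
    rw [avgStat, smul_smul, mul_inv_cancel₀ hn.ne', one_smul, Finset.sum_range]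
    refine Finset.sum_congr rfl fun i _ => ?_
    rw [censorStat_eq_obsStat (θ := θ) hc htT hσ, hγ, hξ, hYZ]
  have hiff := isLikelihoodMax_iff (z := fun i : Fin x.1 => Z i x.2) hc htT (fun i => h3 i) hs
    (by
      have : uncensored ((x.1 : ℝ) • avgStat γ ξ Y x) = x.1 * uncensored (avgStat γ ξ Y x) := by
        simp only [uncensored, PiLp.smul_apply, smul_eq_mul]
        ring
      rw [this]
      exact mul_pos hn h1) h2 (by rw [scoreU_smul, h4.1, mul_zero])
    (by rw [scoreV_smul, h4.2, mul_zero])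
  exact ((hiff _).1 ((hmle x.1).2 _ ⟨_, (hiff _).2 rfl⟩)).symm

lemma isAN_mle [IsProbabilityMeasure P] (hc : 0 < c) (htT : t < T) (hσ : 0 < σ)
    (hlaw : ∀ i, HasLaw (Z i) (paymentLaw c t T !₂[θ, σ]) P) (hindep : iIndepFun Z P)
    {mle : (n : ℕ) → (Fin n → ℝ) → Param} (hmle : IsMLE c t T mle) :
    IsAN P (fun n ω => mle n (fun i : Fin n => Z i ω)) !₂[θ, σ] (SMLE t T !₂[θ, σ]) := by
  obtain ⟨γ, hγ⟩ : ∃ γ, (t - θ) / σ = γ := ⟨_, rfl⟩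
  obtain ⟨ξ, hξ⟩ : ∃ ξ, (T - θ) / σ = ξ := ⟨_, rfl⟩
  obtain ⟨Y, hYZ, hY⟩ : ∃ Y : ℕ → Ω → ℝ, (∀ i ω, Y i ω = standardize c t θ σ (Z i ω)) ∧
      IsIID P Y (clampLaw γ ξ) :=
    ⟨_, fun _ _ => rfl, by
      rw [← hγ, ← hξ]
      exact isIID_standardize hc htT hσ hlaw hindep⟩
  have h : γ < ξ := by
    rw [← hγ, ← hξ]
    exact div_lt_div_of_pos_right (sub_lt_sub_right htT _) hσ
  have hd := sub_pos.2 h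
  have hR : T - t = σ * (ξ - γ) := by
    rw [← hγ, ← hξ]
    field_simp
    ring
  have hI := info_det_pos h
  obtain ⟨A, hA⟩ : ∃ A, A = infoUU (meanStat γ ξ) γ ξ := ⟨_, rfl⟩
  obtain ⟨B, hB⟩ : ∃ B, B = infoUV (meanStat γ ξ) γ ξ := ⟨_, rfl⟩
  obtain ⟨C, hC⟩ : ∃ C, C = infoVV (meanStat γ ξ) γ ξ := ⟨_, rfl⟩
  obtain ⟨sU, sV⟩ := score_meanStat h
  obtain ⟨G, G', hG, hGs, hsol, hG'⟩ := exists_likelihood_solution (s := meanStat γ ξ)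
    (β := !₂[γ, ξ]) h sU sV hI.ne'
  obtain ⟨K', hK, hK'⟩ := exists_paramOf_solution (t := t) (R := T - t) (β := !₂[γ, ξ]) h hG hGs
  have hψ := isScore_obsStat h
  have hT : IsTightSeq P (normSum Y fun y => obsStat γ ξ y - meanStat γ ξ) :=
    hY.isTightSeq_normSum (ι := Fin 5) hψ
  have hav := isAsympLinear_avgStat (P := P) γ ξ Y
  have hest := (hav.comp_hasFDerivAt hT hK).congr
    (eventually_mle_eq hc htT hσ hlaw hγ hξ hYZ h (hav.tendsto hT) hG.continuousAt hGs hsol hmle)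
  have hη : paramOf t (T - t) (G (meanStat γ ξ) 0) (G (meanStat γ ξ) 1) = !₂[θ, σ] := by
    rw [hGs, eq_paramOf (η := !₂[θ, σ]) hσ htT, ← hγ, ← hξ]
    rfl
  rw [hη] at hest
  have hscore := hψ.clm_comp K'
  rw [← hA, ← hB, ← hC] at hI
  -- the influence function is the inverse information applied to the score, pushed forward by the
  -- derivative of `paramOf`
  have hinf : ∀ y, K' (obsStat γ ξ y - meanStat γ ξ) 1
        = σ * (B + C) / ((ξ - γ) * (A * C - B ^ 2)) * scoreU (obsStat γ ξ y) γ ξ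
          + -(σ * (A + B) / ((ξ - γ) * (A * C - B ^ 2))) * scoreV (obsStat γ ξ y) γ ξ ∧
      K' (obsStat γ ξ y - meanStat γ ξ) 0
        = (-(σ * C / (A * C - B ^ 2)) - γ * (σ * (B + C) / ((ξ - γ) * (A * C - B ^ 2))))
            * scoreU (obsStat γ ξ y) γ ξ
          + (σ * B / (A * C - B ^ 2) + γ * (σ * (A + B) / ((ξ - γ) * (A * C - B ^ 2))))
            * scoreV (obsStat γ ξ y) γ ξ := fun y => by
    obtain ⟨k1, k0⟩ := hK' (obsStat γ ξ y - meanStat γ ξ)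
    obtain ⟨g0, g1⟩ := hG' (obsStat γ ξ y - meanStat γ ξ)
    set x := G' (obsStat γ ξ y - meanStat γ ξ)
    simp only [Matrix.cons_val_zero, Matrix.cons_val_one, Matrix.cons_val_fin_one, scoreU_sub,
      scoreV_sub, sU, sV, sub_zero, ← hA, ← hB, ← hC] at k0 k1 g0 g1
    have x0 : x 0 = (C * scoreU (obsStat γ ξ y) γ ξ - B * scoreV (obsStat γ ξ y) γ ξ)
        / (A * C - B ^ 2) := by
      rw [eq_div_iff hI.ne', ← g0, ← g1]
      ring
    have x1 : x 1 = (A * scoreV (obsStat γ ξ y) γ ξ - B * scoreU (obsStat γ ξ y) γ ξ)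
        / (A * C - B ^ 2) := by
      rw [eq_div_iff hI.ne', ← g0, ← g1]
      ring
    have e1 : K' (obsStat γ ξ y - meanStat γ ξ) 1
        = σ * (B + C) / ((ξ - γ) * (A * C - B ^ 2)) * scoreU (obsStat γ ξ y) γ ξ
          + -(σ * (A + B) / ((ξ - γ) * (A * C - B ^ 2))) * scoreV (obsStat γ ξ y) γ ξ := by
      rw [k1, x0, x1, hR]
      field_simp
      ring
    refine ⟨e1, ?_⟩
    rw [k0, e1, x0, hR]
    field_simp
    ring
  obtain ⟨bU, bV⟩ := bounded_scores h
  obtain ⟨iA, iB, iC⟩ := info_eq_integral h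
  have key := fun u w u' w' : ℝ => integral_lin_mul_lin (ν := clampLaw γ ξ)
    (measurable_scoreU_obsStat γ ξ) (measurable_scoreV_obsStat γ ξ) bU bV u w u' w'
  rw [iA, iB, iC, ← hA, ← hB, ← hC] at key
  have hcov : ∀ i j, SMLE t T !₂[θ, σ] i j
      = ∫ y, K' (obsStat γ ξ y - meanStat γ ξ) i * K' (obsStat γ ξ y - meanStat γ ξ) j
        ∂(clampLaw γ ξ) := fun i j => by
    rw [SMLE_apply hσ htT hγ hξ hA hB hC]
    fin_cases i <;> fin_cases j <;>
      simp only [Fin.zero_eta, Fin.mk_one, (hinf _).1, (hinf _).2] <;>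
      refine Eq.trans ?_ (key _ _ _ _).symm <;> simp <;> field_simp <;> ring
  exact hest.isAN hY (est := fun n ω => mle n (fun i : Fin n => Z i ω)) hscore
    (fun n => (hmle n).1.comp_aemeasurable
      (aemeasurable_pi_lambda _ fun i => (hlaw i).aemeasurable))
    (posSemidef_of_eq_integral hscore hcov) hcov

end mleAsymptotics

end MWM

end

theorem mainTheorem2 {Ω : Type*} [MeasurableSpace Ω] (P : Measure Ω) [IsProbabilityMeasure P]
    (c t T θ σ a b : ℝ) (hc : 0 < c) (htT : t < T) (hσ : 0 < σ)
    (hcase : MWM.FullyObserved a b t T !₂[θ, σ])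
    (Z : ℕ → Ω → ℝ) (hlaw : ∀ i, HasLaw (Z i) (MWM.paymentLaw c t T !₂[θ, σ]) P)
    (hindep : iIndepFun Z P)
    (m m' : ℕ → ℕ)
    (hm : Tendsto (fun n : ℕ => √(n : ℝ) * ((m n : ℝ) / n - a)) atTop (𝓝 0))
    (hm' : Tendsto (fun n : ℕ => √(n : ℝ) * ((m' n : ℝ) / n - b)) atTop (𝓝 0)) :
    -- closed form of the estimators
    0 < MWM.ck a b 2 - MWM.ck a b 1 ^ 2 ∧
    (∀ (n k k' : ℕ) (z : Fin n → ℝ) (η : MWM.Param),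
      MWM.IsMWM c t T a b k k' z η ↔
        0 < η 1 ∧ MWM.FullyObserved a b t T η ∧ η = MWM.mwm c t a b k k' z) ∧
    -- explicit partial derivatives of the constants
    (∀ k : ℕ,
      HasDerivAt (fun x => MWM.ck x b k)
        (k * a * MWM.quantile (gaussianReal 0 1) a ^ (k - 1) / MWM.phi (MWM.quantile (gaussianReal 0 1) a)) a ∧
      HasDerivAt (fun y => MWM.ck a y k)
        (-(k * b * MWM.quantile (gaussianReal 0 1) (1 - b) ^ (k - 1) / MWM.phi (MWM.quantile (gaussianReal 0 1) (1 - b)))) b) ∧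
    (MWM.normalCDF !₂[θ, σ] t < a → 1 - b < MWM.normalCDF !₂[θ, σ] T →
      -- the winsorized observations include all the censored ones, with probability tending to one
      Tendsto (fun n : ℕ => P {ω | Nat.card {i : Fin n // Z i ω = 0} ≤ m n ∧
        Nat.card {i : Fin n // Z i ω = c * (T - t)} ≤ m' n}) atTop (𝓝 1) ∧
      -- the estimators exist, with probability tending to one
      Tendsto (fun n : ℕ => P {ω | MWM.IsMWM c t T a b (m n) (m' n) (fun i : Fin n => Z i ω)
        (MWM.mwm c t a b (m n) (m' n) (fun i : Fin n => Z i ω))}) atTop (𝓝 1) ∧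
      -- asymptotic normality
      MWM.IsAN P (fun n ω => MWM.mwm c t a b (m n) (m' n) (fun i : Fin n => Z i ω)) !₂[θ, σ]
        (MWM.SMWM a b σ) ∧
      -- asymptotic relative efficiency with respect to maximum likelihood
      ∀ mle : (n : ℕ) → (Fin n → ℝ) → MWM.Param, MWM.IsMLE c t T mle →
        MWM.IsAN P (fun n ω => mle n (fun i : Fin n => Z i ω)) !₂[θ, σ]
          (MWM.SMLE t T !₂[θ, σ]) ∧
        MWM.HasARE P (fun n ω => MWM.mwm c t a b (m n) (m' n) (fun i : Fin n => Z i ω))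
          (fun n ω => mle n (fun i : Fin n => Z i ω)) !₂[θ, σ]
          (√((MWM.SMLE t T !₂[θ, σ]).det / (MWM.SMWM a b σ).det))) := by
  obtain ⟨ha, hb⟩ := hcase.pos
  have hab := hcase.2.1
  refine ⟨MWM.ck_two_sub_sq_pos ha hab hb, fun n k k' z η => MWM.isMWM_iff hc htT z, fun k =>
    ⟨MWM.hasDerivAt_ck_left ha hab hb k, MWM.hasDerivAt_ck_right ha hab hb k⟩, fun hγ hξ => ?_⟩
  rw [MWM.normalCDF_lt_iff ha (by linarith)] at hγ
  rw [MWM.lt_normalCDF_iff (ha.trans hab) (by linarith)] at hξ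
  have hAN := MWM.isAN_mwm hc htT hσ hlaw hindep ha hab hb hγ hξ hm hm'
  refine ⟨MWM.tendsto_measure_censored hc htT hσ hlaw hindep ha hab hb hγ hξ hm hm',
    MWM.tendsto_measure_isMWM hc htT hσ hlaw hindep ha hab hb hγ hξ hm hm', hAN,
    fun mle hmle => ?_⟩
  have hMLE : MWM.IsAN P (fun n ω => mle n (fun i : Fin n => Z i ω)) !₂[θ, σ]
      (MWM.SMLE t T !₂[θ, σ]) :=
    MWM.isAN_mle hc htT hσ hlaw hindep hmle
  exact ⟨hMLE, _, _, hAN, hMLE, MWM.det_SMWM_pos ha hab hb hσ,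
    MWM.det_SMLE_pos hσ htT, rfl⟩
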